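/- **Setting.** Let $E$ be a Lusin topological space (a homeomorph of a Borel subset of a compact metric space), $M(E)$ the space of finite Borel measures on $E$ with the topology of weak convergence, $M(E)^\circ=M(E)\setminus\{0\}$, and $B(E)^+$ the set of bounded nonnegative Borel functions on $E$. Write $\mu(f)=\int f\,d\mu$ and $L_R(f)=\int_{M(E)}e^{-\nu(f)}R(d\nu)$ for a probability measure $R$ on $M(E)$; $\|\cdot\|_{\mathrm{var}}$ is the total variation norm ($\|R_1-R_2\|_{\mathrm{var}}=|R_1-R_2|(M(E))$) and $*$ is convolution on $M(E)$. Let $\xi$ be a Borel right process in $E$ with (not necessarily conservative) transition semigroup $(P_t)_{t\ge0}$. Let $b$ be a bounded Borel function on $E$, $c\in B(E)^+$, $\eta(x,dy)$ a bounded kernel on $E$ and $H(x,d\nu)$ a $\sigma$-finite kernel from $E$ to $M(E)^\circ$ with $$\sup_{x\in E}\int_{M(E)^\circ}\big[\nu(1)\wedge\nu(1)^2+\nu_x(1)\big]H(x,d\nu)<\infty,$$ where $\nu_x$ is the restriction of $\nu$ to $E\setminus\{x\}$. Put $$\phi(x,f)=b(x)f(x)+c(x)f(x)^2-\eta(x,f)+\int_{M(E)^\circ}\big[e^{-\nu(f)}-1+f(x)\nu(\{x\})\big]H(x,d\nu),$$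 $$\gamma(x,dy)=\eta(x,dy)+\int_{M(E)^\circ}\nu_x(dy)\,H(x,d\nu),$$ $$\phi_1(x,z)=[b(x)-\gamma(x,1)]z+c(x)z^2+\int_{M(E)^\circ}\big[e^{-z\nu(\{x\})}-1+z\nu(\{x\})\big]H(x,d\nu).$$ Let $(Q_t)_{t\ge0}$ be the transition semigroup on $M(E)$ of the $(\xi,\phi)$-superprocess: with $V_tf(x)=-\log\int e^{-\nu(f)}Q_t(\delta_x,d\nu)$, for every $f\in B(E)^+$ one has $\int e^{-\nu(f)}Q_t(\mu,d\nu)=e^{-\mu(V_tf)}$ for all $\mu\in M(E)$, $t\ge0$, and $(t,x)\mapsto V_tf(x)$ is the locally bounded positive Borel solution of $$V_tf(x)=P_tf(x)-\int_0^t ds\int_E\phi(y,V_sf)\,P_{t-s}(x,dy).$$ Put $\pi_tf(x)=\int\nu(f)\,Q_t(\delta_x,d\nu)$ and $\bar V_t(x)=\lim_{\lambda\to\infty}V_t\lambda(x)$. Let $\mathcal K(P)$ be the set of entrance laws $\kappa=(\kappa_t)_{t>0}$ for $(P_t)$ with $\int_0^1\kappa_s(1)\,ds<\infty$, with the $\sigma$-algebra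 generated by the maps $\kappa\mapsto\kappa_t(f)$, and let $\mathcal K(P)^\circ=\mathcal K(P)\setminus\{0\}$. For $\kappa\in\mathcal K(P)$ put $$\pi_t(\kappa,f)=\kappa_t(f)+\int_0^t\kappa_{t-s}\big((\gamma-b)\pi_sf\big)ds,\qquad V_t(\kappa,f)=\kappa_t(f)-\int_0^t ds\int_E\phi(y,V_sf)\,\kappa_{t-s}(dy).$$ Let $\kappa\in\mathcal K(P)$ and let $F$ be a $\sigma$-finite measure on $\mathcal K(P)^\circ$ with $\int_0^1ds\int\nu_s(1)F(d\nu)<\infty$. Put $I_t(\kappa,F,f)=V_t(\kappa,f)+\int_{\mathcal K(P)^\circ}(1-e^{-V_t(\nu,f)})F(d\nu)$, and let $(N_t)_{t\ge0}$ be the skew convolution semigroup associated with $(Q_t)$ (probability measures on $M(E)$ with $N_{r+t}=(N_rQ_t)*N_t$) given by $$L_{N_t}(f)=\exp\Big\{-\int_0^tI_s(\kappa,F,f)\,ds\Big\},\qquad t\ge0,\ f\in B(E)^+.$$ Let $Q^N_t(\mu,\cdot)=Q_t(\mu,\cdot)*N_t$. **Assumptions.** Suppose that $$\int_0^\infty\Big[\pi_s(\kappa,1)+\int_{\mathcal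 K(P)^\circ}\pi_s(\nu,1)F(d\nu)\Big]ds<\infty,$$ and that $\phi_1(x,z)\ge\phi_*(z)$ for all $x\in E$, $z\ge0$, where $\phi_*(z)=b_*z+c_*z^2+\int_{(0,\infty)}(e^{-zu}-1+zu)\,m_*(du)$ with $b_*\in\mathbb R$, $c_*\ge0$ and $\int_{(0,\infty)}(u\wedge u^2)\,m_*(du)<\infty$ satisfies Grey's condition: $\phi_*(z)>0$ for all sufficiently large $z$, and $\int^\infty\phi_*(z)^{-1}dz<\infty$. **Conclusion.** There is a probability measure $N_\infty$ on $M(E)$ with $\int\nu(1)N_\infty(d\nu)<\infty$ and $L_{N_\infty}(f)=\exp\{-\int_0^\infty I_s(\kappa,F,f)\,ds\}$ for $f\in B(E)^+$ (the integral being finite), such that: (i) $\lim_{t\to\infty}\|N_t-N_\infty\|_{\mathrm{var}}=0$. (ii) If $\lim_{t\to\infty}\bar V_t(x)=0$ for every $x\in E$, then $\lim_{t\to\infty}\|Q^N_t(\mu,\cdot)-N_\infty\|_{\mathrm{var}}=0$ for every $\mu\in M(E)$. (iii) If $\beta_*:=\inf_{x\in E}[b(x)-\gamma(x,1)]>0$,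 then there is a constant $C\ge0$ such that $\|Q^N_t(\mu,\cdot)-N_\infty\|_{\mathrm{var}}\le C(1+\mu(1))e^{-\beta_*t}$ for all $t\ge0$ and $\mu\in M(E)$. -/

import Mathlib

open MeasureTheory ProbabilityTheory Filter Topology Set
open scoped NNReal ENNReal

universe u v

noncomputable section

namespace ImmigrationSuperprocess

/-! ### State space, functions, distances -/

/-- A Lusin topological space: a homeomorph of a Borel subset of a compact metric space. -/
def IsLusinSpace (E : Type u) [TopologicalSpace E] : Prop :=
  ∃ (K : Type u) (_ : MetricSpace K) (_ : CompactSpace K) (i : E → K),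
    IsEmbedding i ∧ @MeasurableSet K (borel K) (Set.range i)

/-- `f ∈ B(E)⁺`: a bounded nonnegative Borel function. -/
structure IsBddBorelNonneg {E : Type u} [MeasurableSpace E] (f : E → ℝ) : Prop where
  measurable : Measurable f
  nonneg : ∀ x, 0 ≤ f x
  bounded : ∃ C : ℝ, ∀ x, f x ≤ C

/-- The total variation distance `|μ - ν|(S)`, where `|μ - ν|` is the total variation measure of
the signed measure `μ - ν`. -/
def tvDist {S : Type u} [MeasurableSpace S] (μ ν : Measure S) [IsFiniteMeasure μ]
    [IsFiniteMeasure ν] : ℝ :=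
  ((μ.toSignedMeasure - ν.toSignedMeasure).totalVariation Set.univ).toReal

/-! The space `M(E)` of finite Borel measures is `FiniteMeasure E`. It carries the σ-algebra
generated by the evaluations `ν ↦ ν B`, which for a Lusin space `E` is the Borel σ-algebra of the
topology of weak convergence. -/

/-- The unit point mass at `x`, as an element of `M(E)`. -/
def diracFM {E : Type u} [MeasurableSpace E] (x : E) : FiniteMeasure E :=
  ⟨Measure.dirac x, inferInstance⟩

/-- The Laplace functional `L_R(f) = ∫ e^{-ν(f)} R(dν)` of a measure `R` on `M(E)`. -/
def laplace {E : Type u} [MeasurableSpace E] (R : Measure (FiniteMeasure E)) (f : E → ℝ) : ℝ :=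
  ∫ ν, Real.exp (-∫ x, f x ∂(ν : Measure E)) ∂(R)

/-! ### Transition semigroups and Borel right processes -/

/-- A (possibly non-conservative) Borel transition semigroup with `P₀ = id`. -/
structure IsTransitionSemigroup {S : Type u} [MeasurableSpace S] (P : ℝ≥0 → Kernel S S) :
    Prop where
  zero : P 0 = Kernel.id
  add : ∀ s t, P (s + t) = P t ∘ₖ P s
  le_one : ∀ t x, P t x Set.univ ≤ 1

/-- `(Ω, ℱ, ξ, Pr)` is a Borel right process in `E` with transition semigroup `P`: a normal,
right continuous, strong Markov process. The isolated cemetery point `∂ = Sum.inr ()` is adjoined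
to `E`, since `P` need not be conservative. The strong Markov property is required at all optional
times `τ` (stopping times of the right-continuous filtration `ℱ_{t+}`), for all `A ∈ ℱ_{τ+}`. -/
structure IsBorelRightProcess {E : Type u} [TopologicalSpace E] [MeasurableSpace E]
    {Ω : Type v} {mΩ : MeasurableSpace Ω} (P : ℝ≥0 → Kernel E E) (ℱ : Filtration ℝ≥0 mΩ)
    (ξ : ℝ≥0 → Ω → E ⊕ Unit) (Pr : E → Measure Ω) : Prop where
  semigroup : IsTransitionSemigroup P
  prob : ∀ x, IsProbabilityMeasure (Pr x)
  adapted : ∀ t, Measurable[ℱ t] (ξ t)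
  right_continuous : ∀ ω t, ContinuousWithinAt (fun s => ξ s ω) (Set.Ici t) t
  normal : ∀ x, ∀ᵐ ω ∂(Pr x), ξ 0 ω = Sum.inl x
  strong_markov : ∀ (x : E) (τ : Ω → WithTop ℝ≥0) (hτ : IsStoppingTime ℱ.rightCont τ)
    (A : Set Ω), MeasurableSet[hτ.measurableSpace] A →
    ∀ (t : ℝ≥0) (B : Set E), MeasurableSet B →
      Pr x (A ∩ {ω | τ ω ≠ ⊤ ∧ ξ ((τ ω).untopA + t) ω ∈ Sum.inl '' B})
        = ∫⁻ ω in A ∩ {ω | τ ω ≠ ⊤},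
            Sum.elim (fun y => P t y B) (fun _ => 0) (ξ (τ ω).untopA ω) ∂(Pr x)

/-! ### Branching mechanisms -/

/-- The data of a branching mechanism on `E`. The Lévy kernel `H` from `E` to `M(E) ∖ {0}` is
encoded as a kernel to `M(E)` which does not charge `0`; its σ-finiteness follows from
`H_moment`. -/
structure BranchingMechanism (E : Type u) [MeasurableSpace E] where
  b : E → ℝ
  c : E → ℝ
  η : Kernel E E
  H : Kernel E (FiniteMeasure E)
  b_measurable : Measurable b
  b_bounded : ∃ C : ℝ, ∀ x, |b x| ≤ C
  c_bddBorelNonneg : IsBddBorelNonneg c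
  η_bounded : ∃ C : ℝ≥0, ∀ x, η x Set.univ ≤ C
  H_zero : ∀ x, H x {0} = 0
  H_moment : ∃ C : ℝ≥0, ∀ x,
    ∫⁻ ν, (min ((ν : Measure E) Set.univ) ((ν : Measure E) Set.univ ^ 2)
      + (ν : Measure E) {x}ᶜ) ∂(H x) ≤ C

namespace BranchingMechanism

variable {E : Type u} [MeasurableSpace E] (φ : BranchingMechanism E)

/-- `φ(x,f) = b(x)f(x) + c(x)f(x)² - η(x,f) + ∫ [e^{-ν(f)} - 1 + f(x)ν({x})] H(x,dν)`. -/
def eval (x : E) (f : E → ℝ) : ℝ :=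
  φ.b x * f x + φ.c x * f x ^ 2 - ∫ y, f y ∂(φ.η x)
    + ∫ ν, (Real.exp (-∫ y, f y ∂(ν : Measure E)) - 1 + f x * (ν : Measure E).real {x}) ∂(φ.H x)

/-- `γ(x,dy) = η(x,dy) + ∫ ν_x(dy) H(x,dν)`, where `ν_x` is the restriction of `ν` to
`E ∖ {x}`. -/
def γ (x : E) : Measure E :=
  φ.η x + (φ.H x).bind (fun ν => (ν : Measure E).restrict {x}ᶜ)

/-- The local projection
`φ₁(x,z) = [b(x) - γ(x,1)]z + c(x)z² + ∫ [e^{-zν({x})} - 1 + zν({x})] H(x,dν)`. -/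
def localProjection (x : E) (z : ℝ) : ℝ :=
  (φ.b x - (φ.γ x).real Set.univ) * z + φ.c x * z ^ 2
    + ∫ ν, (Real.exp (-(z * (ν : Measure E).real {x})) - 1 + z * (ν : Measure E).real {x}) ∂(φ.H x)

/-- `β_* = inf_x [b(x) - γ(x,1)]`. -/
def betaStar : ℝ := ⨅ x, (φ.b x - (φ.γ x).real Set.univ)

end BranchingMechanism

/-- The data of a spatially independent (CB) branching mechanism; only the restriction of `m` to
`(0,∞)` plays a role. -/
structure CBMechanism where
  b : ℝ
  c : ℝ
  m : Measure ℝ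
  c_nonneg : 0 ≤ c
  m_moment : ∫⁻ u in Set.Ioi (0 : ℝ), ENNReal.ofReal (min u (u ^ 2)) ∂m < ⊤

namespace CBMechanism

/-- `φ_*(z) = b z + c z² + ∫_{(0,∞)} (e^{-zu} - 1 + zu) m(du)`. -/
def eval (ψ : CBMechanism) (z : ℝ) : ℝ :=
  ψ.b * z + ψ.c * z ^ 2 + ∫ u in Set.Ioi (0 : ℝ), (Real.exp (-(z * u)) - 1 + z * u) ∂ψ.m

/-- Grey's condition: `φ_*(z) > 0` for large `z`, and `∫^∞ φ_*(z)⁻¹ dz < ∞`. -/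
def Grey (ψ : CBMechanism) : Prop :=
  ∃ z₀ : ℝ, 0 < z₀ ∧ (∀ z, z₀ ≤ z → 0 < ψ.eval z) ∧
    IntegrableOn (fun z => (ψ.eval z)⁻¹) (Set.Ioi z₀) volume

end CBMechanism

/-! ### Dawson--Watanabe superprocesses -/

section Superprocess

variable {E : Type u} [MeasurableSpace E]

/-- `V_t f(x) = -log ∫ e^{-ν(f)} Q_t(δ_x,dν)`. -/
def cumulant (Q : ℝ≥0 → Kernel (FiniteMeasure E) (FiniteMeasure E)) (t : ℝ≥0) (f : E → ℝ)
    (x : E) : ℝ :=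
  -Real.log (laplace (Q t (diracFM x)) f)

/-- `π_t f(x) = ∫ ν(f) Q_t(δ_x,dν)`. -/
def moment (Q : ℝ≥0 → Kernel (FiniteMeasure E) (FiniteMeasure E)) (t : ℝ≥0) (f : E → ℝ)
    (x : E) : ℝ :=
  ∫ ν, (∫ y, f y ∂(ν : Measure E)) ∂(Q t (diracFM x))

/-- `V̄_t(x) = lim_{λ → ∞} V_t λ(x) ∈ [0,∞]`; the limit is increasing in the constant `λ`, hence
a supremum. -/
def cumulantBar (Q : ℝ≥0 → Kernel (FiniteMeasure E) (FiniteMeasure E)) (t : ℝ≥0) (x : E) :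
    ℝ≥0∞ :=
  ⨆ l : ℝ≥0, ENNReal.ofReal (cumulant Q t (fun _ => (l : ℝ)) x)

/-- `Q` is the transition semigroup of the superprocess with spatial motion of semigroup `P` and
branching mechanism `φ`: a conservative transition semigroup on `M(E)` with the branching property
`∫ e^{-ν(f)} Q_t(μ,dν) = e^{-μ(V_t f)}`, whose cumulant semigroup `(t,x) ↦ V_t f(x)` is the locally
bounded positive Borel solution of
`V_t f(x) = P_t f(x) - ∫₀ᵗ ds ∫ φ(y,V_s f) P_{t-s}(x,dy)`. -/
structure IsSuperprocessSemigroup (P : ℝ≥0 → Kernel E E) (φ : BranchingMechanism E)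
    (Q : ℝ≥0 → Kernel (FiniteMeasure E) (FiniteMeasure E)) : Prop where
  semigroup : IsTransitionSemigroup Q
  conservative : ∀ t, IsMarkovKernel (Q t)
  branching : ∀ t (μ : FiniteMeasure E) (f : E → ℝ), IsBddBorelNonneg f →
    laplace (Q t μ) f = Real.exp (-∫ x, cumulant Q t f x ∂(μ : Measure E))
  measurable : ∀ f : E → ℝ, IsBddBorelNonneg f →
    Measurable (fun p : ℝ≥0 × E => cumulant Q p.1 f p.2)
  locally_bounded : ∀ f : E → ℝ, IsBddBorelNonneg f →
    ∀ T : ℝ≥0, ∃ C : ℝ, ∀ t ≤ T, ∀ x, cumulant Q t f x ≤ C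
  evolution : ∀ f : E → ℝ, IsBddBorelNonneg f → ∀ (t : ℝ≥0) (x : E),
    cumulant Q t f x = ∫ y, f y ∂(P t x)
      - ∫ s in (0 : ℝ)..t, ∫ y, φ.eval y (cumulant Q s.toNNReal f) ∂(P (t - s).toNNReal x)

/-! ### Immigration -/

/-- The set `𝒦(P)` of entrance laws `(κ_t)_{t>0}` for `P` with `∫₀¹ κ_s(1) ds < ∞`. Only `t > 0`
matters, so that the value at `t = 0` is normalized to `0`. (Each `κ_t` is then finite.) -/
@[ext]
structure EntranceLaw (P : ℝ≥0 → Kernel E E) where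
  law : ℝ≥0 → Measure E
  law_zero : law 0 = 0
  entrance : ∀ r t : ℝ≥0, 0 < r → law (r + t) = (law r).bind (P t)
  integrable : ∫⁻ s in Set.Ioc (0 : ℝ) 1, law s.toNNReal Set.univ < ⊤

variable {P : ℝ≥0 → Kernel E E}

/-- The σ-algebra on `𝒦(P)` generated by the maps `κ ↦ κ_t(B)`. -/
instance : MeasurableSpace (EntranceLaw P) := MeasurableSpace.comap EntranceLaw.law inferInstance

instance : Zero (EntranceLaw P) :=
  ⟨⟨fun _ => 0, rfl, fun _ _ _ => by simp, by simp⟩⟩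

/-- `π_t(κ,f) = κ_t(f) + ∫₀ᵗ κ_{t-s}((γ-b)π_s f) ds`. -/
def EntranceLaw.moment (φ : BranchingMechanism E)
    (Q : ℝ≥0 → Kernel (FiniteMeasure E) (FiniteMeasure E)) (κ : EntranceLaw P) (t : ℝ≥0)
    (f : E → ℝ) : ℝ :=
  ∫ y, f y ∂(κ.law t)
    + ∫ s in (0 : ℝ)..t, ∫ y,
        ((∫ z, ImmigrationSuperprocess.moment Q s.toNNReal f z ∂(φ.γ y))
          - φ.b y * ImmigrationSuperprocess.moment Q s.toNNReal f y) ∂(κ.law (t - s).toNNReal)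

/-- `V_t(κ,f) = κ_t(f) - ∫₀ᵗ ds ∫ φ(y,V_s f) κ_{t-s}(dy)`. -/
def EntranceLaw.cumulant (φ : BranchingMechanism E)
    (Q : ℝ≥0 → Kernel (FiniteMeasure E) (FiniteMeasure E)) (κ : EntranceLaw P) (t : ℝ≥0)
    (f : E → ℝ) : ℝ :=
  ∫ y, f y ∂(κ.law t)
    - ∫ s in (0 : ℝ)..t, ∫ y,
        φ.eval y (ImmigrationSuperprocess.cumulant Q s.toNNReal f) ∂(κ.law (t - s).toNNReal)

/-- `I_t(κ,F,f) = V_t(κ,f) + ∫ (1 - e^{-V_t(ν,f)}) F(dν)`. -/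
def immigrationExponent (φ : BranchingMechanism E)
    (Q : ℝ≥0 → Kernel (FiniteMeasure E) (FiniteMeasure E)) (κ : EntranceLaw P)
    (F : Measure (EntranceLaw P)) (t : ℝ≥0) (f : E → ℝ) : ℝ :=
  κ.cumulant φ Q t f + ∫ ν : EntranceLaw P, (1 - Real.exp (-(ν.cumulant φ Q t f))) ∂F

/-- `N` is a skew convolution semigroup associated with `Q`: `N_{r+t} = (N_r Q_t) * N_t`. -/
def IsSkewConvolutionSemigroup (Q : ℝ≥0 → Kernel (FiniteMeasure E) (FiniteMeasure E))
    (N : ℝ≥0 → ProbabilityMeasure (FiniteMeasure E)) : Prop :=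
  ∀ r t : ℝ≥0, (N (r + t) : Measure (FiniteMeasure E))
    = (((N r : Measure (FiniteMeasure E)).bind (Q t)).conv (N t : Measure (FiniteMeasure E)))

/-- The transition semigroup with immigration, `Q^N_t(μ,·) = Q_t(μ,·) * N_t`. -/
def immigrationTransition (Q : ℝ≥0 → Kernel (FiniteMeasure E) (FiniteMeasure E))
    (N : ℝ≥0 → ProbabilityMeasure (FiniteMeasure E)) (t : ℝ≥0) (μ : FiniteMeasure E) :
    Measure (FiniteMeasure E) :=
  (Q t μ).conv (N t : Measure (FiniteMeasure E))

instance (Q : ℝ≥0 → Kernel (FiniteMeasure E) (FiniteMeasure E)) [∀ t, IsMarkovKernel (Q t)]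
    (N : ℝ≥0 → ProbabilityMeasure (FiniteMeasure E)) (t : ℝ≥0) (μ : FiniteMeasure E) :
    IsFiniteMeasure (immigrationTransition Q N t μ) := by
  unfold immigrationTransition; infer_instance

end Superprocess

end ImmigrationSuperprocess

end

/-!
# Ergodicity of superprocesses with immigration

By the skew convolution property, `N_{r+t} = (N_r Q_t) * N_t`: the population at time `r + t`
consists of an independent copy of `N_t`, due to the immigration during the last `t` units of time,
and of what the superprocess makes in time `t` of the older immigrants. All total variation bounds
come from extinction: since `R * N ≥ R({0}) N`, convolving a probability measure with a law `R`
moves it by at most `1 - R({0})` on each set (`abs_measureReal_conv_sub_le`), and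
`R({0}) = lim_n L_R(n)` is computed from Laplace functionals.

**Coming down from infinity.** `φ(x, f) ≥ φ₁(x, f(x)) + γ(x, 1) f(x) - γ(x, f)`, so that `V_t f` is
dominated by solutions of `U' = -p U + q` whenever `φ₁(x, z) ≥ p z - q` for all `x`
(`cumulant_le_of_affine`). With `p = β_*` and `q = 0` this gives `V_t f ≤ ‖f‖ e^{-β_* t}`
(`cumulant_le_exp`). With tangent lines of the convex function `φ_* ≤ φ₁`, `V` descends from level
`2z` to level `z` within time `z / φ_*(z)`. By Grey's condition these times, summed along `z = 2ⁿ z₀`,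
are finite, hence `V_T f ≤ C` for some `T`, `C` and all `f` (`exists_cumulant_le`).

**Entrance laws.** `V_t(κ, f)` is the limit of `κ_r(V_{t-r} f)` as `r → 0`, so it inherits positivity
and monotonicity from `V`. As `θ → 0`, `V_t(κ, θ) / θ → π_t(κ, 1)`, while Jensen's inequality makes
`V_t(κ, θ) / θ` decrease in `θ`. Therefore `V_t(κ, f) ≤ ‖f‖ π_t(κ, 1)` (`law_cumulant_le_moment`).
Consequently `I_s(κ, F, f)` is at most `‖f‖` times the rate `π_s(κ, 1) + ∫ π_s(ν, 1) F(dν)`, which is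
the density of the finite measure `ρ` (`immigrationMeasure`), and `I_{s+T}(κ, F, f)` is at most `C`
times that rate, whatever `f` is.

**Convergence.** `N_r Q_t` has Laplace functional `exp (-∫_t^{t+r} I_s ds)`, so for `t ≥ T` it gives
`{0}` at least the mass `exp (-C ρ((t - T, t + r - T]))`. With `A_t = C ρ((t - T, ∞))` this says that
`e^{-A_t} N_t` increases for `t ≥ T`. Since `A_t → 0`, the `N_t` converge setwise to a probability
measure `N_∞` (`exists_limit`), within `A_t` on each set. Its first moment is finite as
`L_{N_∞}(a) ≥ 1 - a ρ((0, ∞))` for `a > 0`. The remaining term `Q_t(μ, ·)` gives `{0}` at least the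
mass `1 - sup_n μ(V_t n)`, which tends to `1` by dominated convergence if `V̄_t → 0`. If `β_* > 0`,
both extinction probabilities are bounded through `V_t n ≤ C e^{-β_*(t - T)}`.
-/

noncomputable section

namespace ImmigrationSuperprocess

section

/-! ### Total variation, monotone limits of measures, and Laplace functionals -/

section General

variable {S : Type*} [MeasurableSpace S]

/-- Evaluate the total variation of `μ - ν` on the two parts of a Hahn decomposition. -/
theorem tvDist_le_two_mul {μ ν : Measure S} [IsFiniteMeasure μ] [IsFiniteMeasure ν] {δ : ℝ}
    (h : ∀ A, MeasurableSet A → |μ.real A - ν.real A| ≤ δ) :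
    tvDist μ ν ≤ 2 * δ := by
  set s := μ.toSignedMeasure - ν.toSignedMeasure with hs
  have key : ∀ A, MeasurableSet A → s A = μ.real A - ν.real A := by
    intro A hA
    rw [hs, sub_apply, Measure.toSignedMeasure_apply_measurable hA,
      Measure.toSignedMeasure_apply_measurable hA]
  obtain ⟨i, hi, hi1, hi2, hp, hn⟩ := s.toJordanDecomposition_spec
  have e1 : s.toJordanDecomposition.posPart univ = ENNReal.ofReal (s i) := by
    rw [hp, SignedMeasure.toMeasureOfZeroLE_apply _ hi1 hi MeasurableSet.univ,
      ← ENNReal.ofReal_coe_nnreal]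
    simp
  have e2 : s.toJordanDecomposition.negPart univ = ENNReal.ofReal (-s iᶜ) := by
    rw [hn, SignedMeasure.toMeasureOfLEZero_apply _ hi2 hi.compl MeasurableSet.univ,
      ← ENNReal.ofReal_coe_nnreal]
    simp
  have h1 := abs_le.1 (h i hi)
  have h2 := abs_le.1 (h iᶜ hi.compl)
  unfold tvDist
  rw [← hs, SignedMeasure.totalVariation, Measure.add_apply, e1, e2,
    ENNReal.toReal_add ENNReal.ofReal_ne_top ENNReal.ofReal_ne_top, ENNReal.toReal_ofReal',
    ENNReal.toReal_ofReal', key i hi, key iᶜ hi.compl]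
  have : 0 ≤ δ := (abs_nonneg _).trans (h i hi)
  have := max_le h1.2 this
  have := max_le (a := -(μ.real iᶜ - ν.real iᶜ)) (b := 0) (c := δ) (by linarith) (by linarith)
  linarith

/-- If `ν ≥ (1 - δ) μ` for probability measures `μ` and `ν`, the two differ by at most `δ` on
each set: apply the minorization to the set and to its complement. -/
theorem abs_measureReal_sub_le_of_minorant {μ ν : Measure S} [IsProbabilityMeasure μ]
    [IsProbabilityMeasure ν] {δ : ℝ} (hδ : 0 ≤ δ)
    (h : ∀ A, MeasurableSet A → (1 - δ) * μ.real A ≤ ν.real A) (A : Set S) (hA : MeasurableSet A) :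
    |μ.real A - ν.real A| ≤ δ := by
  have h1 := h A hA
  have h2 := h Aᶜ hA.compl
  rw [probReal_compl_eq_one_sub hA, probReal_compl_eq_one_sub hA] at h2
  have := measureReal_nonneg (μ := μ) (s := A)
  have := measureReal_le_one (μ := μ) (s := A)
  rw [abs_le]
  constructor <;> nlinarith

/-- An increasing sequence of measures has a limit, along which all lower integrals converge: write
it as a series of its increments. -/
theorem exists_measure_tendsto_of_monotone (M : ℕ → Measure S) [∀ n, IsFiniteMeasure (M n)]
    (hM : Monotone M) :
    ∃ μ : Measure S, ∀ f : S → ℝ≥0∞,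
      Tendsto (fun n => ∫⁻ x, f x ∂(M n)) atTop (𝓝 (∫⁻ x, f x ∂μ)) := by
  refine ⟨M 0 + Measure.sum (fun n => M (n + 1) - M n), fun f => ?_⟩
  have hs : ∀ n, ∫⁻ x, f x ∂(M n)
      = ∫⁻ x, f x ∂(M 0) + ∑ k ∈ Finset.range n, ∫⁻ x, f x ∂(M (k + 1) - M k) := by
    intro n
    induction n with
    | zero => rw [Finset.range_zero, Finset.sum_empty, add_zero]
    | succ n ih =>
      rw [Finset.sum_range_succ, ← add_assoc, ← ih, ← lintegral_add_measure, add_comm (M n),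
        Measure.sub_add_cancel_of_le (hM n.le_succ)]
  rw [lintegral_add_measure, lintegral_sum_measure]
  rw [funext hs]
  exact tendsto_const_nhds.add ENNReal.summable.hasSum.tendsto_sum_nat

/-- Probability measures `N_t` for which `e^{-A(t)} N_t` increases with `t`, where `A(t) → 0`,
converge to a probability measure, as these minorants do. -/
theorem exists_probabilityMeasure_tendsto (N : ℝ≥0 → ProbabilityMeasure S) (A : ℝ≥0 → ℝ)
    (hA : Tendsto A atTop (𝓝 0)) (T : ℝ≥0)
    (h : ∀ t r, T ≤ t → ∀ B, MeasurableSet B →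
      Real.exp (-(A t - A (t + r))) * (N t : Measure S).real B ≤ (N (t + r) : Measure S).real B) :
    ∃ μ : ProbabilityMeasure S, ∀ f : S → ℝ≥0∞,
      Tendsto (fun n : ℕ => ∫⁻ x, f x ∂(N n : Measure S)) atTop
        (𝓝 (∫⁻ x, f x ∂(μ : Measure S))) := by
  obtain ⟨k, hk⟩ := exists_nat_ge T
  let c : ℕ → ℝ≥0∞ := fun n => ENNReal.ofReal (Real.exp (-A ((n + k : ℕ) : ℝ≥0)))
  let M : ℕ → Measure S := fun n => c n • (N ((n + k : ℕ) : ℝ≥0) : Measure S)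
  have hc : Tendsto c atTop (𝓝 1) := by
    have h1 : Tendsto (fun n : ℕ => ((n + k : ℕ) : ℝ≥0)) atTop atTop :=
      tendsto_natCast_atTop_atTop.comp (tendsto_add_atTop_nat k)
    have h2 := ENNReal.tendsto_ofReal ((Real.continuous_exp.tendsto _).comp (hA.comp h1).neg)
    simpa [c, Function.comp_def] using h2
  have : ∀ n, IsFiniteMeasure (M n) := fun n =>
    Measure.smul_finite _ ENNReal.ofReal_ne_top
  have hM : Monotone M := by
    refine monotone_nat_of_le_succ fun n => Measure.le_iff.2 fun B hB => ?_
    simp only [M, Measure.smul_apply, smul_eq_mul, c]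
    rw [← ofReal_measureReal, ← ofReal_measureReal, ← ENNReal.ofReal_mul (Real.exp_pos _).le,
      ← ENNReal.ofReal_mul (Real.exp_pos _).le]
    refine ENNReal.ofReal_le_ofReal ?_
    have h1 := h ((n + k : ℕ) : ℝ≥0) 1 (hk.trans (Nat.cast_le.2 (Nat.le_add_left k n))) B hB
    rw [show ((n + k : ℕ) : ℝ≥0) + 1 = ((n + 1 + k : ℕ) : ℝ≥0) by push_cast; ring] at h1
    refine le_trans (le_of_eq ?_) (mul_le_mul_of_nonneg_left h1 (Real.exp_pos _).le)
    rw [← mul_assoc, ← Real.exp_add]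
    ring_nf
  obtain ⟨μ, hμ⟩ := exists_measure_tendsto_of_monotone M hM
  have key : ∀ f : S → ℝ≥0∞, Tendsto (fun n : ℕ => ∫⁻ x, f x ∂(N n : Measure S)) atTop
      (𝓝 (∫⁻ x, f x ∂μ)) := by
    intro f
    rw [← tendsto_add_atTop_iff_nat k]
    have h1 := ENNReal.Tendsto.mul (tendsto_inv_iff.2 hc) (by simp) (hμ f) (by simp)
    rw [inv_one, one_mul] at h1
    refine h1.congr fun n => ?_
    have hc0 : c n ≠ 0 := by simp [c, Real.exp_pos]
    simp only [M]
    rw [lintegral_smul_measure, smul_eq_mul, ← mul_assoc,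
      ENNReal.inv_mul_cancel hc0 ENNReal.ofReal_ne_top, one_mul]
  have hprob : IsProbabilityMeasure μ := by
    refine ⟨tendsto_nhds_unique (f := fun _ : ℕ => (1 : ℝ≥0∞)) (l := atTop) ?_ tendsto_const_nhds⟩
    simpa only [lintegral_one, measure_univ] using key (fun _ => 1)
  exact ⟨⟨μ, hprob⟩, key⟩

end General

section FiniteMeasures

variable {E : Type u} [MeasurableSpace E]

theorem measurable_coe_finiteMeasure :
    Measurable (fun ν : FiniteMeasure E => (ν : Measure E)) := measurable_subtype_coe

theorem measurable_finiteMeasure_apply {A : Set E} (hA : MeasurableSet A) :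
    Measurable (fun ν : FiniteMeasure E => (ν : Measure E) A) :=
  (Measure.measurable_coe hA).comp measurable_coe_finiteMeasure

instance : MeasurableAdd₂ (FiniteMeasure E) where
  measurable_add := by
    refine Measurable.subtype_mk (Measure.measurable_of_measurable_coe _ fun A hA => ?_)
    exact ((measurable_finiteMeasure_apply hA).comp measurable_fst).add
      ((measurable_finiteMeasure_apply hA).comp measurable_snd)

theorem measurableSet_finiteMeasure_zero : MeasurableSet ({0} : Set (FiniteMeasure E)) := by
  have : ({0} : Set (FiniteMeasure E))
      = (fun ν : FiniteMeasure E => (ν : Measure E) univ) ⁻¹' {0} := by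
    ext ν
    simp only [mem_singleton_iff, mem_preimage, Measure.measure_univ_eq_zero]
    exact ⟨fun h => by simp [h], fun h => Subtype.ext h⟩
  rw [this]
  exact measurable_finiteMeasure_apply MeasurableSet.univ (measurableSet_singleton 0)

/-- A kernel of finite, not necessarily uniformly bounded, measures is s-finite. -/
theorem isSFiniteKernel_of_isFiniteMeasure {α β : Type*} [MeasurableSpace α] [MeasurableSpace β]
    (k : Kernel α β) (hk : ∀ a, IsFiniteMeasure (k a)) : IsSFiniteKernel k := by
  classical
  have hm : ∀ n : ℕ, MeasurableSet {a | ⌊(k a univ).toReal⌋₊ = n} := fun n =>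
    (Nat.measurable_floor.comp (k.measurable_coe MeasurableSet.univ).ennreal_toReal)
      (measurableSet_singleton n)
  let κ : ℕ → Kernel α β := fun n => Kernel.piecewise (hm n) k 0
  have hκ : ∀ n, IsFiniteKernel (κ n) := fun n => by
    refine ⟨⟨(n : ℝ≥0∞) + 1, by simp, fun a => ?_⟩⟩
    simp only [κ, Kernel.piecewise_apply]
    split_ifs with h
    · have h1 := Nat.lt_floor_add_one ((k a univ).toReal)
      rw [show ⌊(k a univ).toReal⌋₊ = n from h] at h1
      rw [← ENNReal.ofReal_toReal (measure_ne_top (k a) univ)]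
      refine ENNReal.ofReal_le_of_le_toReal ?_
      rw [ENNReal.toReal_add (by simp) (by simp)]
      simpa using h1.le
    · simp
  refine ⟨κ, hκ, ?_⟩
  ext a s hs
  rw [Kernel.sum_apply' _ _ hs, tsum_eq_single (⌊(k a univ).toReal⌋₊)]
  · simp [κ, Kernel.piecewise_apply]
  · intro n hn
    simp [κ, Kernel.piecewise_apply, hn.symm]

/-- The tautological kernel from `M(E)` to `E`. -/
def evalKernel (E : Type u) [MeasurableSpace E] : Kernel (FiniteMeasure E) E :=
  ⟨fun ν => (ν : Measure E), measurable_coe_finiteMeasure⟩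

@[simp] theorem evalKernel_apply (ν : FiniteMeasure E) : evalKernel E ν = (ν : Measure E) := rfl

instance : IsSFiniteKernel (evalKernel E) :=
  isSFiniteKernel_of_isFiniteMeasure _ fun ν => by rw [evalKernel_apply]; infer_instance

theorem measurable_finiteMeasure_integral {f : E → ℝ} (hf : Measurable f) :
    Measurable (fun ν : FiniteMeasure E => ∫ x, f x ∂(ν : Measure E)) :=
  (hf.stronglyMeasurable.integral_kernel (κ := evalKernel E)).measurable

theorem IsBddBorelNonneg.integrable {f : E → ℝ} (hf : IsBddBorelNonneg f) (μ : Measure E)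
    [IsFiniteMeasure μ] : Integrable f μ := by
  obtain ⟨C, hC⟩ := hf.bounded
  refine Integrable.of_bound hf.measurable.aestronglyMeasurable C (ae_of_all _ fun x => ?_)
  rw [Real.norm_of_nonneg (hf.nonneg x)]
  exact hC x

theorem isBddBorelNonneg_const {a : ℝ} (ha : 0 ≤ a) : IsBddBorelNonneg (fun _ : E => a) :=
  ⟨measurable_const, fun _ => ha, a, fun _ => le_rfl⟩

variable {f : E → ℝ}

theorem integrable_exp_neg (R : Measure (FiniteMeasure E)) [IsFiniteMeasure R]
    (hf : IsBddBorelNonneg f) :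
    Integrable (fun ν : FiniteMeasure E => Real.exp (-∫ x, f x ∂(ν : Measure E))) R := by
  refine Integrable.of_bound (Real.measurable_exp.comp
    (measurable_finiteMeasure_integral hf.measurable).neg).aestronglyMeasurable 1
    (ae_of_all _ fun ν => ?_)
  rw [Real.norm_of_nonneg (Real.exp_pos _).le, Real.exp_le_one_iff, neg_nonpos]
  exact integral_nonneg hf.nonneg

theorem laplace_nonneg (R : Measure (FiniteMeasure E)) (f : E → ℝ) : 0 ≤ laplace R f :=
  integral_nonneg fun _ => (Real.exp_pos _).le

theorem laplace_pos (R : Measure (FiniteMeasure E)) [IsProbabilityMeasure R]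
    (hf : IsBddBorelNonneg f) : 0 < laplace R f := by
  unfold laplace
  rw [integral_pos_iff_support_of_nonneg (fun _ => (Real.exp_pos _).le) (integrable_exp_neg R hf)]
  have : Function.support (fun ν : FiniteMeasure E => Real.exp (-∫ x, f x ∂(ν : Measure E)))
      = univ := by
    ext ν; simp [Real.exp_ne_zero]
  simp [this]

theorem laplace_anti (R : Measure (FiniteMeasure E)) [IsFiniteMeasure R] {g : E → ℝ}
    (hf : IsBddBorelNonneg f) (hg : IsBddBorelNonneg g) (h : ∀ x, f x ≤ g x) :
    laplace R g ≤ laplace R f :=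
  integral_mono (integrable_exp_neg R hg) (integrable_exp_neg R hf) fun _ =>
    Real.exp_le_exp.2 (neg_le_neg (integral_mono (hf.integrable _) (hg.integrable _) h))

theorem laplace_le_one (R : Measure (FiniteMeasure E)) [IsProbabilityMeasure R]
    (hf : IsBddBorelNonneg f) : laplace R f ≤ 1 := by
  have := laplace_anti R (isBddBorelNonneg_const le_rfl) hf hf.nonneg
  simpa [laplace] using this

theorem laplace_conv (R N : Measure (FiniteMeasure E)) [IsFiniteMeasure R] [IsFiniteMeasure N]
    (hf : IsBddBorelNonneg f) : laplace (R.conv N) f = laplace R f * laplace N f := by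
  unfold laplace
  have hm : Measurable (fun ν : FiniteMeasure E => Real.exp (-∫ x, f x ∂(ν : Measure E))) :=
    Real.measurable_exp.comp (measurable_finiteMeasure_integral hf.measurable).neg
  rw [Measure.conv, integral_map measurable_add.aemeasurable hm.aestronglyMeasurable,
    ← integral_prod_mul]
  refine integral_congr_ae (ae_of_all _ fun p => ?_)
  simp only
  rw [FiniteMeasure.toMeasure_add, integral_add_measure (hf.integrable _) (hf.integrable _),
    neg_add, Real.exp_add]

/-- As the constant `n` grows, `L_R(n)` decreases to `R({0})`. -/
theorem le_measureReal_zero_of_le_laplace (R : Measure (FiniteMeasure E)) [IsProbabilityMeasure R]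
    {a : ℝ} (h : ∀ n : ℕ, a ≤ laplace R (fun _ => (n : ℝ))) : a ≤ R.real {0} := by
  have hlim : Tendsto (fun n : ℕ => laplace R (fun _ => (n : ℝ))) atTop
      (𝓝 (∫ ν, Set.indicator {0} (fun _ => (1 : ℝ)) ν ∂(R))) := by
    unfold laplace
    refine tendsto_integral_of_dominated_convergence (fun _ => 1) (fun n =>
      (integrable_exp_neg R (isBddBorelNonneg_const n.cast_nonneg)).aestronglyMeasurable)
      (integrable_const 1) (fun n => ae_of_all _ fun _ => ?_) (ae_of_all _ fun ν => ?_)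
    · rw [Real.norm_of_nonneg (Real.exp_pos _).le, Real.exp_le_one_iff, neg_nonpos]
      exact integral_nonneg fun _ => n.cast_nonneg
    · by_cases hν : ν = 0
      · subst hν; simp
      · have hpos : 0 < (ν : Measure E).real univ := by
          rw [measureReal_def, ENNReal.toReal_pos_iff]
          refine ⟨pos_iff_ne_zero.2 fun h0 => hν (Subtype.ext ?_), measure_lt_top _ _⟩
          exact Measure.measure_univ_eq_zero.1 h0
        simp only [mem_singleton_iff, hν, not_false_eq_true, indicator_of_notMem, integral_const,
          smul_eq_mul]
        exact Real.tendsto_exp_neg_atTop_nhds_zero.comp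
          (tendsto_natCast_atTop_atTop.const_mul_atTop hpos)
  rw [integral_indicator_const _ measurableSet_finiteMeasure_zero] at hlim
  simpa using ge_of_tendsto' hlim h

/-- A convolution `R * N` dominates its part `R({0}) N`. -/
theorem measure_zero_mul_le_conv (R N : Measure (FiniteMeasure E)) [SFinite N]
    {A : Set (FiniteMeasure E)}
    (hA : MeasurableSet A) : R {0} * N A ≤ (R.conv N) A := by
  rw [Measure.conv, Measure.map_apply measurable_add hA, ← Measure.prod_prod]
  refine measure_mono ?_
  rintro ⟨x, y⟩ ⟨hx, hy⟩
  simp only [mem_singleton_iff] at hx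
  simpa [hx] using hy

end FiniteMeasures

end

section

/-! ### Joint measurability of transition semigroups and entrance laws -/

section TransitionKernels

theorem IsLusinSpace.metrizable_secondCountable {E : Type u} [TopologicalSpace E]
    (hE : IsLusinSpace E) :
    TopologicalSpace.MetrizableSpace E ∧ SecondCountableTopology E := by
  obtain ⟨K, _, _, i, hi, -⟩ := hE
  have : SecondCountableTopology K := inferInstance
  exact ⟨hi.metrizableSpace, hi.secondCountableTopology⟩

variable {E : Type u} [MeasurableSpace E]

/-- The points `(⌊(n + 1) t⌋ + 1) / (n + 1)` are discrete, measurable approximations of `t` from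
the right. -/
theorem exists_discrete_approx_right : ∃ (q : ℕ → ℕ → ℝ≥0) (k : ℕ → ℝ≥0 → ℕ),
    (∀ n, Measurable (k n)) ∧ ∀ t, Tendsto (fun n => q n (k n t)) atTop (𝓝[>] t) := by
  refine ⟨fun n j => ((j : ℝ≥0) + 1) / ((n : ℝ≥0) + 1), fun n t => ⌊((n : ℝ≥0) + 1) * t⌋₊,
    fun n => Nat.measurable_floor.comp (measurable_id.const_mul _), fun t => ?_⟩
  have hpos : ∀ n : ℕ, (0 : ℝ≥0) < (n : ℝ≥0) + 1 := fun n => by positivity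
  have hgt : ∀ n : ℕ, t < ((⌊((n : ℝ≥0) + 1) * t⌋₊ : ℝ≥0) + 1) / ((n : ℝ≥0) + 1) := fun n => by
    rw [lt_div_iff₀ (hpos n), mul_comm]
    exact Nat.lt_floor_add_one _
  have hle : ∀ n : ℕ, ((⌊((n : ℝ≥0) + 1) * t⌋₊ : ℝ≥0) + 1) / ((n : ℝ≥0) + 1)
      ≤ t + 1 / ((n : ℝ≥0) + 1) := fun n => by
    rw [div_le_iff₀ (hpos n), add_mul t, one_div, inv_mul_cancel₀ (hpos n).ne', mul_comm t]
    exact add_le_add_left (Nat.floor_le (by positivity)) 1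
  refine tendsto_nhdsWithin_iff.2 ⟨?_, Eventually.of_forall hgt⟩
  refine tendsto_of_tendsto_of_tendsto_of_le_of_le tendsto_const_nhds ?_ (fun n => (hgt n).le) hle
  simpa using tendsto_const_nhds.add (tendsto_one_div_add_atTop_nhds_zero_nat (𝕜 := ℝ≥0))

/-- A function of `(t, a)` that is measurable in `a` and right continuous in `t > 0` is jointly
measurable. -/
theorem measurable_uncurry_of_rightContinuous {T : Type*} [MeasurableSpace T]
    {g : ℝ≥0 → T → ℝ≥0∞} (hg : ∀ t, Measurable (g t))
    (hr : ∀ t a, 0 < t → Tendsto (fun s => g s a) (𝓝[>] t) (𝓝 (g t a))) :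
    Measurable (fun p : ℝ≥0 × T => g p.1 p.2) := by
  classical
  obtain ⟨q, k, hk, hq⟩ := exists_discrete_approx_right
  let h : ℕ → ℝ≥0 × T → ℝ≥0∞ := fun n p =>
    if p.1 = 0 then g 0 p.2 else g (q n (k n p.1)) p.2
  have hh : ∀ n, Measurable (h n) := fun n => by
    refine Measurable.ite (measurable_fst (measurableSet_singleton 0))
      ((hg 0).comp measurable_snd) ?_
    have h1 : Measurable (fun p : ℕ × T => g (q n p.1) p.2) :=
      measurable_from_prod_countable_right fun j => hg (q n j)
    exact h1.comp (((hk n).comp measurable_fst).prodMk measurable_snd)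
  refine measurable_of_tendsto_metrizable hh (tendsto_pi_nhds.2 fun p => ?_)
  by_cases hp : p.1 = 0
  · simp only [h, hp, if_true]; exact tendsto_const_nhds
  · simp only [h, hp, if_false]
    exact (hr p.1 p.2 (pos_iff_ne_zero.2 hp)).comp (hq p.1)

open scoped BoundedContinuousFunction

/-- A weakly right continuous family of finite measures, measurable for each time, is jointly
measurable. -/
theorem measurable_uncurry_of_weakly_rightContinuous [TopologicalSpace E] [BorelSpace E]
    [TopologicalSpace.PseudoMetrizableSpace E] {T : Type*} [MeasurableSpace T]
    {m : ℝ≥0 → T → Measure E}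
    (hm : ∀ t, Measurable (m t)) (hfin : ∀ t a, IsFiniteMeasure (m t a))
    (hr : ∀ (f : E →ᵇ ℝ≥0) t a, 0 < t →
      Tendsto (fun s => ∫⁻ x, f x ∂(m s a)) (𝓝[>] t) (𝓝 (∫⁻ x, f x ∂(m t a)))) :
    Measurable (fun p : ℝ≥0 × T => m p.1 p.2) := by
  have hf : ∀ f : E →ᵇ ℝ≥0, Measurable (fun p : ℝ≥0 × T => ∫⁻ x, f x ∂(m p.1 p.2)) := fun f =>
    measurable_uncurry_of_rightContinuous (fun t =>
      (Measure.measurable_lintegral f.continuous.measurable.coe_nnreal_ennreal).comp (hm t)) (hr f)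
  have hclosed : ∀ F : Set E, IsClosed F → Measurable (fun p : ℝ≥0 × T => m p.1 p.2 F) := by
    intro F hF
    refine measurable_of_tendsto_metrizable (fun n => hf (hF.apprSeq n))
      (tendsto_pi_nhds.2 fun p => ?_)
    exact HasOuterApproxClosed.tendsto_lintegral_apprSeq hF _
  have : ∀ p : ℝ≥0 × T, IsFiniteMeasure (m p.1 p.2) := fun p => hfin _ _
  refine Measurable.measure_of_isPiSystem (BorelSpace.measurable_eq.trans
    borel_eq_generateFrom_isClosed) isPiSystem_isClosed (fun s hs => hclosed s hs)
    (hclosed univ isClosed_univ)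

theorem IsTransitionSemigroup.isFiniteMeasure {S : Type*} [MeasurableSpace S]
    {P : ℝ≥0 → Kernel S S} (hP : IsTransitionSemigroup P) (t : ℝ≥0) (x : S) :
    IsFiniteMeasure (P t x) := ⟨(hP.le_one t x).trans_lt ENNReal.one_lt_top⟩

theorem IsTransitionSemigroup.isFiniteKernel {S : Type*} [MeasurableSpace S]
    {P : ℝ≥0 → Kernel S S} (hP : IsTransitionSemigroup P) (t : ℝ≥0) :
    IsFiniteKernel (P t) := ⟨1, ENNReal.one_lt_top, hP.le_one t⟩

variable {P : ℝ≥0 → Kernel E E}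

namespace EntranceLaw

theorem law_anti (hP : IsTransitionSemigroup P) (κ : EntranceLaw P) {r t : ℝ≥0} (hr : 0 < r)
    (h : r ≤ t) : κ.law t univ ≤ κ.law r univ := by
  obtain ⟨s, rfl⟩ := exists_add_of_le h
  rw [κ.entrance r s hr, Measure.bind_apply MeasurableSet.univ (P s).aemeasurable]
  calc ∫⁻ x, P s x univ ∂(κ.law r) ≤ ∫⁻ _, 1 ∂(κ.law r) := lintegral_mono fun x => hP.le_one s x
    _ = κ.law r univ := by simp

/-- The total masses of an entrance law decrease in time, so an infinite one would contradict the
integrability at `0`. -/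
theorem isFiniteMeasure (hP : IsTransitionSemigroup P) (κ : EntranceLaw P) (t : ℝ≥0) :
    IsFiniteMeasure (κ.law t) := by
  refine ⟨?_⟩
  rcases eq_or_ne t 0 with rfl | ht
  · rw [κ.law_zero]; simp
  by_contra htop
  rw [not_lt, top_le_iff] at htop
  have ht' : 0 < t := pos_iff_ne_zero.2 ht
  refine κ.integrable.ne (top_unique ?_)
  calc (⊤ : ℝ≥0∞) = ∫⁻ s in Ioc (0 : ℝ) (min t 1), ⊤ := by
        rw [setLIntegral_const, Real.volume_Ioc, ENNReal.top_mul]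
        simp [ht]
    _ ≤ ∫⁻ s in Ioc (0 : ℝ) (min t 1), κ.law s.toNNReal univ := by
        refine setLIntegral_mono' measurableSet_Ioc fun s hs => ?_
        rw [← htop]
        exact law_anti hP κ (Real.toNNReal_pos.2 hs.1)
          (Real.toNNReal_le_iff_le_coe.2 (hs.2.trans (min_le_left _ _)))
    _ ≤ _ := lintegral_mono_set (Ioc_subset_Ioc_right (min_le_right _ _))

theorem measurable_law (t : ℝ≥0) : Measurable (fun κ : EntranceLaw P => κ.law t) :=
  (measurable_pi_apply t).comp (comap_measurable _)

end EntranceLaw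

variable [TopologicalSpace E] {Ω : Type v} {mΩ : MeasurableSpace Ω}
  {ℱ : Filtration ℝ≥0 mΩ} {ξ : ℝ≥0 → Ω → E ⊕ Unit} {Pr : E → Measure Ω}

/-- `P_t(x, ·)` is the law of `ξ_t` under `Pr x`, restricted to `E`: apply the strong Markov
property at time `0`. -/
theorem IsBorelRightProcess.measure_eq (hξ : IsBorelRightProcess P ℱ ξ Pr) (t : ℝ≥0) (x : E)
    {B : Set E} (hB : MeasurableSet B) : P t x B = Pr x (ξ t ⁻¹' (Sum.inl '' B)) := by
  have := hξ.prob x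
  have h := hξ.strong_markov x (fun _ => ((0 : ℝ≥0) : WithTop ℝ≥0)) (isStoppingTime_const _ 0) univ
    MeasurableSet.univ t B hB
  simp only [ne_eq, WithTop.coe_ne_top, not_false_eq_true, true_and, univ_inter,
    WithTop.untopA_eq_untop, WithTop.untop_coe, zero_add, ofPred_true,
    Measure.restrict_univ] at h
  have h2 : ∫⁻ ω, Sum.elim (fun y => P t y B) (fun _ => 0) (ξ 0 ω) ∂(Pr x)
      = ∫⁻ _, P t x B ∂(Pr x) := by
    refine lintegral_congr_ae ?_
    filter_upwards [hξ.normal x] with ω hω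
    rw [hω, Sum.elim_inl]
  rw [h2, lintegral_const, measure_univ, mul_one] at h
  exact h.symm

theorem IsBorelRightProcess.measurable (hξ : IsBorelRightProcess P ℱ ξ Pr) (t : ℝ≥0) :
    Measurable (ξ t) := (hξ.adapted t).mono (ℱ.le t) le_rfl

theorem IsBorelRightProcess.lintegral_eq (hξ : IsBorelRightProcess P ℱ ξ Pr) (t : ℝ≥0) (x : E)
    {f : E → ℝ≥0∞} (hf : Measurable f) :
    ∫⁻ y, f y ∂(P t x) = ∫⁻ ω, Sum.elim f (fun _ => 0) (ξ t ω) ∂(Pr x) := by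
  have hF : Measurable (Sum.elim f (fun _ : Unit => (0 : ℝ≥0∞))) := hf.sumElim measurable_const
  have hinl : MeasurableEmbedding (Sum.inl : E → E ⊕ Unit) :=
    ⟨Sum.inl_injective, measurable_inl, fun _ hs => hs.inl_image⟩
  have hP : P t x = ((Pr x).map (ξ t)).comap Sum.inl := by
    ext B hB
    rw [hξ.measure_eq t x hB, hinl.comap_apply,
      Measure.map_apply (hξ.measurable t) (hinl.measurableSet_image.2 hB)]
  rw [← lintegral_map hF (hξ.measurable t), hP]
  have h1 : ∫⁻ y, f y ∂(((Pr x).map (ξ t)).comap Sum.inl)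
      = ∫⁻ z, Sum.elim f (fun _ : Unit => (0 : ℝ≥0∞)) z
          ∂((((Pr x).map (ξ t)).comap Sum.inl).map Sum.inl) := by
    rw [lintegral_map hF measurable_inl]; rfl
  rw [h1, hinl.map_comap, ← lintegral_indicator measurableSet_range_inl]
  refine lintegral_congr fun z => ?_
  cases z <;> simp

/-- `t ↦ P_t f(x)` is right continuous for bounded continuous `f`, as the paths are. -/
theorem IsBorelRightProcess.tendsto_lintegral [OpensMeasurableSpace E]
    (hξ : IsBorelRightProcess P ℱ ξ Pr)
    (f : E →ᵇ ℝ≥0) (t : ℝ≥0) (x : E) :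
    Tendsto (fun s => ∫⁻ y, f y ∂(P s x)) (𝓝[≥] t) (𝓝 (∫⁻ y, f y ∂(P t x))) := by
  have := hξ.prob x
  have hfm : Measurable (fun y => (f y : ℝ≥0∞)) := f.continuous.measurable.coe_nnreal_ennreal
  have hF : Measurable (Sum.elim (fun y => (f y : ℝ≥0∞)) (fun _ : Unit => (0 : ℝ≥0∞))) :=
    hfm.sumElim measurable_const
  have hFc : Continuous (Sum.elim (fun y => (f y : ℝ≥0∞)) (fun _ : Unit => (0 : ℝ≥0∞))) :=
    (ENNReal.continuous_coe.comp f.continuous).sumElim continuous_const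
  simp_rw [hξ.lintegral_eq _ x hfm]
  refine tendsto_lintegral_filter_of_dominated_convergence (fun _ => (nndist f 0 : ℝ≥0∞))
    (Eventually.of_forall fun s => hF.comp (hξ.measurable s))
    (Eventually.of_forall fun s => ae_of_all _ fun ω => ?_) (by simp) (ae_of_all _ fun ω => ?_)
  · cases ξ s ω with
    | inl y => exact ENNReal.coe_le_coe.2 (BoundedContinuousFunction.NNReal.upper_bound f y)
    | inr _ => simp
  · exact (hFc.tendsto _).comp (hξ.right_continuous ω t)

theorem IsBorelRightProcess.measurable_uncurry [BorelSpace E]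
    [TopologicalSpace.PseudoMetrizableSpace E]
    (hξ : IsBorelRightProcess P ℱ ξ Pr) : Measurable (fun p : ℝ≥0 × E => P p.1 p.2) :=
  measurable_uncurry_of_weakly_rightContinuous (m := fun t x => P t x) (fun t => (P t).measurable)
    (fun t x => hξ.semigroup.isFiniteMeasure t x)
    fun f t x _ => (hξ.tendsto_lintegral f t x).mono_left (nhdsWithin_mono _ Ioi_subset_Ici_self)

namespace EntranceLaw

/-- Since `κ_s = κ_t P_{s-t}` for `s > t > 0`, entrance laws inherit weak right continuity from the
transition semigroup. -/
theorem measurable_uncurry_law [BorelSpace E]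
    [TopologicalSpace.PseudoMetrizableSpace E]
    (hξ : IsBorelRightProcess P ℱ ξ Pr) :
    Measurable (fun p : ℝ≥0 × EntranceLaw P => p.2.law p.1) := by
  refine measurable_uncurry_of_weakly_rightContinuous (m := fun t (κ : EntranceLaw P) => κ.law t)
    measurable_law (fun t κ => κ.isFiniteMeasure hξ.semigroup t) fun f t κ ht => ?_
  have := κ.isFiniteMeasure hξ.semigroup t
  have hfm : Measurable (fun y => (f y : ℝ≥0∞)) := f.continuous.measurable.coe_nnreal_ennreal
  have h1 : ∀ s ∈ Ioi t, ∫⁻ x, ∫⁻ y, f y ∂(P (s - t) x) ∂(κ.law t) = ∫⁻ y, f y ∂(κ.law s) := by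
    intro s hs
    conv_rhs => rw [← add_tsub_cancel_of_le (le_of_lt (mem_Ioi.1 hs) : t ≤ s), κ.entrance t _ ht,
      Measure.lintegral_bind (P (s - t)).aemeasurable hfm.aemeasurable]
  refine Tendsto.congr' (eventually_nhdsWithin_of_forall h1) ?_
  have h0 : ∀ x, ∫⁻ y, f y ∂(P 0 x) = f x := fun x => by
    rw [hξ.semigroup.zero, Kernel.id_apply, lintegral_dirac' _ hfm]
  have h2 : ∫⁻ y, f y ∂(κ.law t) = ∫⁻ x, ∫⁻ y, f y ∂(P 0 x) ∂(κ.law t) :=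
    lintegral_congr fun x => (h0 x).symm
  rw [h2]
  have hsub : Tendsto (fun s : ℝ≥0 => s - t) (𝓝[>] t) (𝓝[≥] 0) := by
    refine tendsto_nhdsWithin_iff.2 ⟨?_, Eventually.of_forall fun s => mem_Ici.2 zero_le⟩
    have : Tendsto (fun s : ℝ≥0 => s - t) (𝓝 t) (𝓝 (t - t)) :=
      (continuous_id.sub continuous_const).tendsto t
    rw [tsub_self] at this
    exact this.mono_left nhdsWithin_le_nhds
  refine tendsto_lintegral_filter_of_dominated_convergence (fun _ => (nndist f 0 : ℝ≥0∞))
    (Eventually.of_forall fun s => (Measure.measurable_lintegral hfm).comp (P _).measurable)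
    (Eventually.of_forall fun s => ae_of_all _ fun x => ?_) ?_ (ae_of_all _ fun x => ?_)
  · calc ∫⁻ y, f y ∂(P (s - t) x) ≤ ∫⁻ _, (nndist f 0 : ℝ≥0∞) ∂(P (s - t) x) :=
          lintegral_mono fun y =>
            ENNReal.coe_le_coe.2 (BoundedContinuousFunction.NNReal.upper_bound f y)
      _ ≤ (nndist f 0 : ℝ≥0∞) := by
          rw [lintegral_const]
          exact mul_le_of_le_one_right' (hξ.semigroup.le_one _ _)
  · rw [lintegral_const]
    exact ENNReal.mul_ne_top ENNReal.coe_ne_top (measure_ne_top _ _)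
  · exact (hξ.tendsto_lintegral f 0 x).comp hsub

end EntranceLaw

end TransitionKernels

end

section

/-! ### Bounds for the branching mechanism -/

section Exponential

theorem exp_neg_sub_one_add_nonneg (u : ℝ) : 0 ≤ Real.exp (-u) - 1 + u := by
  linarith [Real.add_one_le_exp (-u)]

theorem exp_neg_sub_one_add_le {u : ℝ} (hu : 0 ≤ u) : Real.exp (-u) - 1 + u ≤ u := by
  linarith [Real.exp_le_one_iff.2 (neg_nonpos.2 hu)]

theorem exp_neg_sub_one_add_le_sq {u : ℝ} (hu : 0 ≤ u) : Real.exp (-u) - 1 + u ≤ u ^ 2 := by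
  rcases le_total u 1 with h | h
  · have := (le_abs_self _).trans (Real.abs_exp_sub_one_sub_id_le (x := -u)
      (by rwa [abs_neg, abs_of_nonneg hu]))
    linarith [neg_sq u]
  · have := exp_neg_sub_one_add_le hu
    nlinarith

/-- If `u_n = θ_n a_n` with `θ_n → 0` and `a_n → a`, then `(e^{-u_n} - 1) / θ_n → -a`. -/
theorem tendsto_exp_neg_sub_one_div {θ a : ℕ → ℝ} {a₀ : ℝ} (hθ : Tendsto θ atTop (𝓝 0))
    (hθ0 : ∀ n, 0 < θ n) (ha0 : ∀ n, 0 ≤ a n) (ha : Tendsto a atTop (𝓝 a₀)) :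
    Tendsto (fun n => (Real.exp (-(θ n * a n)) - 1) / θ n) atTop (𝓝 (-a₀)) := by
  have h1 : Tendsto (fun n => -a n + θ n * a n ^ 2) atTop (𝓝 (-a₀)) := by
    simpa using ha.neg.add (hθ.mul (ha.pow 2))
  refine tendsto_of_tendsto_of_tendsto_of_le_of_le ha.neg h1 (fun n => ?_) (fun n => ?_)
  · simp only
    rw [le_div_iff₀ (hθ0 n)]
    linarith [exp_neg_sub_one_add_nonneg (θ n * a n)]
  · simp only
    rw [div_le_iff₀ (hθ0 n)]
    have := exp_neg_sub_one_add_le_sq (mul_nonneg (hθ0 n).le (ha0 n))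
    nlinarith

end Exponential

theorem measurable_integral_kernel_comp {T A B : Type*} [MeasurableSpace T] [MeasurableSpace A]
    [MeasurableSpace B] (k : Kernel A B) [IsSFiniteKernel k] {g : T → A} (hg : Measurable g)
    {f : T → B → ℝ} (hf : Measurable (Function.uncurry f)) :
    Measurable (fun t => ∫ y, f t y ∂(k (g t))) :=
  (hf.stronglyMeasurable.integral_kernel_prod_right (κ := k.comap g hg)).measurable

namespace BranchingMechanism

variable {E : Type u} [MeasurableSpace E] (φ : BranchingMechanism E)

/-- The function `ν(1) ∧ ν(1)² + ν_x(1)`, whose `H(x, ·)`-integrals are bounded. -/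
def weight (x : E) (ν : FiniteMeasure E) : ℝ :=
  min ((ν : Measure E).real univ) ((ν : Measure E).real univ ^ 2) + (ν : Measure E).real {x}ᶜ

/-- The integrand `e^{-ν(f)} - 1 + f(x)ν({x})` in the branching mechanism. -/
def jump (x : E) (f : E → ℝ) (ν : FiniteMeasure E) : ℝ :=
  Real.exp (-∫ y, f y ∂(ν : Measure E)) - 1 + f x * (ν : Measure E).real {x}

theorem weight_nonneg (x : E) (ν : FiniteMeasure E) : 0 ≤ weight x ν :=
  add_nonneg (le_min measureReal_nonneg (sq_nonneg _)) measureReal_nonneg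

theorem ofReal_weight (x : E) (ν : FiniteMeasure E) : ENNReal.ofReal (weight x ν)
    = min ((ν : Measure E) univ) ((ν : Measure E) univ ^ 2) + (ν : Measure E) {x}ᶜ := by
  rw [weight, ENNReal.ofReal_add (le_min measureReal_nonneg (sq_nonneg _)) measureReal_nonneg,
    ENNReal.ofReal_min, ENNReal.ofReal_pow measureReal_nonneg, ofReal_measureReal,
    ofReal_measureReal]

theorem measurable_measureReal {A : Set E} (hA : MeasurableSet A) :
    Measurable (fun ν : FiniteMeasure E => (ν : Measure E).real A) :=
  (measurable_finiteMeasure_apply hA).ennreal_toReal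

variable {f : E → ℝ} {a : ℝ}

/-- `ν(f) = ν_x(f) + f(x) ν({x})`. -/
theorem integral_eq_add_singleton [MeasurableSingletonClass E] (x : E) (ν : FiniteMeasure E)
    (hf : IsBddBorelNonneg f) :
    ∫ y, f y ∂(ν : Measure E)
      = ∫ y in {x}ᶜ, f y ∂(ν : Measure E) + f x * (ν : Measure E).real {x} := by
  rw [← integral_add_compl (measurableSet_singleton x) (hf.integrable _), integral_singleton,
    smul_eq_mul]
  ring

/-- The jump integrand dominates its local part at `f(x)` up to the mass `ν_x(f)` displaced
from `x`. -/
theorem le_jump [MeasurableSingletonClass E] (x : E) (ν : FiniteMeasure E)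
    (hf : IsBddBorelNonneg f) :
    (Real.exp (-(f x * (ν : Measure E).real {x})) - 1 + f x * (ν : Measure E).real {x})
      - ∫ y in {x}ᶜ, f y ∂(ν : Measure E) ≤ jump x f ν := by
  unfold jump
  rw [integral_eq_add_singleton x ν hf]
  set A := ∫ y in {x}ᶜ, f y ∂(ν : Measure E)
  set B := f x * (ν : Measure E).real {x}
  have hA : 0 ≤ A := integral_nonneg hf.nonneg
  have hB : 0 ≤ B := mul_nonneg (hf.nonneg x) measureReal_nonneg
  rw [neg_add, Real.exp_add]
  have h1 := Real.add_one_le_exp (-A)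
  have h2 := Real.exp_le_one_iff.2 (neg_nonpos.2 hB)
  have h3 := Real.exp_pos (-B)
  nlinarith

theorem setIntegral_compl_le [MeasurableSingletonClass E] (x : E) (ν : FiniteMeasure E)
    (hf : IsBddBorelNonneg f) (hfa : ∀ y, f y ≤ a) :
    ∫ y in {x}ᶜ, f y ∂(ν : Measure E) ≤ a * weight x ν := by
  have ha : 0 ≤ a := (hf.nonneg x).trans (hfa x)
  calc ∫ y in {x}ᶜ, f y ∂(ν : Measure E) ≤ ∫ y in {x}ᶜ, a ∂(ν : Measure E) :=
        integral_mono (hf.integrable _) (integrable_const _) hfa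
    _ = a * (ν : Measure E).real {x}ᶜ := by
        rw [integral_const, measureReal_restrict_apply_univ, smul_eq_mul, mul_comm]
    _ ≤ a * weight x ν := mul_le_mul_of_nonneg_left
        (le_add_of_nonneg_left (le_min measureReal_nonneg (sq_nonneg _))) ha

theorem localJump_le {z : ℝ} (hz : 0 ≤ z) (hza : z ≤ a) (x : E) (ν : FiniteMeasure E) :
    Real.exp (-(z * (ν : Measure E).real {x})) - 1 + z * (ν : Measure E).real {x}
      ≤ (a + a ^ 2) * weight x ν := by
  have ha : 0 ≤ a := hz.trans hza
  set k := (ν : Measure E).real {x}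
  set m := (ν : Measure E).real univ
  have hk : 0 ≤ k := measureReal_nonneg
  have hkm : k ≤ m := measureReal_mono (subset_univ _)
  have hm : 0 ≤ m := hk.trans hkm
  have hB : 0 ≤ z * k := mul_nonneg hz hk
  have hB2 : z * k ≤ a * m := mul_le_mul hza hkm hk ha
  have h1 := exp_neg_sub_one_add_le hB
  have h2 := exp_neg_sub_one_add_le_sq hB
  have h3 : (z * k) ^ 2 ≤ (a * m) ^ 2 := pow_le_pow_left₀ hB hB2 2
  have h4 : (a + a ^ 2) * min m (m ^ 2) ≤ (a + a ^ 2) * weight x ν :=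
    mul_le_mul_of_nonneg_left (le_add_of_nonneg_right measureReal_nonneg) (by positivity)
  refine le_trans ?_ h4
  rcases min_cases m (m ^ 2) with ⟨h, -⟩ | ⟨h, -⟩ <;> rw [h]
  · nlinarith [mul_nonneg (sq_nonneg a) hm]
  · nlinarith [mul_nonneg ha (sq_nonneg m)]

theorem abs_jump_le [MeasurableSingletonClass E] (x : E) (ν : FiniteMeasure E)
    (hf : IsBddBorelNonneg f) (hfa : ∀ y, f y ≤ a) :
    |jump x f ν| ≤ (a + a ^ 2) * weight x ν := by
  have ha : 0 ≤ a := (hf.nonneg x).trans (hfa x)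
  rw [abs_le]
  constructor
  · have h1 := le_jump x ν hf
    have h2 := setIntegral_compl_le x ν hf hfa
    have h3 := exp_neg_sub_one_add_nonneg (f x * (ν : Measure E).real {x})
    nlinarith [mul_nonneg (sq_nonneg a) (weight_nonneg x ν)]
  · refine le_trans ?_ (localJump_le (hf.nonneg x) (hfa x) x ν)
    unfold jump
    have : f x * (ν : Measure E).real {x} ≤ ∫ y, f y ∂(ν : Measure E) := by
      rw [integral_eq_add_singleton x ν hf]
      exact le_add_of_nonneg_left (integral_nonneg hf.nonneg)
    have := Real.exp_le_exp.2 (neg_le_neg this)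
    linarith

theorem measurable_weight [MeasurableSingletonClass E] (x : E) :
    Measurable (weight x : FiniteMeasure E → ℝ) :=
  ((measurable_measureReal MeasurableSet.univ).min
    ((measurable_measureReal MeasurableSet.univ).pow_const 2)).add
    (measurable_measureReal (measurableSet_singleton x).compl)

theorem lintegral_weight_le : ∃ M : ℝ≥0, ∀ x, ∫⁻ ν, ENNReal.ofReal (weight x ν) ∂(φ.H x) ≤ M := by
  obtain ⟨M, hM⟩ := φ.H_moment
  exact ⟨M, fun x => by simpa only [ofReal_weight] using hM x⟩

theorem integrable_weight [MeasurableSingletonClass E] (x : E) : Integrable (weight x) (φ.H x) := by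
  obtain ⟨M, hM⟩ := φ.lintegral_weight_le
  refine (lintegral_ofReal_ne_top_iff_integrable (measurable_weight x).aestronglyMeasurable
    (ae_of_all _ (weight_nonneg x))).1 ((hM x).trans_lt ENNReal.coe_lt_top).ne

/-- One constant bounds all the coefficients. -/
theorem exists_bound [MeasurableSingletonClass E] : ∃ M : ℝ, 0 ≤ M ∧ ∀ x, |φ.b x| ≤ M ∧ φ.c x ≤ M ∧
    (φ.η x).real univ ≤ M ∧ ∫ ν, weight x ν ∂(φ.H x) ≤ M := by
  obtain ⟨M, hM⟩ := φ.lintegral_weight_le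
  obtain ⟨B, hB⟩ := φ.b_bounded
  obtain ⟨C, hC⟩ := φ.c_bddBorelNonneg.bounded
  obtain ⟨D, hD⟩ := φ.η_bounded
  refine ⟨|B| + |C| + D + M, by positivity, fun x => ⟨?_, ?_, ?_, ?_⟩⟩
  · have := abs_nonneg C; have := le_abs_self B; have := D.2; have := M.2
    linarith [hB x, NNReal.coe_nonneg D, NNReal.coe_nonneg M]
  · linarith [hC x, le_abs_self C, abs_nonneg B, NNReal.coe_nonneg D, NNReal.coe_nonneg M]
  · have : (φ.η x).real univ ≤ D := ENNReal.toReal_le_coe_of_le_coe (hD x)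
    linarith [abs_nonneg C, abs_nonneg B, NNReal.coe_nonneg D, NNReal.coe_nonneg M]
  · have : ∫ ν, weight x ν ∂(φ.H x) ≤ M := by
      rw [integral_eq_lintegral_of_nonneg_ae (ae_of_all _ (weight_nonneg x))
        (measurable_weight x).aestronglyMeasurable]
      exact ENNReal.toReal_le_coe_of_le_coe (hM x)
    linarith [abs_nonneg C, abs_nonneg B, NNReal.coe_nonneg D, NNReal.coe_nonneg M]

instance (x : E) : IsFiniteMeasure (φ.η x) := by
  obtain ⟨D, hD⟩ := φ.η_bounded
  exact ⟨(hD x).trans_lt ENNReal.coe_lt_top⟩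

instance : IsFiniteKernel φ.η := by
  obtain ⟨D, hD⟩ := φ.η_bounded
  exact ⟨D, ENNReal.coe_lt_top, hD⟩

theorem measurable_jump (x : E) (hf : Measurable f) [MeasurableSingletonClass E] :
    Measurable (jump x f : FiniteMeasure E → ℝ) :=
  ((Real.measurable_exp.comp (measurable_finiteMeasure_integral hf).neg).sub_const 1).add
    ((measurable_measureReal (measurableSet_singleton x)).const_mul _)

theorem integrable_jump [MeasurableSingletonClass E] (x : E) (hf : IsBddBorelNonneg f) :
    Integrable (jump x f) (φ.H x) := by
  obtain ⟨a, ha⟩ := hf.bounded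
  exact ((φ.integrable_weight x).const_mul (a + a ^ 2)).mono'
    (measurable_jump x hf.measurable).aestronglyMeasurable
    (ae_of_all _ fun ν => abs_jump_le x ν hf ha)

theorem eval_eq (x : E) (f : E → ℝ) : φ.eval x f = φ.b x * f x + φ.c x * f x ^ 2
    - ∫ y, f y ∂(φ.η x) + ∫ ν, jump x f ν ∂(φ.H x) := rfl

/-- `φ(x, f)` is bounded by a multiple of `‖f‖ + ‖f‖²`. -/
theorem exists_abs_eval_le [MeasurableSingletonClass E] : ∃ M : ℝ, 0 ≤ M ∧
    ∀ (f : E → ℝ) (a : ℝ), IsBddBorelNonneg f → (∀ y, f y ≤ a) → ∀ x,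
      |φ.eval x f| ≤ M * (a + a ^ 2) := by
  obtain ⟨M, hM0, hM⟩ := φ.exists_bound
  refine ⟨4 * M, by positivity, fun f a hf hfa x => ?_⟩
  obtain ⟨h1, h2, h3, h4⟩ := hM x
  have hfx := hf.nonneg x
  have ha : 0 ≤ a := hfx.trans (hfa x)
  have e1 : |φ.b x * f x| ≤ M * a := by
    rw [abs_mul, abs_of_nonneg hfx]
    exact mul_le_mul h1 (hfa x) hfx hM0
  have e2 : |φ.c x * f x ^ 2| ≤ M * a ^ 2 := by
    rw [abs_of_nonneg (mul_nonneg (φ.c_bddBorelNonneg.nonneg x) (sq_nonneg _))]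
    exact mul_le_mul h2 (pow_le_pow_left₀ hfx (hfa x) 2) (sq_nonneg _) hM0
  have e3 : |∫ y, f y ∂(φ.η x)| ≤ M * a := by
    rw [abs_of_nonneg (integral_nonneg hf.nonneg)]
    calc ∫ y, f y ∂(φ.η x) ≤ ∫ _, a ∂(φ.η x) :=
          integral_mono (hf.integrable _) (integrable_const _) hfa
      _ = (φ.η x).real univ * a := by rw [integral_const, smul_eq_mul]
      _ ≤ M * a := mul_le_mul_of_nonneg_right h3 ha
  have e4 : |∫ ν, jump x f ν ∂(φ.H x)| ≤ (a + a ^ 2) * M := by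
    calc |∫ ν, jump x f ν ∂(φ.H x)| ≤ ∫ ν, |jump x f ν| ∂(φ.H x) := abs_integral_le_integral_abs
      _ ≤ ∫ ν, (a + a ^ 2) * weight x ν ∂(φ.H x) :=
          integral_mono (φ.integrable_jump x hf).abs ((φ.integrable_weight x).const_mul _)
            fun ν => abs_jump_le x ν hf hfa
      _ = (a + a ^ 2) * ∫ ν, weight x ν ∂(φ.H x) := integral_const_mul _ _
      _ ≤ (a + a ^ 2) * M := mul_le_mul_of_nonneg_left h4 (by positivity)
  rw [eval_eq]
  have t1 := abs_add_le (φ.b x * f x + φ.c x * f x ^ 2 - ∫ y, f y ∂(φ.η x))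
    (∫ ν, jump x f ν ∂(φ.H x))
  have t2 := abs_sub (φ.b x * f x + φ.c x * f x ^ 2) (∫ y, f y ∂(φ.η x))
  have t3 := abs_add_le (φ.b x * f x) (φ.c x * f x ^ 2)
  nlinarith [mul_nonneg hM0 ha, mul_nonneg hM0 (sq_nonneg a)]

end BranchingMechanism

end

section

/-! ### The local projection, linearization and measurability of the branching mechanism -/

namespace BranchingMechanism

section Gamma

variable {E : Type u} [MeasurableSpace E] [MeasurableSingletonClass E] (φ : BranchingMechanism E)
  {f : E → ℝ} {a : ℝ}

theorem measurable_restrict_compl (x : E) :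
    Measurable (fun ν : FiniteMeasure E => (ν : Measure E).restrict {x}ᶜ) := by
  refine Measure.measurable_of_measurable_coe _ fun A hA => ?_
  simp_rw [Measure.restrict_apply hA]
  exact measurable_finiteMeasure_apply (hA.inter (measurableSet_singleton x).compl)

theorem lintegral_γ (x : E) {g : E → ℝ≥0∞} (hg : Measurable g) :
    ∫⁻ y, g y ∂(φ.γ x)
      = ∫⁻ y, g y ∂(φ.η x) + ∫⁻ ν, ∫⁻ y in {x}ᶜ, g y ∂(ν : Measure E) ∂(φ.H x) := by
  rw [γ, lintegral_add_measure,
    Measure.lintegral_bind (measurable_restrict_compl x).aemeasurable hg.aemeasurable]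

theorem exists_γ_le : ∃ M : ℝ≥0, ∀ x, φ.γ x univ ≤ M := by
  obtain ⟨M, hM⟩ := φ.lintegral_weight_le
  obtain ⟨D, hD⟩ := φ.η_bounded
  refine ⟨D + M, fun x => ?_⟩
  have h := φ.lintegral_γ x (g := fun _ => 1) measurable_const
  rw [lintegral_one] at h
  rw [h, lintegral_one, ENNReal.coe_add]
  refine add_le_add (hD x) (le_trans (lintegral_mono fun ν => ?_) (hM x))
  rw [lintegral_one, Measure.restrict_apply_univ, ← ofReal_measureReal]
  exact ENNReal.ofReal_le_ofReal
    (le_add_of_nonneg_left (le_min measureReal_nonneg (sq_nonneg _)))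

instance (x : E) : IsFiniteMeasure (φ.γ x) := by
  obtain ⟨M, hM⟩ := φ.exists_γ_le
  exact ⟨(hM x).trans_lt ENNReal.coe_lt_top⟩

theorem exists_γ_real_le : ∃ M : ℝ, 0 ≤ M ∧ ∀ x, (φ.γ x).real univ ≤ M := by
  obtain ⟨M, hM⟩ := φ.exists_γ_le
  exact ⟨M, M.2, fun x => ENNReal.toReal_le_coe_of_le_coe (hM x)⟩

theorem measurable_setIntegral_compl (x : E) (hf : Measurable f) :
    Measurable (fun ν : FiniteMeasure E => ∫ y in {x}ᶜ, f y ∂(ν : Measure E)) := by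
  have := measurable_finiteMeasure_integral (f := ({x}ᶜ : Set E).indicator f)
    (hf.indicator (measurableSet_singleton x).compl)
  simpa only [integral_indicator (measurableSet_singleton x).compl] using this

theorem integrable_setIntegral_compl (x : E) (hf : IsBddBorelNonneg f) :
    Integrable (fun ν : FiniteMeasure E => ∫ y in {x}ᶜ, f y ∂(ν : Measure E)) (φ.H x) := by
  obtain ⟨a, ha⟩ := hf.bounded
  refine ((φ.integrable_weight x).const_mul a).mono'
    (measurable_setIntegral_compl x hf.measurable).aestronglyMeasurable (ae_of_all _ fun ν => ?_)
  rw [Real.norm_of_nonneg (integral_nonneg hf.nonneg)]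
  exact setIntegral_compl_le x ν hf ha

/-- `γ(x, f) = η(x, f) + ∫ ν_x(f) H(x, dν)`. -/
theorem integral_γ (x : E) (hf : IsBddBorelNonneg f) :
    ∫ y, f y ∂(φ.γ x)
      = ∫ y, f y ∂(φ.η x) + ∫ ν, ∫ y in {x}ᶜ, f y ∂(ν : Measure E) ∂(φ.H x) := by
  have h0 : ∀ ρ : Measure E, IsFiniteMeasure ρ →
      ENNReal.ofReal (∫ y, f y ∂ρ) = ∫⁻ y, ENNReal.ofReal (f y) ∂ρ := fun ρ _ =>
    ofReal_integral_eq_lintegral_ofReal (hf.integrable ρ) (ae_of_all _ hf.nonneg)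
  have h1 := φ.lintegral_γ x hf.measurable.ennreal_ofReal
  rw [← h0 _ inferInstance, ← h0 _ inferInstance] at h1
  have h2 : ∫⁻ ν, ∫⁻ y in {x}ᶜ, ENNReal.ofReal (f y) ∂(ν : Measure E) ∂(φ.H x)
      = ENNReal.ofReal (∫ ν, ∫ y in {x}ᶜ, f y ∂(ν : Measure E) ∂(φ.H x)) := by
    rw [ofReal_integral_eq_lintegral_ofReal (φ.integrable_setIntegral_compl x hf)
      (ae_of_all _ fun ν => integral_nonneg hf.nonneg)]
    exact lintegral_congr fun ν => (h0 _ inferInstance).symm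
  rw [h2, ← ENNReal.ofReal_add (integral_nonneg hf.nonneg)
    (integral_nonneg fun ν => integral_nonneg hf.nonneg)] at h1
  exact (ENNReal.ofReal_eq_ofReal_iff (integral_nonneg hf.nonneg)
    (add_nonneg (integral_nonneg hf.nonneg)
      (integral_nonneg fun ν => integral_nonneg hf.nonneg))).1 h1

theorem integrable_localJump (x : E) {z : ℝ} (hz : 0 ≤ z) :
    Integrable (fun ν : FiniteMeasure E => Real.exp (-(z * (ν : Measure E).real {x})) - 1
      + z * (ν : Measure E).real {x}) (φ.H x) := by
  have hm : Measurable (fun ν : FiniteMeasure E => z * (ν : Measure E).real {x}) :=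
    (measurable_measureReal (measurableSet_singleton x)).const_mul z
  refine ((φ.integrable_weight x).const_mul (z + z ^ 2)).mono'
    (((Real.measurable_exp.comp hm.neg).sub_const 1).add hm).aestronglyMeasurable
    (ae_of_all _ fun ν => ?_)
  rw [Real.norm_of_nonneg (exp_neg_sub_one_add_nonneg _)]
  exact localJump_le hz le_rfl x ν

/-- The branching mechanism dominates its local projection up to the loss term
`γ(x, f) - γ(x, 1) f(x)`. -/
theorem localProjection_le_eval (x : E) (hf : IsBddBorelNonneg f) :
    φ.localProjection x (f x) + (φ.γ x).real univ * f x - ∫ y, f y ∂(φ.γ x) ≤ φ.eval x f := by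
  rw [eval_eq, localProjection, φ.integral_γ x hf]
  have h := integral_mono ((φ.integrable_localJump x (hf.nonneg x)).sub
    (φ.integrable_setIntegral_compl x hf)) (φ.integrable_jump x hf) fun ν => le_jump x ν hf
  have h2 := integral_sub (φ.integrable_localJump x (hf.nonneg x))
    (φ.integrable_setIntegral_compl x hf)
  simp only [Pi.sub_apply] at h
  rw [h2] at h
  linarith

omit [MeasurableSingletonClass E] in
theorem localProjection_ge_linear (x : E) (z : ℝ) :
    (φ.b x - (φ.γ x).real univ) * z ≤ φ.localProjection x z := by
  unfold localProjection
  have h1 : 0 ≤ φ.c x * z ^ 2 := mul_nonneg (φ.c_bddBorelNonneg.nonneg x) (sq_nonneg _)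
  have h2 : 0 ≤ ∫ ν, (Real.exp (-(z * (ν : Measure E).real {x})) - 1
      + z * (ν : Measure E).real {x}) ∂(φ.H x) :=
    integral_nonneg fun ν => exp_neg_sub_one_add_nonneg _
  linarith

theorem bddBelow_range : BddBelow (range fun x => φ.b x - (φ.γ x).real univ) := by
  obtain ⟨B, hB⟩ := φ.b_bounded
  obtain ⟨M, -, hM⟩ := φ.exists_γ_real_le
  refine ⟨-B - M, ?_⟩
  rintro _ ⟨x, rfl⟩
  have := (abs_le.1 (hB x)).1
  simp only
  linarith [hM x]

theorem betaStar_mul_le_localProjection (x : E) {z : ℝ} (hz : 0 ≤ z) :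
    φ.betaStar * z ≤ φ.localProjection x z :=
  (mul_le_mul_of_nonneg_right (ciInf_le φ.bddBelow_range x) hz).trans
    (φ.localProjection_ge_linear x z)

/-- The key pointwise estimate for comparison: if `φ₁(x, z) ≥ p z - q` and `0 ≤ f ≤ m`, then
`K f(x) - φ(x, f) ≤ (K - p) m + q` for `K` large. -/
theorem mul_sub_eval_le {p q K m : ℝ} (x : E) (hf : IsBddBorelNonneg f) (hfm : ∀ y, f y ≤ m)
    (hloc : ∀ z, 0 ≤ z → p * z - q ≤ φ.localProjection x z)
    (hK : p + (φ.γ x).real univ ≤ K) : K * f x - φ.eval x f ≤ (K - p) * m + q := by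
  have h1 := φ.localProjection_le_eval x hf
  have h2 := hloc (f x) (hf.nonneg x)
  have h3 : ∫ y, f y ∂(φ.γ x) ≤ (φ.γ x).real univ * m := by
    calc ∫ y, f y ∂(φ.γ x) ≤ ∫ _, m ∂(φ.γ x) :=
          integral_mono (hf.integrable _) (integrable_const _) hfm
      _ = (φ.γ x).real univ * m := by rw [integral_const, smul_eq_mul]
  nlinarith [hfm x]

/-- The linearization of the branching mechanism at `0` is `f ↦ b f - γ f`. -/
theorem tendsto_eval_div (x : E) {θ : ℕ → ℝ} {v : ℕ → E → ℝ} {g : E → ℝ} {M : ℝ}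
    (hθ : Tendsto θ atTop (𝓝 0)) (hθ0 : ∀ n, 0 < θ n) (hθ1 : ∀ n, θ n ≤ 1)
    (hv : ∀ n, IsBddBorelNonneg (v n)) (hvM : ∀ n y, v n y ≤ θ n * M)
    (hg : ∀ y, Tendsto (fun n => v n y / θ n) atTop (𝓝 (g y))) :
    Tendsto (fun n => φ.eval x (v n) / θ n) atTop (𝓝 (φ.b x * g x - ∫ y, g y ∂(φ.γ x))) := by
  have hw0 : ∀ n y, 0 ≤ v n y / θ n := fun n y => div_nonneg ((hv n).nonneg y) (hθ0 n).le
  have hwM : ∀ n y, v n y / θ n ≤ M := fun n y => by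
    rw [div_le_iff₀ (hθ0 n), mul_comm]; exact hvM n y
  have hM0 : 0 ≤ M := (hw0 0 x).trans (hwM 0 x)
  have hgB : IsBddBorelNonneg g := ⟨measurable_of_tendsto_metrizable
    (fun n => (hv n).measurable.div_const (θ n)) (tendsto_pi_nhds.2 hg),
    fun y => ge_of_tendsto' (hg y) fun n => hw0 n y,
    M, fun y => le_of_tendsto' (hg y) fun n => hwM n y⟩
  -- integrals against finite measures converge
  have hint : ∀ ρ : Measure E, IsFiniteMeasure ρ →
      Tendsto (fun n => ∫ y, v n y / θ n ∂ρ) atTop (𝓝 (∫ y, g y ∂ρ)) := fun ρ _ => by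
    refine tendsto_integral_of_dominated_convergence (fun _ => M)
      (fun n => ((hv n).measurable.div_const (θ n)).aestronglyMeasurable) (integrable_const M)
      (fun n => ae_of_all _ fun y => ?_) (ae_of_all _ hg)
    rw [Real.norm_of_nonneg (hw0 n y)]
    exact hwM n y
  have hb : Tendsto (fun n => φ.b x * (v n x / θ n)) atTop (𝓝 (φ.b x * g x)) :=
    (hg x).const_mul _
  have hc : Tendsto (fun n => φ.c x * (θ n * (v n x / θ n) ^ 2)) atTop (𝓝 0) := by
    simpa using (hθ.mul ((hg x).pow 2)).const_mul (φ.c x)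
  have hH : Tendsto (fun n => ∫ ν, jump x (v n) ν / θ n ∂(φ.H x)) atTop
      (𝓝 (∫ ν : FiniteMeasure E, -∫ y in {x}ᶜ, g y ∂(ν : Measure E) ∂(φ.H x))) := by
    refine tendsto_integral_of_dominated_convergence (fun ν => (M + M ^ 2) * weight x ν)
      (fun n => ((measurable_jump x (hv n).measurable).div_const (θ n)).aestronglyMeasurable)
      ((φ.integrable_weight x).const_mul _) (fun n => ae_of_all _ fun ν => ?_)
      (ae_of_all _ fun ν => ?_)
    · rw [Real.norm_eq_abs, abs_div, abs_of_pos (hθ0 n), div_le_iff₀ (hθ0 n)]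
      refine (abs_jump_le x ν (hv n) (hvM n)).trans ?_
      have h1 : θ n * M + (θ n * M) ^ 2 ≤ (M + M ^ 2) * θ n := by
        have := mul_le_mul_of_nonneg_left (hθ1 n) (mul_nonneg (hθ0 n).le (sq_nonneg M))
        nlinarith
      calc (θ n * M + (θ n * M) ^ 2) * weight x ν ≤ (M + M ^ 2) * θ n * weight x ν :=
            mul_le_mul_of_nonneg_right h1 (weight_nonneg x ν)
        _ = _ := by ring
    · have e1 := tendsto_exp_neg_sub_one_div hθ hθ0 (fun n => integral_nonneg (hw0 n))
        (hint (ν : Measure E) inferInstance)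
      have e2 := e1.add ((hg x).mul_const ((ν : Measure E).real {x}))
      have e3 := integral_eq_add_singleton x ν hgB
      have e4 : -∫ y, g y ∂(ν : Measure E) + g x * (ν : Measure E).real {x}
          = -∫ y in {x}ᶜ, g y ∂(ν : Measure E) := by rw [e3]; ring
      rw [e4] at e2
      refine e2.congr fun n => ?_
      rw [jump, integral_div, mul_div_cancel₀ _ (hθ0 n).ne']
      ring
  have hall := ((hb.add hc).sub (hint (φ.η x) inferInstance)).add hH
  rw [φ.integral_γ x hgB]
  rw [integral_neg] at hall
  refine (hall.congr fun n => ?_).trans_eq (by congr 1; ring)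
  rw [eval_eq, integral_div, integral_div]
  have := (hθ0 n).ne'
  field_simp

end Gamma

section Measurability

variable {E : Type u} [MeasurableSpace E] [MeasurableEq E] (φ : BranchingMechanism E)

theorem measurable_measureReal_singleton :
    Measurable (fun p : E × FiniteMeasure E => (p.2 : Measure E).real {p.1}) := by
  have hd : MeasurableSet {q : (E × FiniteMeasure E) × E | q.2 = q.1.1} :=
    measurableSet_eq_fun measurable_snd (measurable_fst.comp measurable_fst)
  have hm : Measurable (Function.uncurry fun (p : E × FiniteMeasure E) (y : E) =>
      ({q : (E × FiniteMeasure E) × E | q.2 = q.1.1}).indicator (fun _ => (1 : ℝ)) (p, y)) :=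
    measurable_const.indicator hd
  have h := measurable_integral_kernel_comp (evalKernel E)
    (measurable_snd : Measurable (Prod.snd : E × FiniteMeasure E → FiniteMeasure E)) hm
  convert h using 2 with p
  rw [← integral_indicator_one (measurableSet_singleton p.1)]
  rfl

/-- The Lévy kernel is s-finite: the sets on which `⌊1 / (ν(1) ∧ ν(1)²)⌋ = n` have bounded
`H(x, ·)`-measure, and `H(x, ·)` does not charge `0`. -/
instance : IsSFiniteKernel φ.H := by
  obtain ⟨M, hM⟩ := φ.H_moment
  -- the weight `ν(1) ∧ ν(1)²` is positive off `0`
  let w : FiniteMeasure E → ℝ := fun ν =>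
    min ((ν : Measure E).real univ) ((ν : Measure E).real univ ^ 2)
  have hw : Measurable w := (measurable_measureReal MeasurableSet.univ).min
    ((measurable_measureReal MeasurableSet.univ).pow_const 2)
  have hw0 : ∀ ν : FiniteMeasure E, ν ≠ 0 → 0 < w ν := fun ν hν => by
    have : 0 < (ν : Measure E).real univ := by
      rw [measureReal_def, ENNReal.toReal_pos_iff]
      exact ⟨pos_iff_ne_zero.2 fun h0 => hν (Subtype.ext (Measure.measure_univ_eq_zero.1 h0)),
        measure_lt_top _ _⟩
    exact lt_min this (by positivity)
  let B : ℕ → Set (FiniteMeasure E) := fun n => {0}ᶜ ∩ (fun ν => ⌊(w ν)⁻¹⌋₊) ⁻¹' {n}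
  have hB : ∀ n, MeasurableSet (B n) := fun n => measurableSet_finiteMeasure_zero.compl.inter
    ((Nat.measurable_floor.comp hw.inv) (measurableSet_singleton n))
  have hUB : ⋃ n, B n = {0}ᶜ := by
    ext ν; simp [B]
  have hdisj : Pairwise (Function.onFun Disjoint B) := fun n m hnm => by
    rw [Function.onFun, Set.disjoint_left]
    rintro ν ⟨-, h1⟩ ⟨-, h2⟩
    exact hnm (h1.symm.trans h2)
  refine ⟨fun n => φ.H.restrict (hB n), fun n => ?_, ?_⟩
  · refine ⟨((n : ℝ≥0∞) + 1) * M, ENNReal.mul_lt_top (by simp) ENNReal.coe_lt_top, fun x => ?_⟩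
    rw [Kernel.restrict_apply, Measure.restrict_apply_univ]
    have h1 : ∀ ν ∈ B n, (1 : ℝ≥0∞) ≤ ((n : ℝ≥0∞) + 1) * ENNReal.ofReal (w ν) := by
      rintro ν ⟨hν, hn⟩
      have hpos := hw0 ν hν
      have h2 := Nat.lt_floor_add_one (w ν)⁻¹
      rw [show ⌊(w ν)⁻¹⌋₊ = n from hn, inv_lt_iff_one_lt_mul₀ hpos] at h2
      calc (1 : ℝ≥0∞) = ENNReal.ofReal 1 := ENNReal.ofReal_one.symm
        _ ≤ ENNReal.ofReal (((n : ℝ) + 1) * w ν) := ENNReal.ofReal_le_ofReal h2.le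
        _ = _ := by
          rw [ENNReal.ofReal_mul (by positivity), ENNReal.ofReal_add (by positivity) one_pos.le]
          simp
    calc φ.H x (B n) = ∫⁻ _ in B n, 1 ∂(φ.H x) := by simp
      _ ≤ ∫⁻ ν in B n, ((n : ℝ≥0∞) + 1) * ENNReal.ofReal (w ν) ∂(φ.H x) :=
          setLIntegral_mono' (hB n) h1
      _ ≤ ∫⁻ ν, ((n : ℝ≥0∞) + 1) * ENNReal.ofReal (w ν) ∂(φ.H x) := setLIntegral_le_lintegral _ _
      _ = ((n : ℝ≥0∞) + 1) * ∫⁻ ν, ENNReal.ofReal (w ν) ∂(φ.H x) :=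
          lintegral_const_mul _ hw.ennreal_ofReal
      _ ≤ ((n : ℝ≥0∞) + 1) * M := by
          refine mul_le_mul_right (le_trans (lintegral_mono fun ν => ?_) (hM x)) _
          rw [← ofReal_weight]
          exact ENNReal.ofReal_le_ofReal (le_add_of_nonneg_right measureReal_nonneg)
  · ext x s hs
    rw [Kernel.sum_apply' _ _ hs]
    simp_rw [Kernel.restrict_apply, Measure.restrict_apply hs]
    rw [← measure_iUnion (fun n m hnm => (hdisj hnm).mono inter_subset_right inter_subset_right)
      (fun n => hs.inter (hB n)), ← inter_iUnion, hUB]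
    refine (measure_inter_conull ?_).symm
    rw [compl_compl]
    exact φ.H_zero x

theorem measurable_eval {T : Type*} [MeasurableSpace T] {v : T × E → ℝ} (hv : Measurable v) :
    Measurable (fun p : T × E => φ.eval p.2 (fun z => v (p.1, z))) := by
  have h1 : Measurable (fun p : T × E => ∫ z, v (p.1, z) ∂(φ.η p.2)) :=
    measurable_integral_kernel_comp φ.η measurable_snd
      (f := fun (p : T × E) z => v (p.1, z))
      (hv.comp ((measurable_fst.comp measurable_fst).prodMk measurable_snd))
  have h2 : Measurable (fun q : (T × E) × FiniteMeasure E =>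
      ∫ z, v (q.1.1, z) ∂(q.2 : Measure E)) :=
    measurable_integral_kernel_comp (evalKernel E) measurable_snd
      (f := fun (q : (T × E) × FiniteMeasure E) z => v (q.1.1, z))
      (hv.comp ((measurable_fst.comp (measurable_fst.comp measurable_fst)).prodMk measurable_snd))
  have h3 : Measurable (fun q : (T × E) × FiniteMeasure E => (q.2 : Measure E).real {q.1.2}) :=
    measurable_measureReal_singleton.comp
      ((measurable_snd.comp measurable_fst).prodMk measurable_snd)
  have h4 : Measurable (fun p : T × E => ∫ ν, jump p.2 (fun z => v (p.1, z)) ν ∂(φ.H p.2)) :=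
    measurable_integral_kernel_comp φ.H measurable_snd
      (f := fun (p : T × E) ν => jump p.2 (fun z => v (p.1, z)) ν)
      (((Real.measurable_exp.comp h2.neg).sub_const 1).add ((hv.comp measurable_fst).mul h3))
  exact ((((φ.b_measurable.comp measurable_snd).mul hv).add
    ((φ.c_bddBorelNonneg.measurable.comp measurable_snd).mul (hv.pow_const 2))).sub h1).add h4

end Measurability

end BranchingMechanism

end

section

/-! ### The cumulant semigroup and its evolution equation -/

section KernelIntegrals

variable {E : Type u} [MeasurableSpace E]

theorem integrable_of_abs_le {f : E → ℝ} {C : ℝ} (hf : Measurable f) (hC : ∀ x, |f x| ≤ C)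
    (μ : Measure E) [IsFiniteMeasure μ] : Integrable f μ :=
  Integrable.of_bound hf.aestronglyMeasurable C (ae_of_all _ hC)

theorem integral_bind_kernel {A : Type*} [MeasurableSpace A] (m : Measure A) [IsFiniteMeasure m]
    (k : Kernel A E) [IsFiniteKernel k] {f : E → ℝ} {C : ℝ} (hf : Measurable f)
    (hC : ∀ x, |f x| ≤ C) : ∫ y, f y ∂(m.bind k) = ∫ x, ∫ y, f y ∂(k x) ∂m := by
  have hk : m.bind k = (k ∘ₖ Kernel.const Unit m) () := by
    rw [Kernel.comp_apply, Kernel.const_apply]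
  have h := Kernel.integral_comp (κ := Kernel.const Unit m) (η := k) (a := ()) (f := f)
    (integrable_of_abs_le hf hC _)
  rw [hk, h, Kernel.const_apply]

end KernelIntegrals

/-- Variation of constants: multiply `W(s) = A - ∫₀ˢ h` by `e^{Ks}` and integrate the
derivative. -/
theorem exp_mul_primitive_eq {h : ℝ → ℝ} {t : ℝ} (A K : ℝ)
    (hh : IntervalIntegrable h volume 0 t) :
    Real.exp (K * t) * (A - ∫ r in (0 : ℝ)..t, h r)
      = A + ∫ s in (0 : ℝ)..t, Real.exp (K * s) * (K * (A - ∫ r in (0 : ℝ)..s, h r) - h s) := by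
  have hE : ∀ s : ℝ, HasDerivAt (fun s => Real.exp (K * s)) (K * Real.exp (K * s)) s := fun s => by
    simpa [mul_comm] using ((hasDerivAt_id s).const_mul K).exp
  have hc : ∀ c : ℝ, AbsolutelyContinuousOnInterval (fun _ : ℝ => c) 0 t := fun c =>
    ((LipschitzWith.const c).lipschitzOnWith (s := uIcc 0 t)).absolutelyContinuousOnInterval
  have hprim : ∀ g : ℝ → ℝ, IntervalIntegrable g volume 0 t →
      AbsolutelyContinuousOnInterval (fun s : ℝ => ∫ r in (0 : ℝ)..s, g r) 0 t := fun g hg =>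
    hg.absolutelyContinuousOnInterval_intervalIntegral left_mem_uIcc
  have hEac : AbsolutelyContinuousOnInterval (fun s : ℝ => Real.exp (K * s)) 0 t := by
    have hcont : Continuous (fun s : ℝ => K * Real.exp (K * s)) := by fun_prop
    have := (hc 1).add (hprim _ (hcont.intervalIntegrable 0 t))
    refine (funext fun s => ?_ : (fun s : ℝ => Real.exp (K * s)) = _) ▸ this
    rw [Pi.add_apply, intervalIntegral.integral_eq_sub_of_hasDerivAt (fun r _ => hE r)
      (hcont.intervalIntegrable 0 s)]
    simp
  have hW : AbsolutelyContinuousOnInterval (fun s : ℝ => A - ∫ r in (0 : ℝ)..s, h r) 0 t :=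
    (hc A).sub (hprim h hh)
  have key := AbsolutelyContinuousOnInterval.integral_deriv_mul_eq_sub hEac hW
  simp only [mul_zero, Real.exp_zero, intervalIntegral.integral_same, sub_zero, one_mul] at key
  rw [eq_sub_iff_add_eq, add_comm] at key
  rw [← key]
  congr 1
  refine intervalIntegral.integral_congr_ae ?_
  filter_upwards [hh.ae_hasDerivAt_integral] with s hs hsm
  have h1 := hs (uIoc_subset_uIcc hsm) 0 left_mem_uIcc
  rw [(hE s).deriv, (h1.const_sub A).deriv]
  ring

/-- A superprocess over a jointly measurable transition semigroup `P`, such that `(t, κ) ↦ κ_t` is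
jointly measurable on entrance laws for `P`. These are the properties of a Borel right process which
the analysis of the cumulant semigroup relies on. -/
structure IsMeasurableSuperprocess {E : Type u} [MeasurableSpace E] (P : ℝ≥0 → Kernel E E)
    (φ : BranchingMechanism E) (Q : ℝ≥0 → Kernel (FiniteMeasure E) (FiniteMeasure E)) : Prop where
  motion : IsTransitionSemigroup P
  measurable_motion : Measurable (fun p : ℝ≥0 × E => P p.1 p.2)
  measurable_law : Measurable (fun p : ℝ≥0 × EntranceLaw P => p.2.law p.1)
  superprocess : IsSuperprocessSemigroup P φ Q

namespace IsMeasurableSuperprocess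

variable {E : Type u} [MeasurableSpace E] {P : ℝ≥0 → Kernel E E} {φ : BranchingMechanism E}
  {Q : ℝ≥0 → Kernel (FiniteMeasure E) (FiniteMeasure E)} {f g : E → ℝ}

section Cumulant

theorem isProbabilityMeasure (h : IsMeasurableSuperprocess P φ Q) (t : ℝ≥0)
    (μ : FiniteMeasure E) : IsProbabilityMeasure (Q t μ) :=
  (h.superprocess.conservative t).isProbabilityMeasure μ

theorem cumulant_nonneg (h : IsMeasurableSuperprocess P φ Q) (hf : IsBddBorelNonneg f) (t : ℝ≥0)
    (x : E) : 0 ≤ cumulant Q t f x := by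
  have := h.isProbabilityMeasure t (diracFM x)
  exact neg_nonneg.2 (Real.log_nonpos (laplace_nonneg _ _) (laplace_le_one _ hf))

theorem isBddBorelNonneg_cumulant (h : IsMeasurableSuperprocess P φ Q) (hf : IsBddBorelNonneg f)
    (t : ℝ≥0) : IsBddBorelNonneg (cumulant Q t f) := by
  obtain ⟨C, hC⟩ := h.superprocess.locally_bounded f hf t
  exact ⟨(h.superprocess.measurable f hf).comp measurable_prodMk_left,
    h.cumulant_nonneg hf t, C, hC t le_rfl⟩

theorem cumulant_mono (h : IsMeasurableSuperprocess P φ Q) (hf : IsBddBorelNonneg f)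
    (hg : IsBddBorelNonneg g) (hfg : ∀ x, f x ≤ g x) (t : ℝ≥0) (x : E) :
    cumulant Q t f x ≤ cumulant Q t g x := by
  have := h.isProbabilityMeasure t (diracFM x)
  exact neg_le_neg (Real.log_le_log (laplace_pos _ hg) (laplace_anti _ hf hg hfg))

/-- The semigroup property `V_{s+t} = V_s V_t`. -/
theorem cumulant_add (h : IsMeasurableSuperprocess P φ Q) (hf : IsBddBorelNonneg f) (s t : ℝ≥0)
    (x : E) : cumulant Q (s + t) f x = cumulant Q s (cumulant Q t f) x := by
  have := h.superprocess.conservative t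
  have := h.superprocess.conservative s
  unfold cumulant
  congr 2
  rw [h.superprocess.semigroup.add]
  unfold laplace
  have hm : Measurable (fun ν : FiniteMeasure E => Real.exp (-∫ x, f x ∂(ν : Measure E))) :=
    Real.measurable_exp.comp (measurable_finiteMeasure_integral hf.measurable).neg
  rw [Kernel.integral_comp (integrable_exp_neg _ hf)]
  exact integral_congr_ae (ae_of_all _ fun ν => h.superprocess.branching t ν f hf)

theorem cumulant_zero (h : IsMeasurableSuperprocess P φ Q) (hf : IsBddBorelNonneg f) (x : E) :
    cumulant Q 0 f x = f x := by
  have hm : Measurable (fun ν : FiniteMeasure E => Real.exp (-∫ x, f x ∂(ν : Measure E))) :=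
    Real.measurable_exp.comp (measurable_finiteMeasure_integral hf.measurable).neg
  rw [cumulant, h.superprocess.semigroup.zero, laplace, Kernel.id_apply,
    integral_dirac' _ _ hm.stronglyMeasurable, Real.log_exp, neg_neg]
  exact integral_dirac' _ _ hf.measurable.stronglyMeasurable

/-- By Jensen's inequality, `V_t(c f) ≥ c V_t f` for `0 ≤ c ≤ 1`. -/
theorem mul_cumulant_le (h : IsMeasurableSuperprocess P φ Q) (hf : IsBddBorelNonneg f) {c : ℝ}
    (hc0 : 0 ≤ c) (hc1 : c ≤ 1) (t : ℝ≥0) (x : E) :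
    c * cumulant Q t f x ≤ cumulant Q t (fun y => c * f y) x := by
  have := h.isProbabilityMeasure t (diracFM x)
  have hcf : IsBddBorelNonneg (fun y => c * f y) := by
    obtain ⟨C, hC⟩ := hf.bounded
    exact ⟨hf.measurable.const_mul c, fun y => mul_nonneg hc0 (hf.nonneg y), c * C,
      fun y => mul_le_mul_of_nonneg_left (hC y) hc0⟩
  set R := Q t (diracFM x)
  have hJ : laplace R (fun y => c * f y) ≤ laplace R f ^ c := by
    have hconc := Real.concaveOn_rpow hc0 hc1
    have heq : ∀ ν : FiniteMeasure E, Real.exp (-∫ y, c * f y ∂(ν : Measure E))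
        = Real.exp (-∫ y, f y ∂(ν : Measure E)) ^ c := fun ν => by
      rw [integral_const_mul, ← Real.exp_mul]; ring_nf
    have hcont : ContinuousOn (fun z : ℝ => z ^ c) (Ici 0) :=
      (Real.continuous_rpow_const hc0).continuousOn
    have := hconc.le_map_integral hcont isClosed_Ici
      (ae_of_all _ fun ν => mem_Ici.2 (Real.exp_pos _).le) (integrable_exp_neg R hf)
      ((integrable_exp_neg R hcf).congr (ae_of_all _ heq))
    unfold laplace
    rw [integral_congr_ae (ae_of_all _ heq)]
    exact this
  have hL := Real.log_le_log (laplace_pos R hcf) hJ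
  rw [Real.log_rpow (laplace_pos R hf)] at hL
  unfold cumulant
  linarith

end Cumulant

section Evolution

variable [MeasurableEq E]

/-- `(s, y) ↦ φ(y, V_s f)` is measurable. -/
theorem measurable_eval_cumulant (h : IsMeasurableSuperprocess P φ Q) (hf : IsBddBorelNonneg f) :
    Measurable (fun p : ℝ≥0 × E => φ.eval p.2 (cumulant Q p.1 f)) :=
  φ.measurable_eval (h.superprocess.measurable f hf)

theorem exists_abs_eval_cumulant_le (h : IsMeasurableSuperprocess P φ Q)
    (hf : IsBddBorelNonneg f) (T : ℝ≥0) :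
    ∃ B, 0 ≤ B ∧ ∀ s ≤ T, ∀ y, |φ.eval y (cumulant Q s f)| ≤ B := by
  obtain ⟨C, hC⟩ := h.superprocess.locally_bounded f hf T
  obtain ⟨M, hM0, hM⟩ := φ.exists_abs_eval_le
  have hC' : ∀ s ≤ T, ∀ y, cumulant Q s f y ≤ |C| := fun s hs y => (hC s hs y).trans (le_abs_self C)
  exact ⟨M * (|C| + |C| ^ 2), by positivity, fun s hs y =>
    hM _ _ (h.isBddBorelNonneg_cumulant hf s) (hC' s hs) y⟩

/-- The integrand `s ↦ κ_{t-s}(φ(·, V_s f))` of the evolution equation. -/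
def lawIntegrand (φ : BranchingMechanism E) (Q : ℝ≥0 → Kernel (FiniteMeasure E) (FiniteMeasure E))
    (κ : EntranceLaw P) (t : ℝ≥0) (f : E → ℝ) (s : ℝ) : ℝ :=
  ∫ y, φ.eval y (cumulant Q s.toNNReal f) ∂(κ.law (t - s).toNNReal)

omit [MeasurableEq E] in
theorem isSFiniteKernel_law (h : IsMeasurableSuperprocess P φ Q) :
    IsSFiniteKernel (⟨fun p : ℝ≥0 × EntranceLaw P => p.2.law p.1, h.measurable_law⟩ :
      Kernel (ℝ≥0 × EntranceLaw P) E) :=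
  isSFiniteKernel_of_isFiniteMeasure _ fun p => p.2.isFiniteMeasure h.motion p.1

/-- Joint measurability of `(κ, t, s) ↦ κ_{t-s}(φ(·, V_s f))`. -/
theorem measurable_lawIntegrand (h : IsMeasurableSuperprocess P φ Q) (hf : IsBddBorelNonneg f) :
    Measurable (fun p : (EntranceLaw P × ℝ≥0) × ℝ => lawIntegrand φ Q p.1.1 p.1.2 f p.2) := by
  have := h.isSFiniteKernel_law
  have hg : Measurable (fun p : (EntranceLaw P × ℝ≥0) × ℝ =>
      (((p.1.2 : ℝ) - p.2).toNNReal, p.1.1)) := by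
    refine Measurable.prodMk ?_ (measurable_fst.comp measurable_fst)
    exact ((measurable_coe_nnreal_real.comp (measurable_snd.comp measurable_fst)).sub
      measurable_snd).real_toNNReal
  exact measurable_integral_kernel_comp (⟨fun p : ℝ≥0 × EntranceLaw P => p.2.law p.1,
    h.measurable_law⟩ : Kernel (ℝ≥0 × EntranceLaw P) E) hg
    (f := fun (p : (EntranceLaw P × ℝ≥0) × ℝ) y => φ.eval y (cumulant Q p.2.toNNReal f))
    ((h.measurable_eval_cumulant hf).comp
      ((measurable_snd.comp measurable_fst).real_toNNReal.prodMk measurable_snd))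

theorem measurable_lawIntegrand_right (h : IsMeasurableSuperprocess P φ Q)
    (hf : IsBddBorelNonneg f) (κ : EntranceLaw P) (t : ℝ≥0) :
    Measurable (lawIntegrand φ Q κ t f) :=
  (h.measurable_lawIntegrand hf).comp (measurable_prodMk_left (x := (κ, t)))

omit [MeasurableEq E] in
theorem lintegral_law_lt_top (h : IsMeasurableSuperprocess P φ Q) (κ : EntranceLaw P) (t : ℝ≥0) :
    ∫⁻ s in Ioc (0 : ℝ) t, κ.law s.toNNReal univ < ⊤ := by
  have hsub : Ioc (0 : ℝ) t ⊆ Ioc 0 1 ∪ Ioc 1 (max 1 t) := by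
    rw [Ioc_union_Ioc_eq_Ioc zero_le_one (le_max_left _ _)]
    exact Ioc_subset_Ioc_right (le_max_right _ _)
  have := κ.isFiniteMeasure h.motion 1
  refine (lintegral_mono_set hsub).trans_lt ((lintegral_union_le _ _ _).trans_lt
    (ENNReal.add_lt_top.2 ⟨κ.integrable, ?_⟩))
  calc ∫⁻ s in Ioc (1 : ℝ) (max 1 t), κ.law s.toNNReal univ
      ≤ ∫⁻ _ in Ioc (1 : ℝ) (max 1 t), κ.law 1 univ :=
        setLIntegral_mono' measurableSet_Ioc fun s hs => κ.law_anti h.motion one_pos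
          (by rw [← Real.toNNReal_one]; exact Real.toNNReal_le_toNNReal hs.1.le)
    _ < ⊤ := by
        rw [setLIntegral_const, Real.volume_Ioc]
        exact ENNReal.mul_lt_top (measure_lt_top _ _) ENNReal.ofReal_lt_top

omit [MeasurableEq E] in
/-- Time reversal turns the integrability of `κ_s(1)` at `s = 0` into that of `κ_{t-s}(1)`
at `s = t`. -/
theorem intervalIntegrable_law_real (h : IsMeasurableSuperprocess P φ Q) (κ : EntranceLaw P)
    (t : ℝ≥0) : IntervalIntegrable (fun s : ℝ => (κ.law ((t : ℝ) - s).toNNReal).real univ)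
      volume 0 t := by
  have hm : Measurable (fun s : ℝ => (κ.law s.toNNReal).real univ) :=
    ((Measure.measurable_coe MeasurableSet.univ).comp
      (h.measurable_law.comp (measurable_real_toNNReal.prodMk
        (measurable_const (a := κ))))).ennreal_toReal
  have h1 : IntervalIntegrable (fun s : ℝ => (κ.law s.toNNReal).real univ) volume 0 t := by
    rw [intervalIntegrable_iff_integrableOn_Ioc_of_le t.coe_nonneg]
    refine ⟨hm.aestronglyMeasurable, ?_⟩
    rw [hasFiniteIntegral_iff_ofReal (ae_of_all _ fun s => measureReal_nonneg)]
    refine lt_of_eq_of_lt (lintegral_congr fun s => ?_) (h.lintegral_law_lt_top κ t)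
    have := κ.isFiniteMeasure h.motion s.toNNReal
    exact ofReal_measureReal
  simpa using (h1.comp_sub_left (t : ℝ)).symm

omit [MeasurableEq E] in
theorem abs_lawIntegrand_le (h : IsMeasurableSuperprocess P φ Q) (κ : EntranceLaw P) {t T : ℝ≥0}
    {B : ℝ} (hB : ∀ s ≤ T, ∀ y, |φ.eval y (cumulant Q s f)| ≤ B) {s : ℝ} (hs : s ≤ T) :
    |lawIntegrand φ Q κ t f s| ≤ B * (κ.law ((t : ℝ) - s).toNNReal).real univ := by
  have := κ.isFiniteMeasure h.motion ((t : ℝ) - s).toNNReal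
  rw [← Real.norm_eq_abs]
  exact norm_integral_le_of_norm_le_const (ae_of_all _ fun y =>
    hB _ (Real.toNNReal_le_iff_le_coe.2 hs) y)

theorem intervalIntegrable_lawIntegrand (h : IsMeasurableSuperprocess P φ Q)
    (hf : IsBddBorelNonneg f) (κ : EntranceLaw P) (t : ℝ≥0) :
    IntervalIntegrable (lawIntegrand φ Q κ t f) volume 0 t := by
  obtain ⟨B, -, hB⟩ := h.exists_abs_eval_cumulant_le hf t
  refine ((h.intervalIntegrable_law_real κ t).const_mul B).mono_fun'
    (h.measurable_lawIntegrand_right hf κ t).aestronglyMeasurable ?_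
  rw [uIoc_of_le t.coe_nonneg]
  filter_upwards [ae_restrict_mem measurableSet_Ioc] with s hs
  exact h.abs_lawIntegrand_le κ hB hs.2

/-- The evolution equation integrated against `κ_r`, namely
`κ_r(V_u f) = κ_{r+u}(f) - ∫_0^u κ_{r+u-s}(φ(·, V_s f)) ds`. -/
theorem integral_cumulant_law (h : IsMeasurableSuperprocess P φ Q) (hf : IsBddBorelNonneg f)
    (κ : EntranceLaw P) {r u : ℝ≥0} (hr : 0 < r) :
    ∫ y, cumulant Q u f y ∂(κ.law r) = ∫ y, f y ∂(κ.law (r + u))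
      - ∫ s in (0 : ℝ)..u, lawIntegrand φ Q κ (r + u) f s := by
  obtain ⟨B, hB0, hB⟩ := h.exists_abs_eval_cumulant_le hf u
  have := κ.isFiniteMeasure h.motion r
  have hfin := fun t => h.motion.isFiniteKernel t
  have hfin' := fun t x => h.motion.isFiniteMeasure t x
  obtain ⟨a, ha⟩ := hf.bounded
  have hfa : ∀ x, |f x| ≤ a := fun x => by rw [abs_of_nonneg (hf.nonneg x)]; exact ha x
  -- truncating time at `u` makes the integrand bounded
  let G : ℝ → E → ℝ := fun s y => φ.eval y (cumulant Q (min s.toNNReal u) f)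
  have hGm : Measurable (Function.uncurry G) := (h.measurable_eval_cumulant hf).comp
    ((measurable_fst.real_toNNReal.min measurable_const).prodMk measurable_snd)
  have hGB : ∀ s y, |G s y| ≤ B := fun s y => hB _ (min_le_right _ _) y
  have hGeq : ∀ s ∈ uIcc (0 : ℝ) u, ∀ y, φ.eval y (cumulant Q s.toNNReal f) = G s y := by
    intro s hs y
    rw [uIcc_of_le u.coe_nonneg] at hs
    simp only [G]
    rw [min_eq_left (Real.toNNReal_le_iff_le_coe.2 hs.2)]
  let K : ℝ → E → ℝ := fun s x => ∫ y, G s y ∂(P ((u : ℝ) - s).toNNReal x)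
  have hKm : Measurable (fun p : E × ℝ => K p.2 p.1) := by
    have hsf : IsSFiniteKernel (⟨fun p : ℝ≥0 × E => P p.1 p.2, h.measurable_motion⟩ :
        Kernel (ℝ≥0 × E) E) := isSFiniteKernel_of_isFiniteMeasure _ fun p => hfin' p.1 p.2
    exact measurable_integral_kernel_comp
      (⟨fun p : ℝ≥0 × E => P p.1 p.2, h.measurable_motion⟩ : Kernel (ℝ≥0 × E) E)
      (g := fun p : E × ℝ => (((u : ℝ) - p.2).toNNReal, p.1))
      ((measurable_const.sub measurable_snd).real_toNNReal.prodMk measurable_fst)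
      (f := fun (p : E × ℝ) y => G p.2 y)
      (hGm.comp ((measurable_snd.comp measurable_fst).prodMk measurable_snd))
  have hKB : ∀ s x, |K s x| ≤ B := fun s x => by
    rw [← Real.norm_eq_abs]
    refine (norm_integral_le_of_norm_le_const (ae_of_all _ fun y => hGB s y)).trans ?_
    have : (P ((u : ℝ) - s).toNNReal x).real univ ≤ 1 :=
      ENNReal.toReal_le_of_le_ofReal zero_le_one (by simpa using h.motion.le_one _ x)
    exact mul_le_of_le_one_right hB0 this
  have hev : ∀ x, cumulant Q u f x = ∫ y, f y ∂(P u x) - ∫ s in (0 : ℝ)..u, K s x := fun x => by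
    rw [h.superprocess.evolution f hf u x]
    congr 1
    refine intervalIntegral.integral_congr fun s hs => ?_
    exact integral_congr_ae (ae_of_all _ fun y => hGeq s hs y)
  have hint1 : Integrable (fun x => ∫ y, f y ∂(P u x)) (κ.law r) := by
    refine integrable_of_abs_le (C := a)
      (hf.measurable.stronglyMeasurable.integral_kernel).measurable (fun x => ?_) _
    rw [← Real.norm_eq_abs]
    refine (norm_integral_le_of_norm_le_const (ae_of_all _ fun y => hfa y)).trans ?_
    have : (P u x).real univ ≤ 1 :=
      ENNReal.toReal_le_of_le_ofReal zero_le_one (by simpa using h.motion.le_one u x)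
    exact mul_le_of_le_one_right ((hf.nonneg x).trans (ha x)) this
  have hint : Integrable (Function.uncurry fun x s => K s x)
      ((κ.law r).prod (volume.restrict (Ioc (0 : ℝ) u))) :=
    integrable_of_abs_le hKm (fun p => hKB p.2 p.1) _
  have hswap : ∫ x, (∫ s in (0 : ℝ)..u, K s x) ∂(κ.law r)
      = ∫ s in (0 : ℝ)..u, lawIntegrand φ Q κ (r + u) f s := by
    simp_rw [intervalIntegral.integral_of_le u.coe_nonneg]
    rw [integral_integral_swap hint]
    refine setIntegral_congr_fun measurableSet_Ioc fun s hs => ?_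
    simp only [K, lawIntegrand]
    rw [← integral_bind_kernel (κ.law r) (P _) (f := G s) (hGm.comp measurable_prodMk_left) (hGB s),
      ← κ.entrance r _ hr]
    have : ((r + u : ℝ≥0) - s : ℝ).toNNReal = r + ((u : ℝ) - s).toNNReal := by
      rw [NNReal.coe_add, add_sub_assoc, Real.toNNReal_add r.coe_nonneg (sub_nonneg.2 hs.2),
        Real.toNNReal_coe]
    rw [this]
    exact integral_congr_ae (ae_of_all _ fun y =>
      (hGeq s (by rw [uIcc_of_le u.coe_nonneg]; exact ⟨hs.1.le, hs.2⟩) y).symm)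
  rw [integral_congr_ae (ae_of_all _ hev), integral_sub hint1 (by
    simp_rw [intervalIntegral.integral_of_le u.coe_nonneg]; exact hint.integral_prod_left), hswap,
    ← integral_bind_kernel (κ.law r) (P u) hf.measurable hfa, ← κ.entrance r u hr]

end Evolution

end IsMeasurableSuperprocess

end

section

/-! ### Comparison of the cumulant semigroup with linear equations -/

variable {E : Type u} [MeasurableSpace E] {P : ℝ≥0 → Kernel E E} {φ : BranchingMechanism E}
  {Q : ℝ≥0 → Kernel (FiniteMeasure E) (FiniteMeasure E)} {f g : E → ℝ}

open Classical in
/-- The entrance law `(P_t(x, ·))_{t > 0}`, set to `0` at `t = 0` as the normalization of entrance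
laws demands. -/
def diracLaw (hP : IsTransitionSemigroup P) (x : E) : EntranceLaw P where
  law t := if t = 0 then 0 else P t x
  law_zero := if_pos rfl
  entrance r t hr := by
    rw [if_neg (add_pos_of_pos_of_nonneg hr t.2).ne', if_neg hr.ne', hP.add, Kernel.comp_apply]
  integrable := by
    refine lt_of_le_of_lt (lintegral_mono (g := fun _ => 1) fun s => ?_) (by simp)
    split_ifs
    · simp
    · exact hP.le_one _ x

theorem diracLaw_law (hP : IsTransitionSemigroup P) (x : E) {t : ℝ≥0} (ht : t ≠ 0) :
    (diracLaw hP x).law t = P t x := if_neg ht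

namespace IsMeasurableSuperprocess

variable [MeasurableEq E]

omit [MeasurableEq E] in
theorem measureReal_motion_le_one (h : IsMeasurableSuperprocess P φ Q) (t : ℝ≥0) (x : E) :
    (P t x).real univ ≤ 1 :=
  ENNReal.toReal_le_of_le_ofReal zero_le_one (by simpa using h.motion.le_one t x)

omit [MeasurableEq E] in
theorem cumulant_eq_diracLaw (h : IsMeasurableSuperprocess P φ Q) (hf : IsBddBorelNonneg f)
    (t : ℝ≥0) (x : E) : cumulant Q t f x = ∫ y, f y ∂(P t x)
      - ∫ s in (0 : ℝ)..t, lawIntegrand φ Q (diracLaw h.motion x) t f s := by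
  rw [h.superprocess.evolution f hf t x]
  congr 1
  refine intervalIntegral.integral_congr_ae ?_
  have hne : ∀ᵐ s : ℝ, s ≠ t := by simp [ae_iff]
  filter_upwards [hne] with s hs hst
  rw [uIoc_of_le t.coe_nonneg] at hst
  have : ((t : ℝ) - s).toNNReal ≠ 0 :=
    (Real.toNNReal_pos.2 (sub_pos.2 (lt_of_le_of_ne hst.2 hs))).ne'
  rw [lawIntegrand, diracLaw_law _ _ this]

/-- The evolution equation with an exponential weight `e^{Ks}`. For `K` large,
`K V_s f - φ(·, V_s f)` is bounded by an increasing function of `sup V_s f`, which is what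
comparison needs. -/
theorem exp_mul_cumulant_eq (h : IsMeasurableSuperprocess P φ Q) (hf : IsBddBorelNonneg f)
    (K : ℝ) (t : ℝ≥0) (x : E) :
    IntervalIntegrable (fun s : ℝ => Real.exp (K * s) * ∫ y, (K * cumulant Q s.toNNReal f y
      - φ.eval y (cumulant Q s.toNNReal f)) ∂(P ((t : ℝ) - s).toNNReal x)) volume 0 t ∧
    Real.exp (K * t) * cumulant Q t f x = ∫ y, f y ∂(P t x)
      + ∫ s in (0 : ℝ)..t, Real.exp (K * s) * ∫ y, (K * cumulant Q s.toNNReal f y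
          - φ.eval y (cumulant Q s.toNNReal f)) ∂(P ((t : ℝ) - s).toNNReal x) := by
  set κ := diracLaw h.motion x
  set A := ∫ y, f y ∂(P t x)
  have hint := h.intervalIntegrable_lawIntegrand hf κ t
  obtain ⟨B, hB0, hB⟩ := h.exists_abs_eval_cumulant_le hf t
  have hae : ∀ᵐ s : ℝ, s ∈ uIoc (0 : ℝ) t →
      Real.exp (K * s) * (K * (A - ∫ r in (0 : ℝ)..s, lawIntegrand φ Q κ t f r)
        - lawIntegrand φ Q κ t f s)
      = Real.exp (K * s) * ∫ y, (K * cumulant Q s.toNNReal f y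
          - φ.eval y (cumulant Q s.toNNReal f)) ∂(P ((t : ℝ) - s).toNNReal x) := by
    have hne : ∀ᵐ s : ℝ, s ≠ t := by simp [ae_iff]
    filter_upwards [hne] with s hs hst
    rw [uIoc_of_le t.coe_nonneg] at hst
    have hr : 0 < ((t : ℝ) - s).toNNReal :=
      Real.toNNReal_pos.2 (sub_pos.2 (lt_of_le_of_ne hst.2 hs))
    have hrt : ((t : ℝ) - s).toNNReal + s.toNNReal = t := by
      rw [← Real.toNNReal_add (sub_nonneg.2 hst.2) hst.1.le, sub_add_cancel, Real.toNNReal_coe]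
    have hG := h.integral_cumulant_law hf κ (u := s.toNNReal) hr
    have ht0 : t ≠ 0 := by
      rintro rfl
      exact absurd (hst.1.trans_le hst.2) (by simp)
    rw [hrt, Real.coe_toNNReal s hst.1.le, diracLaw_law _ _ hr.ne', diracLaw_law _ _ ht0] at hG
    have := h.motion.isFiniteMeasure ((t : ℝ) - s).toNNReal x
    rw [← hG, lawIntegrand, diracLaw_law _ _ hr.ne', integral_sub, integral_const_mul]
    · exact ((h.isBddBorelNonneg_cumulant hf _).integrable _).const_mul K
    · exact integrable_of_abs_le ((h.measurable_eval_cumulant hf).comp measurable_prodMk_left)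
        (hB _ (Real.toNNReal_le_iff_le_coe.2 hst.2)) _
  constructor
  · have hW : ContinuousOn (fun s : ℝ => A - ∫ r in (0 : ℝ)..s, lawIntegrand φ Q κ t f r)
        (uIcc 0 (t : ℝ)) :=
      continuousOn_const.sub (intervalIntegral.continuousOn_primitive_interval' hint
        left_mem_uIcc)
    have h1 : IntervalIntegrable (fun s => Real.exp (K * s) *
        (K * (A - ∫ r in (0 : ℝ)..s, lawIntegrand φ Q κ t f r) - lawIntegrand φ Q κ t f s))
        volume 0 t :=
      (((hW.const_smul K).intervalIntegrable).sub hint).continuousOn_mul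
        (by fun_prop)
    exact h1.congr_ae ((ae_restrict_iff' measurableSet_uIoc).2 hae)
  · rw [h.cumulant_eq_diracLaw hf t x, exp_mul_primitive_eq A K hint]
    congr 1
    exact intervalIntegral.integral_congr_ae hae

/-- One step of the comparison argument: an upper bound `U + D e^{(K - 2p)s}` improves to
`U + (D / 2) e^{(K - 2p)t}`. -/
theorem cumulant_le_step (h : IsMeasurableSuperprocess P φ Q) (hf : IsBddBorelNonneg f)
    {p q K D : ℝ} {U : ℝ → ℝ} {T : ℝ≥0} (hq : 0 ≤ q) (hD : 0 ≤ D)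
    (hloc : ∀ x z, 0 ≤ z → p * z - q ≤ φ.localProjection x z)
    (hK : ∀ x, p + (φ.γ x).real univ ≤ K)
    (hU : ∀ s, HasDerivAt U (-(p * U s) + q) s) (hf0 : ∀ x, f x ≤ U 0)
    (hV : ∀ s : ℝ≥0, s ≤ T → ∀ x, cumulant Q s f x ≤ U s + D * Real.exp ((K - 2 * p) * s))
    {t : ℝ≥0} (ht : t ≤ T) (x : E) :
    cumulant Q t f x ≤ U t + D / 2 * Real.exp ((K - 2 * p) * t) := by
  obtain ⟨hint, heq⟩ := h.exp_mul_cumulant_eq hf K t x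
  have hKp : 0 ≤ K - p := by linarith [hK x, measureReal_nonneg (μ := φ.γ x) (s := univ)]
  let G : ℝ → ℝ := fun s => (K - p) * (U s + D * Real.exp ((K - 2 * p) * s)) + q
  have hUc : Continuous U := continuous_iff_continuousAt.2 fun s => (hU s).continuousAt
  have hGc : Continuous (fun s => Real.exp (K * s) * G s) := by fun_prop
  let Y : ℝ → ℝ := fun s => Real.exp (K * s) * (U s + D / 2 * Real.exp ((K - 2 * p) * s))
  have hexp : ∀ k s : ℝ, HasDerivAt (fun s => Real.exp (k * s)) (Real.exp (k * s) * k) s :=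
    fun k s => by simpa using ((hasDerivAt_id s).const_mul k).exp
  have hY : ∀ s, HasDerivAt Y (Real.exp (K * s) * G s) s := fun s => by
    refine ((hexp K s).mul ((hU s).add ((hexp (K - 2 * p) s).const_mul (D / 2)))).congr_deriv ?_
    simp only [G, Pi.add_apply]
    ring
  have hle : ∫ s in (0 : ℝ)..t, Real.exp (K * s) * ∫ y, (K * cumulant Q s.toNNReal f y
          - φ.eval y (cumulant Q s.toNNReal f)) ∂(P ((t : ℝ) - s).toNNReal x)
      ≤ ∫ s in (0 : ℝ)..t, Real.exp (K * s) * G s := by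
    refine intervalIntegral.integral_mono_on t.coe_nonneg hint (hGc.intervalIntegrable _ _)
      fun s hs => mul_le_mul_of_nonneg_left ?_ (Real.exp_pos _).le
    have := h.motion.isFiniteMeasure ((t : ℝ) - s).toNNReal x
    have hsT : s.toNNReal ≤ T := (Real.toNNReal_le_iff_le_coe.2 hs.2).trans ht
    obtain ⟨B, hB0, hB⟩ := h.exists_abs_eval_cumulant_le hf T
    have hVs := hV s.toNNReal hsT
    rw [Real.coe_toNNReal s hs.1] at hVs
    have hm0 : 0 ≤ U s + D * Real.exp ((K - 2 * p) * s) :=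
      (h.cumulant_nonneg hf _ x).trans (hVs x)
    have hG0 : 0 ≤ G s := add_nonneg (mul_nonneg hKp hm0) hq
    calc ∫ y, (K * cumulant Q s.toNNReal f y - φ.eval y (cumulant Q s.toNNReal f))
          ∂(P ((t : ℝ) - s).toNNReal x)
        ≤ ∫ _, G s ∂(P ((t : ℝ) - s).toNNReal x) := by
          refine integral_mono ?_ (integrable_const _) fun y =>
            φ.mul_sub_eval_le y (h.isBddBorelNonneg_cumulant hf _) hVs (hloc y) (hK y)
          exact (((h.isBddBorelNonneg_cumulant hf _).integrable _).const_mul K).sub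
            (integrable_of_abs_le ((h.measurable_eval_cumulant hf).comp measurable_prodMk_left)
              (hB _ hsT) _)
      _ = (P ((t : ℝ) - s).toNNReal x).real univ * G s := by rw [integral_const, smul_eq_mul]
      _ ≤ G s := mul_le_of_le_one_left hG0 (h.measureReal_motion_le_one _ x)
  rw [intervalIntegral.integral_eq_sub_of_hasDerivAt (fun s _ => hY s)
    (hGc.intervalIntegrable _ _)] at hle
  have hA : ∫ y, f y ∂(P t x) ≤ U 0 := by
    have := h.motion.isFiniteMeasure t x
    calc ∫ y, f y ∂(P t x) ≤ ∫ _, U 0 ∂(P t x) :=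
          integral_mono (hf.integrable _) (integrable_const _) hf0
      _ = (P t x).real univ * U 0 := by rw [integral_const, smul_eq_mul]
      _ ≤ U 0 := mul_le_of_le_one_left ((hf.nonneg x).trans (hf0 x))
          (h.measureReal_motion_le_one t x)
  have hY0 : U 0 ≤ Y 0 := by simp [Y]; linarith
  have hfin : Real.exp (K * t) * cumulant Q t f x ≤ Y t := by linarith
  exact le_of_mul_le_mul_left hfin (Real.exp_pos _)

/-- Comparison with a linear equation: if `φ₁(x, z) ≥ p z - q` for all `x`, then `V_t f` is
dominated by the solution of `U' = -p U + q` with `U(0) ≥ sup f`. -/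
theorem cumulant_le_of_affine (h : IsMeasurableSuperprocess P φ Q) (hf : IsBddBorelNonneg f)
    {p q : ℝ} {U : ℝ → ℝ} (hq : 0 ≤ q)
    (hloc : ∀ x z, 0 ≤ z → p * z - q ≤ φ.localProjection x z)
    (hU : ∀ s, HasDerivAt U (-(p * U s) + q) s) (hf0 : ∀ x, f x ≤ U 0) (t : ℝ≥0) (x : E) :
    cumulant Q t f x ≤ U t := by
  obtain ⟨M, hM0, hM⟩ := φ.exists_γ_real_le
  set K := max (p + M) (2 * p)
  have hK : ∀ x, p + (φ.γ x).real univ ≤ K := fun x =>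
    (add_le_add_right (hM x) p).trans (le_max_left _ _)
  have hα : 0 ≤ K - 2 * p := sub_nonneg.2 (le_max_right _ _)
  obtain ⟨C, hC⟩ := h.superprocess.locally_bounded f hf t
  have hUc : Continuous U := continuous_iff_continuousAt.2 fun s => (hU s).continuousAt
  obtain ⟨s₀, -, hs₀⟩ := (isCompact_Icc (a := (0 : ℝ)) (b := t)).exists_isMinOn
    ⟨0, left_mem_Icc.2 t.coe_nonneg⟩ hUc.continuousOn
  set D := |C| + |U s₀|
  have hD : 0 ≤ D := by positivity
  have key : ∀ n : ℕ, ∀ s : ℝ≥0, s ≤ t → ∀ x,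
      cumulant Q s f x ≤ U s + D / 2 ^ n * Real.exp ((K - 2 * p) * s) := by
    intro n
    induction n with
    | zero =>
      intro s hs x
      have h1 : U s₀ ≤ U s := hs₀ ⟨s.coe_nonneg, NNReal.coe_le_coe.2 hs⟩
      have h2 : 1 ≤ Real.exp ((K - 2 * p) * s) := Real.one_le_exp (mul_nonneg hα s.coe_nonneg)
      have h3 := hC s hs x
      have h4 : D ≤ D * Real.exp ((K - 2 * p) * s) := le_mul_of_one_le_right hD h2
      rw [pow_zero, div_one]
      linarith [le_abs_self C, neg_abs_le (U s₀)]
    | succ n ih =>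
      intro s hs x
      have := h.cumulant_le_step hf hq (D := D / 2 ^ n) (by positivity) hloc hK hU hf0 ih hs x
      rwa [div_div, ← pow_succ] at this
  have hlim : Tendsto (fun n : ℕ => U t + D / 2 ^ n * Real.exp ((K - 2 * p) * t)) atTop
      (𝓝 (U t + 0 * Real.exp ((K - 2 * p) * t))) :=
    ((tendsto_const_nhds.div_atTop (tendsto_pow_atTop_atTop_of_one_lt one_lt_two)).mul_const
      _).const_add _
  rw [zero_mul, add_zero] at hlim
  exact ge_of_tendsto' hlim fun n => key n t le_rfl x

/-- `V_t f ≤ ‖f‖ e^{-β_* t}`. -/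
theorem cumulant_le_exp (h : IsMeasurableSuperprocess P φ Q) (hf : IsBddBorelNonneg f) {a : ℝ}
    (hfa : ∀ x, f x ≤ a) (t : ℝ≥0) (x : E) :
    cumulant Q t f x ≤ a * Real.exp (-(φ.betaStar * t)) := by
  refine h.cumulant_le_of_affine hf (p := φ.betaStar) (q := 0)
    (U := fun s => a * Real.exp (-(φ.betaStar * s))) le_rfl
    (fun x z hz => by simpa using φ.betaStar_mul_le_localProjection x hz) (fun s => ?_)
    (by simpa using hfa) t x
  refine ((((hasDerivAt_id s).const_mul φ.betaStar).neg.exp).const_mul a).congr_deriv ?_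
  simp
  ring

end IsMeasurableSuperprocess

end

section

/-! ### Grey's condition and coming down from infinity -/

namespace CBMechanism

variable (ψ : CBMechanism)

theorem integrableOn_min : IntegrableOn (fun u : ℝ => min u (u ^ 2)) (Ioi 0) ψ.m := by
  refine ⟨by fun_prop, ?_⟩
  rw [hasFiniteIntegral_iff_ofReal]
  · exact ψ.m_moment
  · filter_upwards [ae_restrict_mem measurableSet_Ioi] with u hu
    exact le_min (le_of_lt hu) (sq_nonneg u)

theorem integrableOn_of_le {k : ℝ → ℝ} {a : ℝ} (hk : Measurable k) (h0 : ∀ u, 0 < u → 0 ≤ k u)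
    (h1 : ∀ u, 0 < u → k u ≤ a * u) (h2 : ∀ u, 0 < u → k u ≤ a * u ^ 2) :
    IntegrableOn k (Ioi 0) ψ.m := by
  refine (ψ.integrableOn_min.const_mul a).mono' hk.aestronglyMeasurable ?_
  filter_upwards [ae_restrict_mem measurableSet_Ioi] with u hu
  rw [Real.norm_of_nonneg (h0 u hu)]
  rcases min_cases u (u ^ 2) with ⟨h, -⟩ | ⟨h, -⟩ <;> rw [h]
  exacts [h1 u hu, h2 u hu]

theorem integrableOn_exp {z : ℝ} (hz : 0 ≤ z) :
    IntegrableOn (fun u : ℝ => Real.exp (-(z * u)) - 1 + z * u) (Ioi 0) ψ.m := by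
  refine ψ.integrableOn_of_le (a := z + z ^ 2) (by fun_prop)
    (fun u _ => exp_neg_sub_one_add_nonneg _) (fun u hu => ?_) (fun u hu => ?_)
  · have := exp_neg_sub_one_add_le (mul_nonneg hz hu.le)
    nlinarith [mul_nonneg (sq_nonneg z) hu.le]
  · have := exp_neg_sub_one_add_le_sq (mul_nonneg hz hu.le)
    nlinarith [mul_nonneg hz (sq_nonneg u)]

theorem eval_zero : ψ.eval 0 = 0 := by simp [eval]

/-- Tangent lines of the convex function `φ_*`. -/
theorem exists_tangent {z : ℝ} (hz : 0 ≤ z) :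
    ∃ p : ℝ, ∀ w, 0 ≤ w → ψ.eval z + p * (w - z) ≤ ψ.eval w := by
  have hI : IntegrableOn (fun u : ℝ => u * (1 - Real.exp (-(z * u)))) (Ioi 0) ψ.m := by
    refine ψ.integrableOn_of_le (a := 1 + z) (by fun_prop) (fun u hu => ?_) (fun u hu => ?_)
      (fun u hu => ?_)
    · exact mul_nonneg hu.le (sub_nonneg.2 (Real.exp_le_one_iff.2
        (neg_nonpos.2 (mul_nonneg hz hu.le))))
    · nlinarith [mul_pos hu (Real.exp_pos (-(z * u))), mul_nonneg hz hu.le]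
    · nlinarith [mul_le_mul_of_nonneg_left (Real.add_one_le_exp (-(z * u))) hu.le, sq_nonneg u]
  refine ⟨ψ.b + 2 * ψ.c * z + ∫ u in Ioi (0 : ℝ), u * (1 - Real.exp (-(z * u))) ∂ψ.m,
    fun w hw => ?_⟩
  have hmono := setIntegral_mono_on ((ψ.integrableOn_exp hz).add (hI.mul_const (w - z)))
    (ψ.integrableOn_exp hw) measurableSet_Ioi fun u _ => by
      simp only [Pi.add_apply]
      have h1 := mul_le_mul_of_nonneg_left (Real.add_one_le_exp (-(u * (w - z))))
        (Real.exp_pos (-(z * u))).le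
      rw [← Real.exp_add] at h1
      have h2 : -(z * u) + -(u * (w - z)) = -(w * u) := by ring
      rw [h2] at h1
      linarith
  have hadd := integral_add (ψ.integrableOn_exp hz) (hI.mul_const (w - z))
  simp only [Pi.add_apply] at hmono
  rw [hadd, integral_mul_const] at hmono
  unfold eval
  nlinarith [mul_nonneg ψ.c_nonneg (sq_nonneg (w - z))]

/-- Where `φ_*` is positive, it has tangent lines `p w - q` with `p > 0` and `q ≥ 0`. -/
theorem exists_affine_minorant {z : ℝ} (hz : 0 < z) (hpos : 0 < ψ.eval z) :
    ∃ p : ℝ, 0 < p ∧ 0 ≤ p * z - ψ.eval z ∧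
      ∀ w, 0 ≤ w → p * w - (p * z - ψ.eval z) ≤ ψ.eval w := by
  obtain ⟨p, hp⟩ := ψ.exists_tangent hz.le
  have h0 := hp 0 le_rfl
  rw [ψ.eval_zero] at h0
  have hpz : ψ.eval z ≤ p * z := by linarith
  refine ⟨p, pos_of_mul_pos_left (hpos.trans_le hpz) hz.le, sub_nonneg.2 hpz, fun w hw => ?_⟩
  linarith [hp w hw]

theorem eval_mono {z w : ℝ} (hz : 0 < z) (hpos : 0 < ψ.eval z) (hzw : z ≤ w) :
    ψ.eval z ≤ ψ.eval w := by
  obtain ⟨p, hp, -, h⟩ := ψ.exists_affine_minorant hz hpos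
  have := h w (hz.le.trans hzw)
  nlinarith [mul_nonneg hp.le (sub_nonneg.2 hzw)]

end CBMechanism

namespace IsMeasurableSuperprocess

variable {E : Type u} [MeasurableSpace E] [MeasurableEq E] {P : ℝ≥0 → Kernel E E}
  {φ : BranchingMechanism E} {Q : ℝ≥0 → Kernel (FiniteMeasure E) (FiniteMeasure E)} {f : E → ℝ}
  {ψ : CBMechanism}

/-- If `φ₁ ≥ φ_*`, the cumulant semigroup comes down from `2z` to `z` within time
`z / φ_*(z)`. -/
theorem cumulant_le_half (h : IsMeasurableSuperprocess P φ Q)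
    (hψ : ∀ x z, 0 ≤ z → ψ.eval z ≤ φ.localProjection x z) {z : ℝ} (hz : 0 < z)
    (hpos : 0 < ψ.eval z) (hf : IsBddBorelNonneg f) (hfz : ∀ x, f x ≤ 2 * z) {t : ℝ≥0}
    (ht : z / ψ.eval z ≤ t) (x : E) : cumulant Q t f x ≤ z := by
  obtain ⟨p, hp, hq, hmin⟩ := ψ.exists_affine_minorant hz hpos
  set q := p * z - ψ.eval z with hq_def
  have hU := h.cumulant_le_of_affine hf (p := p) (q := q)
    (U := fun s => q / p + (2 * z - q / p) * Real.exp (-(p * s))) hq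
    (fun x w hw => (hmin w hw).trans (hψ x w hw)) (fun s => ?_) (by simpa using hfz) t x
  · refine hU.trans ?_
    have h1 : 1 + p * z / ψ.eval z ≤ Real.exp (p * t) := by
      have := Real.add_one_le_exp (p * t)
      have h2 : p * z / ψ.eval z ≤ p * t := by
        rw [mul_div_assoc]; exact mul_le_mul_of_nonneg_left ht hp.le
      linarith
    have h2 : (ψ.eval z + p * z) * Real.exp (-(p * t)) ≤ ψ.eval z := by
      rw [Real.exp_neg, ← div_eq_mul_inv, div_le_iff₀ (Real.exp_pos _)]
      calc ψ.eval z + p * z = ψ.eval z * (1 + p * z / ψ.eval z) := by field_simp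
        _ ≤ _ := mul_le_mul_of_nonneg_left h1 hpos.le
    have h3 : q / p + (2 * z - q / p) * Real.exp (-(p * t))
        = z + ((ψ.eval z + p * z) * Real.exp (-(p * t)) - ψ.eval z) / p := by
      rw [hq_def]; field_simp; ring
    rw [h3]
    have := div_nonpos_of_nonpos_of_nonneg (sub_nonpos.2 h2) hp.le
    linarith
  · have he : HasDerivAt (fun s => Real.exp (-(p * s))) (Real.exp (-(p * s)) * -p) s := by
      simpa using (((hasDerivAt_id s).const_mul p).neg).exp
    refine ((he.const_mul (2 * z - q / p)).const_add (q / p)).congr_deriv ?_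
    field_simp
    ring

/-- Under Grey's condition the cumulant semigroup comes down from infinity: at some time, it is
bounded uniformly in the initial function. It descends from any level `2 ^ n z₀` by successive
halvings, whose durations add up to at most `2 ∫_{z₀}^∞ φ_*(z)⁻¹ dz`. -/
theorem exists_cumulant_le (h : IsMeasurableSuperprocess P φ Q)
    (hψ : ∀ x z, 0 ≤ z → ψ.eval z ≤ φ.localProjection x z) (hG : ψ.Grey) :
    ∃ (T : ℝ≥0) (C : ℝ), 0 ≤ C ∧ ∀ f : E → ℝ, IsBddBorelNonneg f → ∀ x, cumulant Q T f x ≤ C := by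
  obtain ⟨z₀, hz₀, hpos, hint⟩ := hG
  let ζ : ℕ → ℝ := fun k => 2 ^ k * z₀
  have hζ : ∀ k, z₀ ≤ ζ k := fun k => le_mul_of_one_le_left hz₀.le (one_le_pow₀ one_le_two)
  have hζ0 : ∀ k, 0 < ζ k := fun k => hz₀.trans_le (hζ k)
  have hζs : ∀ k, ζ (k + 1) = 2 * ζ k := fun k => by simp only [ζ, pow_succ]; ring
  let τ : ℕ → ℝ := fun k => ζ (k + 1) / ψ.eval (ζ (k + 1))
  have hτ : ∀ k, 0 ≤ τ k := fun k => div_nonneg (hζ0 _).le (hpos _ (hζ _)).le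
  let T : ℕ → ℝ≥0 := fun n => ∑ k ∈ Finset.range n, (τ k).toNNReal
  -- the total time spent descending is bounded
  have hsum : ∀ n, (T n : ℝ) ≤ 2 * ∫ z in Ioc z₀ (ζ n), (ψ.eval z)⁻¹ := by
    intro n
    induction n with
    | zero => simp [T, ζ]
    | succ n ih =>
      have hle : ζ n ≤ ζ (n + 1) := by rw [hζs]; linarith [hζ0 n]
      have hsub : Ioc (ζ n) (ζ (n + 1)) ⊆ Ioi z₀ := fun z hz => (hζ n).trans_lt hz.1
      have hstep : τ n ≤ 2 * ∫ z in Ioc (ζ n) (ζ (n + 1)), (ψ.eval z)⁻¹ := by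
        have h1 : ∫ _ in Ioc (ζ n) (ζ (n + 1)), (ψ.eval (ζ (n + 1)))⁻¹
            ≤ ∫ z in Ioc (ζ n) (ζ (n + 1)), (ψ.eval z)⁻¹ := by
          refine setIntegral_mono_on (integrable_const _) (hint.mono_set hsub) measurableSet_Ioc
            fun z hz => ?_
          have hz0 : z₀ ≤ z := (hsub hz).le
          exact inv_anti₀ (hpos z hz0) (ψ.eval_mono (hz₀.trans_le hz0) (hpos z hz0) hz.2)
        rw [integral_const, measureReal_restrict_apply_univ, Real.volume_real_Ioc_of_le hle,
          smul_eq_mul, hζs] at h1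
        simp only [τ]
        rw [hζs, div_eq_mul_inv]
        linarith
      have hun : Ioc z₀ (ζ (n + 1)) = Ioc z₀ (ζ n) ∪ Ioc (ζ n) (ζ (n + 1)) :=
        (Ioc_union_Ioc_eq_Ioc (hζ n) hle).symm
      rw [hun, setIntegral_union (Ioc_disjoint_Ioc_of_le le_rfl) measurableSet_Ioc
        (hint.mono_set Ioc_subset_Ioi_self) (hint.mono_set hsub)]
      simp only [T, Finset.sum_range_succ, NNReal.coe_add] at ih ⊢
      rw [Real.coe_toNNReal _ (hτ n)]
      linarith
  set S := 2 * ∫ z in Ioi z₀, (ψ.eval z)⁻¹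
  have hS : ∀ n, (T n : ℝ) ≤ S := fun n => (hsum n).trans
    (mul_le_mul_of_nonneg_left (setIntegral_mono_set hint
      ((ae_restrict_iff' measurableSet_Ioi).2 (ae_of_all _ fun z hz =>
        inv_nonneg.2 (hpos z (le_of_lt hz)).le)) Ioc_subset_Ioi_self.eventuallyLE) zero_le_two)
  have hS0 : 0 ≤ S := (T 0).coe_nonneg.trans (hS 0)
  -- descending from level `ζ (n + 1)` to level `ζ 1`
  have hdesc : ∀ n, ∀ f : E → ℝ, IsBddBorelNonneg f → (∀ x, f x ≤ ζ (n + 1)) → ∀ x,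
      cumulant Q (T n) f x ≤ ζ 1 := by
    intro n
    induction n with
    | zero =>
      intro f hf hfz x
      have : T 0 = 0 := by simp [T]
      rw [this, h.cumulant_zero hf]
      exact hfz x
    | succ n ih =>
      intro f hf hfz x
      have hT : T (n + 1) = T n + (τ n).toNNReal := Finset.sum_range_succ _ _
      rw [hT, h.cumulant_add hf]
      refine ih _ (h.isBddBorelNonneg_cumulant hf _) (fun y => ?_) x
      exact h.cumulant_le_half hψ (hζ0 _) (hpos _ (hζ _)) hf (fun y => by rw [← hζs]; exact hfz y)
        (Real.le_coe_toNNReal _) y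
  refine ⟨S.toNNReal, ζ 1 * Real.exp (|φ.betaStar| * S),
    mul_nonneg (hζ0 1).le (Real.exp_pos _).le, fun f hf x => ?_⟩
  obtain ⟨a, ha⟩ := hf.bounded
  obtain ⟨n, hn⟩ := pow_unbounded_of_one_lt (a / z₀) one_lt_two
  have hfn : ∀ x, f x ≤ ζ (n + 1) := fun x => ((ha x).trans ((div_le_iff₀ hz₀).1 hn.le)).trans
    (by rw [hζs]; linarith [hζ0 n])
  have hTn : T n ≤ S.toNNReal := NNReal.le_toNNReal_of_coe_le (hS n)
  rw [← tsub_add_cancel_of_le hTn, h.cumulant_add hf]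
  refine (h.cumulant_le_exp (h.isBddBorelNonneg_cumulant hf _) (hdesc n f hf hfn) _ x).trans
    (mul_le_mul_of_nonneg_left (Real.exp_le_exp.2 ?_) (hζ0 1).le)
  have h1 : ((S.toNNReal - T n : ℝ≥0) : ℝ) ≤ S := by
    rw [NNReal.coe_sub hTn, Real.coe_toNNReal S hS0]
    linarith [(T n).coe_nonneg]
  calc -(φ.betaStar * ((S.toNNReal - T n : ℝ≥0) : ℝ))
      ≤ |φ.betaStar| * ((S.toNNReal - T n : ℝ≥0) : ℝ) := by
        rw [← neg_mul]
        exact mul_le_mul_of_nonneg_right (neg_le_abs _) (NNReal.coe_nonneg _)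
    _ ≤ |φ.betaStar| * S := mul_le_mul_of_nonneg_left h1 (abs_nonneg _)

end IsMeasurableSuperprocess

end

section

/-! ### First moments and cumulants of entrance laws -/

section FirstMoments

variable {E : Type u} [MeasurableSpace E]

theorem integral_const_finiteMeasure (ν : FiniteMeasure E) (a : ℝ) :
    ∫ _, a ∂(ν : Measure E) = a * (ν : Measure E).real univ := by
  rw [integral_const, smul_eq_mul, mul_comm]

theorem measurable_mass_real : Measurable (fun ν : FiniteMeasure E => (ν : Measure E).real univ) :=
  BranchingMechanism.measurable_measureReal MeasurableSet.univ

theorem one_sub_laplace_eq (R : Measure (FiniteMeasure E)) [IsProbabilityMeasure R] {a : ℝ}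
    (ha : 0 ≤ a) : 1 - laplace R (fun _ => a)
      = ∫ ν : FiniteMeasure E, (1 - Real.exp (-(a * (ν : Measure E).real univ))) ∂(R) := by
  have h := integrable_exp_neg R (isBddBorelNonneg_const ha)
  simp_rw [integral_const_finiteMeasure] at h
  simp_rw [laplace, integral_const_finiteMeasure]
  rw [integral_sub (integrable_const 1) h, integral_const, probReal_univ, one_smul]

variable {θ : ℕ → ℝ}

theorem tendsto_one_sub_exp_div (hθ : Tendsto θ atTop (𝓝 0)) (hθ0 : ∀ n, 0 < θ n)
    {m : ℝ} (hm : 0 ≤ m) :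
    Tendsto (fun n => (1 - Real.exp (-(θ n * m))) / θ n) atTop (𝓝 m) := by
  have := (tendsto_exp_neg_sub_one_div hθ hθ0 (a := fun _ => m) (fun _ => hm)
    tendsto_const_nhds).neg
  rw [neg_neg] at this
  exact this.congr fun n => by ring

theorem one_sub_exp_neg_div_nonneg {a m : ℝ} (ha : 0 < a) (hm : 0 ≤ m) :
    0 ≤ (1 - Real.exp (-(a * m))) / a :=
  div_nonneg (sub_nonneg.2 (Real.exp_le_one_iff.2 (neg_nonpos.2 (mul_nonneg ha.le hm)))) ha.le

/-- By Fatou's lemma, a linear bound on `1 - L_R` at small constants bounds the first moment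
of `R`. -/
theorem lintegral_mass_le (R : Measure (FiniteMeasure E)) [IsProbabilityMeasure R] {M : ℝ}
    (hθ : Tendsto θ atTop (𝓝 0)) (hθ0 : ∀ n, 0 < θ n)
    (hM : ∀ n, 1 - laplace R (fun _ => θ n) ≤ θ n * M) :
    ∫⁻ ν, (ν : Measure E) univ ∂(R) ≤ ENNReal.ofReal M := by
  have hm0 : ∀ ν : FiniteMeasure E, 0 ≤ (ν : Measure E).real univ := fun ν => measureReal_nonneg
  let F : ℕ → FiniteMeasure E → ℝ≥0∞ := fun n ν =>
    ENNReal.ofReal ((1 - Real.exp (-(θ n * (ν : Measure E).real univ))) / θ n)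
  have hFr : ∀ n, Measurable (fun ν : FiniteMeasure E =>
      (1 - Real.exp (-(θ n * (ν : Measure E).real univ))) / θ n) := fun n =>
    ((Real.measurable_exp.comp (measurable_mass_real.const_mul _).neg).const_sub 1).div_const _
  have hlim : ∀ ν : FiniteMeasure E, liminf (fun n => F n ν) atTop = (ν : Measure E) univ := by
    intro ν
    rw [← ofReal_measureReal]
    exact (ENNReal.tendsto_ofReal (tendsto_one_sub_exp_div hθ hθ0 (hm0 ν))).liminf_eq
  calc ∫⁻ ν, (ν : Measure E) univ ∂(R) = ∫⁻ ν, liminf (fun n => F n ν) atTop ∂(R) := by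
        simp_rw [hlim]
    _ ≤ liminf (fun n => ∫⁻ ν, F n ν ∂(R)) atTop :=
        lintegral_liminf_le fun n => (hFr n).ennreal_ofReal
    _ ≤ ENNReal.ofReal M := by
        refine liminf_le_of_le (by isBoundedDefault) fun b hb => ?_
        obtain ⟨n, hn⟩ := hb.exists
        refine hn.trans ?_
        have hint : Integrable (fun ν : FiniteMeasure E =>
            (1 - Real.exp (-(θ n * (ν : Measure E).real univ))) / θ n) R := by
          have h := integrable_exp_neg R (isBddBorelNonneg_const (hθ0 n).le)
          simp_rw [integral_const_finiteMeasure] at h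
          exact ((integrable_const 1).sub h).div_const _
        simp only [F]
        rw [← ofReal_integral_eq_lintegral_ofReal hint
          (ae_of_all _ fun ν => one_sub_exp_neg_div_nonneg (hθ0 n) (hm0 ν)), integral_div,
          ← one_sub_laplace_eq R (hθ0 n).le]
        refine ENNReal.ofReal_le_ofReal ?_
        rw [div_le_iff₀ (hθ0 n), mul_comm]
        exact hM n

theorem integrable_mass_of_lintegral_le (R : Measure (FiniteMeasure E)) {M : ℝ}
    (h : ∫⁻ ν, (ν : Measure E) univ ∂(R) ≤ ENNReal.ofReal M) :
    Integrable (fun ν : FiniteMeasure E => (ν : Measure E).real univ) R := by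
  refine ⟨measurable_mass_real.aestronglyMeasurable, ?_⟩
  rw [hasFiniteIntegral_iff_ofReal (ae_of_all _ fun ν => measureReal_nonneg)]
  exact lt_of_eq_of_lt (lintegral_congr fun ν => ofReal_measureReal)
    (h.trans_lt ENNReal.ofReal_lt_top)

/-- The logarithm of the Laplace functional at small constants detects the first moment. -/
theorem tendsto_neg_log_laplace_div (R : Measure (FiniteMeasure E)) [IsProbabilityMeasure R]
    {M : ℝ} (hθ : Tendsto θ atTop (𝓝 0)) (hθ0 : ∀ n, 0 < θ n)
    (hM : ∀ n, -Real.log (laplace R (fun _ => θ n)) ≤ θ n * M) :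
    Tendsto (fun n => -Real.log (laplace R (fun _ => θ n)) / θ n) atTop
      (𝓝 (∫ ν, (ν : Measure E).real univ ∂(R))) := by
  have hL0 : ∀ n, 0 < laplace R (fun _ => θ n) := fun n =>
    laplace_pos R (isBddBorelNonneg_const (hθ0 n).le)
  have hlog1 : ∀ n, 1 - laplace R (fun _ => θ n) ≤ -Real.log (laplace R (fun _ => θ n)) :=
    fun n => by linarith [Real.log_le_sub_one_of_pos (hL0 n)]
  have hint := integrable_mass_of_lintegral_le R
    (lintegral_mass_le R hθ hθ0 fun n => (hlog1 n).trans (hM n))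
  have hm0 : ∀ ν : FiniteMeasure E, 0 ≤ (ν : Measure E).real univ := fun ν => measureReal_nonneg
  have h1 : Tendsto (fun n => (1 - laplace R (fun _ => θ n)) / θ n) atTop
      (𝓝 (∫ ν, (ν : Measure E).real univ ∂(R))) := by
    have : ∀ n, (1 - laplace R (fun _ => θ n)) / θ n = ∫ ν : FiniteMeasure E,
        (1 - Real.exp (-(θ n * (ν : Measure E).real univ))) / θ n ∂(R) := fun n => by
      rw [one_sub_laplace_eq R (hθ0 n).le, integral_div]
    simp_rw [this]
    refine tendsto_integral_of_dominated_convergence _ (fun n =>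
      (((Real.measurable_exp.comp (measurable_mass_real.const_mul _).neg).const_sub 1).div_const
        _).aestronglyMeasurable) hint (fun n => ae_of_all _ fun ν => ?_)
      (ae_of_all _ fun ν => tendsto_one_sub_exp_div hθ hθ0 (hm0 ν))
    rw [Real.norm_of_nonneg (one_sub_exp_neg_div_nonneg (hθ0 n) (hm0 ν)), div_le_iff₀ (hθ0 n)]
    linarith [exp_neg_sub_one_add_nonneg (θ n * (ν : Measure E).real univ)]
  have hL1 : Tendsto (fun n => laplace R (fun _ => θ n)) atTop (𝓝 1) := by
    have h2 := (hθ.mul h1).const_sub 1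
    rw [zero_mul, sub_zero] at h2
    refine h2.congr fun n => ?_
    rw [mul_div_cancel₀ _ (hθ0 n).ne', sub_sub_cancel]
  have h3 := h1.div hL1 one_ne_zero
  rw [div_one] at h3
  refine tendsto_of_tendsto_of_tendsto_of_le_of_le h1 h3
    (fun n => div_le_div_of_nonneg_right (hlog1 n) (hθ0 n).le) (fun n => ?_)
  simp only [Pi.div_apply]
  rw [div_right_comm]
  refine div_le_div_of_nonneg_right ?_ (hθ0 n).le
  have := Real.one_sub_inv_le_log_of_pos (hL0 n)
  rw [sub_div, div_self (hL0 n).ne', one_div]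
  linarith

end FirstMoments

namespace IsMeasurableSuperprocess

variable {E : Type u} [MeasurableSpace E] [MeasurableEq E] {P : ℝ≥0 → Kernel E E}
  {φ : BranchingMechanism E} {Q : ℝ≥0 → Kernel (FiniteMeasure E) (FiniteMeasure E)} {f g : E → ℝ}

omit [MeasurableEq E] in
theorem law_cumulant_eq (κ : EntranceLaw P) (t : ℝ≥0) (f : E → ℝ) : κ.cumulant φ Q t f
    = ∫ y, f y ∂(κ.law t) - ∫ s in (0 : ℝ)..t, lawIntegrand φ Q κ t f s := rfl

/-- The cumulant of an entrance law is the limit of `κ_r(V_{t-r} f)` as `r → 0`. -/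
theorem tendsto_law_cumulant (h : IsMeasurableSuperprocess P φ Q) (hf : IsBddBorelNonneg f)
    (κ : EntranceLaw P) {t : ℝ≥0} (ht : 0 < t) :
    Tendsto (fun r => ∫ y, cumulant Q (t - r) f y ∂(κ.law r)) (𝓝[>] 0)
      (𝓝 (κ.cumulant φ Q t f)) := by
  have hev : ∀ᶠ r in 𝓝[>] (0 : ℝ≥0), r ∈ Ioo 0 t := Ioo_mem_nhdsGT ht
  have hint := h.intervalIntegrable_lawIntegrand hf κ t
  have hcont := intervalIntegral.continuousOn_primitive_interval' hint left_mem_uIcc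
  have hsub : Tendsto (fun r : ℝ≥0 => (t : ℝ) - r) (𝓝[>] 0) (𝓝[uIcc 0 (t : ℝ)] (t : ℝ)) := by
    refine tendsto_nhdsWithin_iff.2 ⟨?_, ?_⟩
    · have : Tendsto (fun r : ℝ≥0 => (t : ℝ) - r) (𝓝 0) (𝓝 ((t : ℝ) - (0 : ℝ≥0))) :=
        (continuous_const.sub NNReal.continuous_coe).tendsto 0
      rw [NNReal.coe_zero, sub_zero] at this
      exact this.mono_left nhdsWithin_le_nhds
    · filter_upwards [hev] with r hr
      rw [uIcc_of_le t.coe_nonneg]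
      exact ⟨sub_nonneg.2 (NNReal.coe_le_coe.2 hr.2.le), sub_le_self _ r.coe_nonneg⟩
  have hlim := ((hcont _ right_mem_uIcc).tendsto.comp hsub).const_sub (∫ y, f y ∂(κ.law t))
  rw [law_cumulant_eq]
  refine hlim.congr' ?_
  filter_upwards [hev] with r hr
  have := h.integral_cumulant_law hf κ (u := t - r) hr.1
  rw [add_tsub_cancel_of_le hr.2.le] at this
  rw [this, Function.comp_apply, NNReal.coe_sub hr.2.le]

/-- Pointwise comparison of cumulants passes to entrance laws, by approximation along `κ_r`,
`r → 0`. -/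
theorem law_cumulant_le_of_forall (h : IsMeasurableSuperprocess P φ Q) (hf : IsBddBorelNonneg f)
    (hg : IsBddBorelNonneg g) (κ : EntranceLaw P) {t t' : ℝ≥0} (ht : 0 < t) (ht' : 0 < t') {a : ℝ}
    (hle : ∀ r, 0 < r → r < t → r < t' → ∀ x,
      cumulant Q (t - r) f x ≤ a * cumulant Q (t' - r) g x) :
    κ.cumulant φ Q t f ≤ a * κ.cumulant φ Q t' g := by
  refine le_of_tendsto_of_tendsto (h.tendsto_law_cumulant hf κ ht)
    ((h.tendsto_law_cumulant hg κ ht').const_mul a) ?_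
  filter_upwards [(Ioo_mem_nhdsGT ht : Ioo 0 t ∈ 𝓝[>] (0 : ℝ≥0)),
    (Ioo_mem_nhdsGT ht' : Ioo 0 t' ∈ 𝓝[>] (0 : ℝ≥0))] with r hr hr'
  have := κ.isFiniteMeasure h.motion r
  rw [← integral_const_mul]
  exact integral_mono ((h.isBddBorelNonneg_cumulant hf _).integrable _)
    (((h.isBddBorelNonneg_cumulant hg _).integrable _).const_mul a)
    (hle r hr.1 hr.2 hr'.2)

theorem law_cumulant_nonneg (h : IsMeasurableSuperprocess P φ Q) (hf : IsBddBorelNonneg f)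
    (κ : EntranceLaw P) {t : ℝ≥0} (ht : 0 < t) : 0 ≤ κ.cumulant φ Q t f :=
  ge_of_tendsto' (h.tendsto_law_cumulant hf κ ht) fun _ =>
    integral_nonneg (h.cumulant_nonneg hf _)

/-- If `V_T f ≤ C`, then `V_{t+T}(κ, f) ≤ V_t(κ, C)`. -/
theorem law_cumulant_add_le (h : IsMeasurableSuperprocess P φ Q) (hf : IsBddBorelNonneg f)
    (κ : EntranceLaw P) {t T : ℝ≥0} (ht : 0 < t) {C : ℝ} (hC0 : 0 ≤ C)
    (hC : ∀ x, cumulant Q T f x ≤ C) :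
    κ.cumulant φ Q (t + T) f ≤ κ.cumulant φ Q t (fun _ => C) := by
  rw [← one_mul (κ.cumulant φ Q t _)]
  refine h.law_cumulant_le_of_forall hf (isBddBorelNonneg_const hC0) κ
    (add_pos_of_pos_of_nonneg ht T.2) ht fun r _ _ hr x => ?_
  rw [one_mul, tsub_add_eq_add_tsub hr.le |>.symm, h.cumulant_add hf]
  exact h.cumulant_mono (h.isBddBorelNonneg_cumulant hf _) (isBddBorelNonneg_const hC0) hC _ x

/-- `V_t(κ, f) ≤ (a / θ) V_t(κ, θ)` for `f ≤ a` and `0 < θ ≤ a`. -/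
theorem law_cumulant_le_scale (h : IsMeasurableSuperprocess P φ Q) (hf : IsBddBorelNonneg f)
    (κ : EntranceLaw P) {t : ℝ≥0} (ht : 0 < t) {a θ : ℝ} (hθ : 0 < θ) (hθa : θ ≤ a)
    (hfa : ∀ x, f x ≤ a) :
    κ.cumulant φ Q t f ≤ a * (κ.cumulant φ Q t (fun _ => θ) / θ) := by
  have ha : 0 < a := hθ.trans_le hθa
  rw [← mul_div_assoc, mul_div_right_comm]
  refine h.law_cumulant_le_of_forall hf (isBddBorelNonneg_const hθ.le) κ ht ht
    fun r _ _ _ x => ?_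
  have h1 := h.cumulant_mono hf (isBddBorelNonneg_const ha.le) hfa (t - r) x
  have h2 := h.mul_cumulant_le (isBddBorelNonneg_const ha.le) (div_nonneg hθ.le ha.le)
    ((div_le_one ha).2 hθa) (t - r) x
  rw [div_mul_cancel₀ θ ha.ne', div_mul_eq_mul_div, div_le_iff₀ ha] at h2
  rw [div_mul_eq_mul_div, le_div_iff₀ hθ]
  nlinarith

variable {θ : ℕ → ℝ}

/-- `V_t θ / θ → π_t 1` as `θ → 0`. -/
theorem tendsto_cumulant_div (h : IsMeasurableSuperprocess P φ Q) (hθ : Tendsto θ atTop (𝓝 0))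
    (hθ0 : ∀ n, 0 < θ n) (t : ℝ≥0) (x : E) :
    Tendsto (fun n => cumulant Q t (fun _ => θ n) x / θ n) atTop
      (𝓝 (moment Q t (fun _ => 1) x)) := by
  have := h.isProbabilityMeasure t (diracFM x)
  have h1 := tendsto_neg_log_laplace_div (Q t (diracFM x)) hθ hθ0
    (M := Real.exp (-(φ.betaStar * t))) fun n =>
      h.cumulant_le_exp (isBddBorelNonneg_const (hθ0 n).le) (fun _ => le_rfl) t x
  simpa [moment, cumulant] using h1

/-- `V_t(κ, θ) / θ → π_t(κ, 1)` as `θ → 0`. -/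
theorem tendsto_law_cumulant_div (h : IsMeasurableSuperprocess P φ Q) (κ : EntranceLaw P)
    (hθ : Tendsto θ atTop (𝓝 0)) (hθ0 : ∀ n, 0 < θ n) (hθ1 : ∀ n, θ n ≤ 1) (t : ℝ≥0) :
    Tendsto (fun n => κ.cumulant φ Q t (fun _ => θ n) / θ n) atTop
      (𝓝 (κ.moment φ Q t (fun _ => 1))) := by
  obtain ⟨M, hM0, hM⟩ := φ.exists_abs_eval_le
  set L := Real.exp (|φ.betaStar| * t)
  have hL0 : 0 < L := Real.exp_pos _
  have hθB : ∀ n, IsBddBorelNonneg (fun _ : E => θ n) := fun n => isBddBorelNonneg_const (hθ0 n).le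
  have hVL : ∀ n, ∀ s : ℝ≥0, s ≤ t → ∀ y, cumulant Q s (fun _ => θ n) y ≤ θ n * L := by
    intro n s hs y
    refine (h.cumulant_le_exp (hθB n) (fun _ => le_rfl) s y).trans
      (mul_le_mul_of_nonneg_left (Real.exp_le_exp.2 ?_) (hθ0 n).le)
    rw [← neg_mul]
    exact mul_le_mul (neg_le_abs _) (NNReal.coe_le_coe.2 hs) s.coe_nonneg (abs_nonneg _)
  have hφ : ∀ n, ∀ s : ℝ≥0, s ≤ t → ∀ y,
      |φ.eval y (cumulant Q s (fun _ => θ n)) / θ n| ≤ M * (L + L ^ 2) := by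
    intro n s hs y
    rw [abs_div, abs_of_pos (hθ0 n), div_le_iff₀ (hθ0 n)]
    refine (hM _ _ (h.isBddBorelNonneg_cumulant (hθB n) s) (hVL n s hs) y).trans ?_
    rw [mul_assoc]
    refine mul_le_mul_of_nonneg_left ?_ hM0
    have := mul_le_mul_of_nonneg_left (hθ1 n) (mul_nonneg (hθ0 n).le (sq_nonneg L))
    nlinarith
  have hinner : ∀ s : ℝ, s ≤ t → Tendsto (fun n => lawIntegrand φ Q κ t (fun _ => θ n) s / θ n)
      atTop (𝓝 (∫ y, (φ.b y * moment Q s.toNNReal (fun _ => 1) y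
        - ∫ z, moment Q s.toNNReal (fun _ => 1) z ∂(φ.γ y)) ∂(κ.law ((t : ℝ) - s).toNNReal))) := by
    intro s hs
    have hs' : s.toNNReal ≤ t := Real.toNNReal_le_iff_le_coe.2 hs
    have := κ.isFiniteMeasure h.motion ((t : ℝ) - s).toNNReal
    simp only [lawIntegrand, ← integral_div]
    refine tendsto_integral_of_dominated_convergence (fun _ => M * (L + L ^ 2)) (fun n =>
      (((h.measurable_eval_cumulant (hθB n)).comp measurable_prodMk_left).div_const
        _).aestronglyMeasurable) (integrable_const _) (fun n => ae_of_all _ fun y => hφ n _ hs' y)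
      (ae_of_all _ fun y => ?_)
    exact φ.tendsto_eval_div y hθ hθ0 hθ1 (fun n => h.isBddBorelNonneg_cumulant (hθB n) _)
      (fun n => hVL n _ hs') fun y => h.tendsto_cumulant_div hθ hθ0 _ y
  have houter : Tendsto (fun n => ∫ s in (0 : ℝ)..t, lawIntegrand φ Q κ t (fun _ => θ n) s / θ n)
      atTop (𝓝 (∫ s in (0 : ℝ)..t, ∫ y, (φ.b y * moment Q s.toNNReal (fun _ => 1) y
        - ∫ z, moment Q s.toNNReal (fun _ => 1) z ∂(φ.γ y)) ∂(κ.law ((t : ℝ) - s).toNNReal))) := by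
    refine intervalIntegral.tendsto_integral_filter_of_dominated_convergence
      (fun s => M * (L + L ^ 2) * (κ.law ((t : ℝ) - s).toNNReal).real univ)
      (Eventually.of_forall fun n =>
        ((h.measurable_lawIntegrand_right (hθB n) κ t).div_const _).aestronglyMeasurable)
      (Eventually.of_forall fun n => ae_of_all _ fun s hs => ?_)
      ((h.intervalIntegrable_law_real κ t).const_mul _) (ae_of_all _ fun s hs => ?_)
    · rw [uIoc_of_le t.coe_nonneg] at hs
      have := κ.isFiniteMeasure h.motion ((t : ℝ) - s).toNNReal
      simp only [lawIntegrand, ← integral_div]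
      exact norm_integral_le_of_norm_le_const (ae_of_all _ fun y =>
        hφ n _ (Real.toNNReal_le_iff_le_coe.2 hs.2) y)
    · rw [uIoc_of_le t.coe_nonneg] at hs
      exact hinner s hs.2
  have hall := houter.const_sub ((κ.law t).real univ)
  have hmom : κ.moment φ Q t (fun _ => 1) = (κ.law t).real univ
      - ∫ s in (0 : ℝ)..t, ∫ y, (φ.b y * moment Q s.toNNReal (fun _ => 1) y
        - ∫ z, moment Q s.toNNReal (fun _ => 1) z ∂(φ.γ y)) ∂(κ.law ((t : ℝ) - s).toNNReal) := by
    rw [EntranceLaw.moment, sub_eq_add_neg, ← intervalIntegral.integral_neg]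
    congr 1
    · simp
    · simp_rw [← integral_neg, neg_sub]
  rw [hmom]
  refine hall.congr fun n => ?_
  rw [law_cumulant_eq, sub_div, intervalIntegral.integral_div, integral_const, smul_eq_mul,
    mul_div_assoc, div_self (hθ0 n).ne', mul_one]

/-- `V_t(κ, f) ≤ ‖f‖ π_t(κ, 1)`. -/
theorem law_cumulant_le_moment (h : IsMeasurableSuperprocess P φ Q) (hf : IsBddBorelNonneg f)
    (κ : EntranceLaw P) {t : ℝ≥0} (ht : 0 < t) {a : ℝ} (ha : 0 < a) (hfa : ∀ x, f x ≤ a) :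
    κ.cumulant φ Q t f ≤ a * κ.moment φ Q t (fun _ => 1) := by
  have hθ : Tendsto (fun n : ℕ => 1 / ((n : ℝ) + 1)) atTop (𝓝 0) :=
    tendsto_one_div_add_atTop_nhds_zero_nat
  have hlim := (h.tendsto_law_cumulant_div κ hθ (fun n => by positivity)
    (fun n => by rw [div_le_one (by positivity)]; linarith [n.cast_nonneg (α := ℝ)]) t).const_mul a
  refine ge_of_tendsto hlim ?_
  filter_upwards [hθ.eventually (Iic_mem_nhds ha)] with n hn
  exact h.law_cumulant_le_scale hf κ ht (by positivity) hn hfa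

end IsMeasurableSuperprocess

end

section

/-! ### Integrability of the immigration exponent -/

variable {E : Type u} [MeasurableSpace E] {P : ℝ≥0 → Kernel E E}
  {φ : BranchingMechanism E} {Q : ℝ≥0 → Kernel (FiniteMeasure E) (FiniteMeasure E)} {f : E → ℝ}
  {κ : EntranceLaw P} {F : Measure (EntranceLaw P)}

/-- The rate `π_s(κ, 1) + ∫ π_s(ν, 1) F(dν)` at which mass immigrated `s` units of time ago is
present. -/
def immigrationRate (φ : BranchingMechanism E)
    (Q : ℝ≥0 → Kernel (FiniteMeasure E) (FiniteMeasure E)) (κ : EntranceLaw P)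
    (F : Measure (EntranceLaw P)) (s : ℝ) : ℝ≥0∞ :=
  ENNReal.ofReal (κ.moment φ Q s.toNNReal (fun _ => 1))
    + ∫⁻ ν : EntranceLaw P, ENNReal.ofReal (ν.moment φ Q s.toNNReal (fun _ => 1)) ∂F

/-- The measure on `(0, ∞)` with density `immigrationRate`. No measurability of the density is
needed: only its lower integrals over measurable sets enter. -/
def immigrationMeasure (φ : BranchingMechanism E)
    (Q : ℝ≥0 → Kernel (FiniteMeasure E) (FiniteMeasure E)) (κ : EntranceLaw P)
    (F : Measure (EntranceLaw P)) : Measure ℝ :=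
  (volume.restrict (Ioi 0)).withDensity (immigrationRate φ Q κ F)

theorem lintegral_immigrationRate {A : Set ℝ} (hA : MeasurableSet A) (hA0 : A ⊆ Ioi 0) :
    ∫⁻ s in A, immigrationRate φ Q κ F s = immigrationMeasure φ Q κ F A := by
  rw [immigrationMeasure, withDensity_apply _ hA, Measure.restrict_restrict hA,
    inter_eq_left.2 hA0]

/-- No integrability of `J` is assumed: where it fails, the integral is `0`. -/
theorem integral_le_immigrationMeasure [IsFiniteMeasure (immigrationMeasure φ Q κ F)] {J : ℝ → ℝ}
    {a b c : ℝ} (ha : 0 ≤ a) (hab : a ≤ b) (hc : 0 ≤ c)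
    (hJ : ∀ s, a < s → ‖J s‖ₑ ≤ ENNReal.ofReal c * immigrationRate φ Q κ F s) :
    ∫ s in a..b, J s ≤ c * (immigrationMeasure φ Q κ F).real (Ioc a b) := by
  rw [intervalIntegral.integral_of_le hab]
  have h1 : ‖∫ s in Ioc a b, J s‖ₑ
      ≤ ENNReal.ofReal (c * (immigrationMeasure φ Q κ F).real (Ioc a b)) := by
    calc ‖∫ s in Ioc a b, J s‖ₑ ≤ ∫⁻ s in Ioc a b, ‖J s‖ₑ := enorm_integral_le_lintegral_enorm _
      _ ≤ ∫⁻ s in Ioc a b, ENNReal.ofReal c * immigrationRate φ Q κ F s :=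
          setLIntegral_mono' measurableSet_Ioc fun s hs => hJ s hs.1
      _ = ENNReal.ofReal c * ∫⁻ s in Ioc a b, immigrationRate φ Q κ F s :=
          lintegral_const_mul' _ _ ENNReal.ofReal_ne_top
      _ = _ := by
          rw [lintegral_immigrationRate measurableSet_Ioc
            (Ioc_subset_Ioi_self.trans (Ioi_subset_Ioi ha)), ENNReal.ofReal_mul hc,
            ofReal_measureReal]
  rw [Real.enorm_eq_ofReal_abs] at h1
  exact (le_abs_self _).trans
    ((ENNReal.ofReal_le_ofReal_iff (mul_nonneg hc measureReal_nonneg)).1 h1)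

namespace IsMeasurableSuperprocess

variable [MeasurableEq E]

/-- `(ν, t) ↦ V_t(ν, f)` is measurable. -/
theorem measurable_law_cumulant (h : IsMeasurableSuperprocess P φ Q) (hf : IsBddBorelNonneg f) :
    Measurable (fun p : EntranceLaw P × ℝ≥0 => p.1.cumulant φ Q p.2 f) := by
  have := h.isSFiniteKernel_law
  have h1 : Measurable (fun p : EntranceLaw P × ℝ≥0 => ∫ y, f y ∂(p.1.law p.2)) :=
    measurable_integral_kernel_comp (⟨fun p : ℝ≥0 × EntranceLaw P => p.2.law p.1,
      h.measurable_law⟩ : Kernel (ℝ≥0 × EntranceLaw P) E) measurable_swap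
      (f := fun _ y => f y) (hf.measurable.comp measurable_snd)
  have hS : MeasurableSet {q : (EntranceLaw P × ℝ≥0) × ℝ | 0 < q.2 ∧ q.2 ≤ q.1.2} :=
    (measurableSet_lt measurable_const measurable_snd).inter
      (measurableSet_le measurable_snd (measurable_coe_nnreal_real.comp
        (measurable_snd.comp measurable_fst)))
  have h2 : Measurable (fun p : EntranceLaw P × ℝ≥0 =>
      ∫ s, ({q : (EntranceLaw P × ℝ≥0) × ℝ | 0 < q.2 ∧ q.2 ≤ q.1.2}).indicator
        (fun q => lawIntegrand φ Q q.1.1 q.1.2 f q.2) (p, s)) :=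
    (((h.measurable_lawIntegrand hf).indicator
      hS).stronglyMeasurable.integral_prod_right').measurable
  convert h1.sub h2 using 1
  ext p
  rw [law_cumulant_eq, Pi.sub_apply, intervalIntegral.integral_of_le p.2.coe_nonneg,
    ← integral_indicator measurableSet_Ioc]
  rfl

theorem measurable_immigrationExponent [SFinite F] (h : IsMeasurableSuperprocess P φ Q)
    (hf : IsBddBorelNonneg f) :
    Measurable (fun s : ℝ => immigrationExponent φ Q κ F s.toNNReal f) := by
  have hm := h.measurable_law_cumulant hf
  have h1 : Measurable (fun s : ℝ => κ.cumulant φ Q s.toNNReal f) :=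
    hm.comp (measurable_const.prodMk measurable_real_toNNReal)
  have h2 : Measurable (fun p : ℝ × EntranceLaw P =>
      1 - Real.exp (-(p.2.cumulant φ Q p.1.toNNReal f))) :=
    (Real.measurable_exp.comp (hm.comp (measurable_snd.prodMk
      (measurable_real_toNNReal.comp measurable_fst))).neg).const_sub 1
  exact h1.add (h2.stronglyMeasurable.integral_prod_right').measurable

omit [MeasurableEq E] in
theorem enorm_immigrationExponent_le {t t' : ℝ≥0} {a : ℝ}
    (h0 : ∀ ν : EntranceLaw P, 0 ≤ ν.cumulant φ Q t f) (ha : 0 ≤ a)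
    (hle : ∀ ν : EntranceLaw P, ν.cumulant φ Q t f ≤ a * ν.moment φ Q t' (fun _ => 1)) :
    ‖immigrationExponent φ Q κ F t f‖ₑ
      ≤ ENNReal.ofReal a * immigrationRate φ Q κ F (t' : ℝ) := by
  rw [immigrationRate, Real.toNNReal_coe, mul_add]
  refine (enorm_add_le _ _).trans (add_le_add ?_ ?_)
  · rw [Real.enorm_of_nonneg (h0 κ), ← ENNReal.ofReal_mul ha]
    exact ENNReal.ofReal_le_ofReal (hle κ)
  · refine (enorm_integral_le_lintegral_enorm _).trans ?_
    rw [← lintegral_const_mul' _ _ ENNReal.ofReal_ne_top]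
    refine lintegral_mono fun ν => ?_
    rw [← ENNReal.ofReal_mul ha, Real.enorm_of_nonneg (sub_nonneg.2 (Real.exp_le_one_iff.2
      (neg_nonpos.2 (h0 ν))))]
    refine ENNReal.ofReal_le_ofReal (le_trans ?_ (hle ν))
    linarith [Real.add_one_le_exp (-(ν.cumulant φ Q t f))]

/-- `I_s(κ, F, f) ≤ ‖f‖ (π_s(κ, 1) + ∫ π_s(ν, 1) F(dν))`. -/
theorem enorm_immigrationExponent_le_rate (h : IsMeasurableSuperprocess P φ Q)
    (hf : IsBddBorelNonneg f) {a : ℝ} (ha : 0 < a) (hfa : ∀ x, f x ≤ a) {s : ℝ} (hs : 0 < s) :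
    ‖immigrationExponent φ Q κ F s.toNNReal f‖ₑ
      ≤ ENNReal.ofReal a * immigrationRate φ Q κ F s := by
  have hs' : 0 < s.toNNReal := Real.toNNReal_pos.2 hs
  have := enorm_immigrationExponent_le (κ := κ) (F := F) (t' := s.toNNReal)
    (fun ν => h.law_cumulant_nonneg hf ν hs') ha.le
    fun ν => h.law_cumulant_le_moment hf ν hs' ha hfa
  rwa [Real.coe_toNNReal s hs.le] at this

/-- If `V_T f ≤ C`, then `I_{s+T}(κ, F, f)` is bounded by `C` times the rate at `s`. -/
theorem enorm_immigrationExponent_add_le_rate (h : IsMeasurableSuperprocess P φ Q)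
    (hf : IsBddBorelNonneg f) {T : ℝ≥0} {C : ℝ} (hC : 0 < C) (hfC : ∀ x, cumulant Q T f x ≤ C)
    {s : ℝ} (hs : 0 < s) :
    ‖immigrationExponent φ Q κ F (s + T).toNNReal f‖ₑ
      ≤ ENNReal.ofReal C * immigrationRate φ Q κ F s := by
  have hs' : 0 < s.toNNReal := Real.toNNReal_pos.2 hs
  have hT : (s + T).toNNReal = s.toNNReal + T := by
    rw [Real.toNNReal_add hs.le T.coe_nonneg, Real.toNNReal_coe]
  have := enorm_immigrationExponent_le (κ := κ) (F := F) (t := s.toNNReal + T) (t' := s.toNNReal)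
    (fun ν => h.law_cumulant_nonneg hf ν (add_pos_of_pos_of_nonneg hs' T.2)) hC.le
    fun ν => (h.law_cumulant_add_le hf ν hs' hC.le hfC).trans
      (h.law_cumulant_le_moment (isBddBorelNonneg_const hC.le) ν hs' hC fun _ => le_rfl)
  rwa [Real.coe_toNNReal s hs.le, ← hT] at this

theorem integrableOn_immigrationExponent [SFinite F]
    [IsFiniteMeasure (immigrationMeasure φ Q κ F)] (h : IsMeasurableSuperprocess P φ Q)
    (hf : IsBddBorelNonneg f) :
    IntegrableOn (fun s : ℝ => immigrationExponent φ Q κ F s.toNNReal f) (Ioi 0) := by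
  obtain ⟨a, ha⟩ := hf.bounded
  have ha1 : ∀ x, f x ≤ |a| + 1 := fun x => by linarith [ha x, le_abs_self a]
  refine ⟨(h.measurable_immigrationExponent hf).aestronglyMeasurable, ?_⟩
  calc ∫⁻ s in Ioi (0 : ℝ), ‖immigrationExponent φ Q κ F s.toNNReal f‖ₑ
      ≤ ∫⁻ s in Ioi (0 : ℝ), ENNReal.ofReal (|a| + 1) * immigrationRate φ Q κ F s :=
        setLIntegral_mono' measurableSet_Ioi fun s hs =>
          h.enorm_immigrationExponent_le_rate hf (by positivity) ha1 hs
    _ = ENNReal.ofReal (|a| + 1) * immigrationMeasure φ Q κ F (Ioi 0) := by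
        rw [lintegral_const_mul' _ _ ENNReal.ofReal_ne_top,
          lintegral_immigrationRate measurableSet_Ioi Subset.rfl]
    _ < ⊤ := ENNReal.mul_lt_top ENNReal.ofReal_lt_top (measure_lt_top _ _)

omit [MeasurableEq E] in
theorem laplace_bind (h : IsMeasurableSuperprocess P φ Q) (R : Measure (FiniteMeasure E))
    [IsFiniteMeasure R] (hf : IsBddBorelNonneg f) (t : ℝ≥0) :
    laplace (R.bind (Q t)) f = laplace R (cumulant Q t f) := by
  have := h.superprocess.conservative t
  have hm : Measurable (fun ν : FiniteMeasure E => Real.exp (-∫ x, f x ∂(ν : Measure E))) :=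
    Real.measurable_exp.comp (measurable_finiteMeasure_integral hf.measurable).neg
  unfold laplace
  rw [integral_bind_kernel (C := 1) R (Q t) hm fun ν => ?_]
  · exact integral_congr_ae (ae_of_all _ fun ν => h.superprocess.branching t ν f hf)
  · rw [abs_of_pos (Real.exp_pos _), Real.exp_le_one_iff, neg_nonpos]
    exact integral_nonneg hf.nonneg

end IsMeasurableSuperprocess

end

section

/-! ### Total variation estimates -/

theorem tendsto_measureReal_Ioi_atTop (ρ : Measure ℝ) [IsFiniteMeasure ρ] :
    Tendsto (fun a : ℝ => ρ.real (Ioi a)) atTop (𝓝 0) := by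
  have h1 : ⋂ a : ℝ, Ioi a = ∅ :=
    eq_empty_of_forall_notMem fun x hx => lt_irrefl x (mem_iInter.1 hx x)
  have h2 := tendsto_measure_iInter_atTop (μ := ρ) (s := fun a : ℝ => Ioi a)
    (fun a => measurableSet_Ioi.nullMeasurableSet) antitone_Ioi ⟨0, measure_ne_top _ _⟩
  rw [h1, measure_empty] at h2
  exact (ENNReal.tendsto_toReal ENNReal.zero_ne_top).comp h2

theorem measureReal_Ioi_sub (ρ : Measure ℝ) [IsFiniteMeasure ρ] {a b : ℝ} (hab : a ≤ b) :
    ρ.real (Ioc a b) = ρ.real (Ioi a) - ρ.real (Ioi b) := by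
  rw [← Ioi_sdiff_Ioi, measureReal_sdiff (Ioi_subset_Ioi hab) measurableSet_Ioi]

section FiniteMeasures

variable {E : Type u} [MeasurableSpace E]

theorem measureReal_zero_mul_le_conv (R N : Measure (FiniteMeasure E)) [IsFiniteMeasure R]
    [IsFiniteMeasure N] {a : ℝ} (ha : a ≤ R.real {0}) {A : Set (FiniteMeasure E)}
    (hA : MeasurableSet A) : a * N.real A ≤ (R.conv N).real A := by
  refine (mul_le_mul_of_nonneg_right ha measureReal_nonneg).trans ?_
  rw [Measure.real, Measure.real, ← ENNReal.toReal_mul]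
  exact ENNReal.toReal_mono (measure_ne_top _ _) (measure_zero_mul_le_conv R N hA)

/-- Convolving with a law which is the zero measure up to probability `δ` moves a probability
measure by at most `δ`. -/
theorem abs_measureReal_conv_sub_le (R N : Measure (FiniteMeasure E)) [IsProbabilityMeasure R]
    [IsProbabilityMeasure N] {δ : ℝ} (hδ : 0 ≤ δ) (h : 1 - δ ≤ R.real {0})
    (A : Set (FiniteMeasure E)) (hA : MeasurableSet A) :
    |(R.conv N).real A - N.real A| ≤ δ := by
  rw [abs_sub_comm]
  exact abs_measureReal_sub_le_of_minorant hδ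
    (fun B hB => measureReal_zero_mul_le_conv R N h hB) A hA

end FiniteMeasures

namespace IsSkewConvolutionSemigroup

variable {E : Type u} [MeasurableSpace E]
  {Q : ℝ≥0 → Kernel (FiniteMeasure E) (FiniteMeasure E)} [∀ t, IsMarkovKernel (Q t)]
  {N : ℝ≥0 → ProbabilityMeasure (FiniteMeasure E)} {f : E → ℝ}

/-- The law `N_r Q_t`, i.e. what is left at time `t` of the mass immigrated before, has Laplace
functional `exp (-∫_t^{t+r} I_s(f) ds)`. -/
theorem laplace_bind_eq (hN : IsSkewConvolutionSemigroup Q N) {I : ℝ → ℝ}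
    (hI : IntegrableOn I (Ioi 0)) (hf : IsBddBorelNonneg f)
    (hL : ∀ t, laplace (N t : Measure (FiniteMeasure E)) f = Real.exp (-∫ s in (0 : ℝ)..t, I s))
    (r t : ℝ≥0) :
    laplace ((N r : Measure (FiniteMeasure E)).bind (Q t)) f
      = Real.exp (-∫ s in (t : ℝ)..(t + r), I s) := by
  have h1 := laplace_conv ((N r : Measure (FiniteMeasure E)).bind (Q t)) (N t) hf
  have hint : ∀ a b : ℝ, 0 ≤ a → a ≤ b → IntervalIntegrable I volume a b := fun a b ha hab =>
    (intervalIntegrable_iff_integrableOn_Ioc_of_le hab).2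
      (hI.mono_set (Ioc_subset_Ioi_self.trans (Ioi_subset_Ioi ha)))
  have h2 := intervalIntegral.integral_add_adjacent_intervals
    (hint 0 t le_rfl t.coe_nonneg) (hint t (t + r) t.coe_nonneg
      (le_add_of_nonneg_right r.coe_nonneg))
  rw [← hN r t, hL, hL, NNReal.coe_add, add_comm (r : ℝ), ← h2, neg_add, add_comm,
    Real.exp_add] at h1
  exact (mul_right_cancel₀ (Real.exp_pos _).ne' h1).symm

/-- If the mass immigrated before is extinct at time `t` up to probability `δ`, then `N_t` is
within `δ` of the limit. -/
theorem abs_measureReal_sub_limit_le (hN : IsSkewConvolutionSemigroup Q N)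
    {Ninf : ProbabilityMeasure (FiniteMeasure E)}
    (hlim : ∀ A, MeasurableSet A → Tendsto (fun n : ℕ => (N n : Measure (FiniteMeasure E)).real A)
      atTop (𝓝 ((Ninf : Measure (FiniteMeasure E)).real A)))
    {t : ℝ≥0} {δ : ℝ} (hδ : 0 ≤ δ)
    (h : ∀ r, 1 - δ ≤ ((N r : Measure (FiniteMeasure E)).bind (Q t)).real {0})
    (A : Set (FiniteMeasure E)) (hA : MeasurableSet A) :
    |(N t : Measure (FiniteMeasure E)).real A - (Ninf : Measure (FiniteMeasure E)).real A|
      ≤ δ := by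
  refine abs_measureReal_sub_le_of_minorant hδ (fun B hB => ?_) A hA
  obtain ⟨k, hk⟩ := exists_nat_ge t
  refine ge_of_tendsto (hlim B hB) ?_
  filter_upwards [eventually_ge_atTop k] with n hn
  have hn' : t ≤ (n : ℝ≥0) := hk.trans (Nat.cast_le.2 hn)
  have h1 := measureReal_zero_mul_le_conv ((N (n - t) : Measure (FiniteMeasure E)).bind (Q t))
    (N t) (h (n - t)) hB
  rwa [← hN, tsub_add_cancel_of_le hn'] at h1

end IsSkewConvolutionSemigroup

theorem tendsto_measureReal_of_tendsto_lintegral {S : Type u} [MeasurableSpace S]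
    {N : ℕ → ProbabilityMeasure S} {μ : ProbabilityMeasure S}
    (h : ∀ f : S → ℝ≥0∞, Tendsto (fun n => ∫⁻ x, f x ∂(N n : Measure S)) atTop
      (𝓝 (∫⁻ x, f x ∂(μ : Measure S)))) (A : Set S) (hA : MeasurableSet A) :
    Tendsto (fun n => (N n : Measure S).real A) atTop (𝓝 ((μ : Measure S).real A)) := by
  have h1 := h (A.indicator 1)
  simp only [lintegral_indicator_one hA] at h1
  exact (ENNReal.tendsto_toReal (measure_ne_top _ _)).comp h1

theorem tendsto_laplace_of_tendsto_lintegral {E : Type u} [MeasurableSpace E]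
    {N : ℕ → ProbabilityMeasure (FiniteMeasure E)} {μ : ProbabilityMeasure (FiniteMeasure E)}
    (h : ∀ f : FiniteMeasure E → ℝ≥0∞,
      Tendsto (fun n => ∫⁻ x, f x ∂(N n : Measure (FiniteMeasure E))) atTop
        (𝓝 (∫⁻ x, f x ∂(μ : Measure (FiniteMeasure E))))) {f : E → ℝ} (hf : IsBddBorelNonneg f) :
    Tendsto (fun n => laplace (N n : Measure (FiniteMeasure E)) f) atTop
      (𝓝 (laplace (μ : Measure (FiniteMeasure E)) f)) := by
  have key : ∀ R : ProbabilityMeasure (FiniteMeasure E),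
      laplace (R : Measure (FiniteMeasure E)) f
        = (∫⁻ ν, ENNReal.ofReal (Real.exp (-∫ x, f x ∂(ν : Measure E)))
            ∂(R : Measure (FiniteMeasure E))).toReal := fun R =>
    integral_eq_lintegral_of_nonneg_ae (ae_of_all _ fun _ => (Real.exp_pos _).le)
      (integrable_exp_neg (R : Measure (FiniteMeasure E)) hf).aestronglyMeasurable
  simp only [key]
  refine (ENNReal.tendsto_toReal ?_).comp (h _)
  rw [← ofReal_integral_eq_lintegral_ofReal (integrable_exp_neg _ hf)
    (ae_of_all _ fun _ => (Real.exp_pos _).le)]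
  exact ENNReal.ofReal_ne_top

end

section

/-! ### Convergence to the stationary law -/

namespace IsMeasurableSuperprocess

variable {E : Type u} [MeasurableSpace E] {P : ℝ≥0 → Kernel E E}
  {φ : BranchingMechanism E} {Q : ℝ≥0 → Kernel (FiniteMeasure E) (FiniteMeasure E)}
  [∀ t, IsMarkovKernel (Q t)] {f : E → ℝ}
  {κ : EntranceLaw P} {F : Measure (EntranceLaw P)}
  {N : ℝ≥0 → ProbabilityMeasure (FiniteMeasure E)}
  {T : ℝ≥0} {C : ℝ}

/-- A superprocess started from `μ` is extinct at time `t` up to probability `sup_n μ(V_t n)`. -/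
theorem one_sub_le_measureReal_zero (h : IsMeasurableSuperprocess P φ Q) {t : ℝ≥0}
    {μ : FiniteMeasure E} {δ : ℝ}
    (hδ : ∀ n : ℕ, ∫ x, cumulant Q t (fun _ => (n : ℝ)) x ∂(μ : Measure E) ≤ δ) :
    1 - δ ≤ (Q t μ).real {0} := by
  refine le_measureReal_zero_of_le_laplace _ fun n => ?_
  rw [h.superprocess.branching t μ _ (isBddBorelNonneg_const n.cast_nonneg)]
  linarith [hδ n,
    Real.one_sub_le_exp_neg (∫ x, cumulant Q t (fun _ => (n : ℝ)) x ∂(μ : Measure E))]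

omit [∀ t, IsMarkovKernel (Q t)] in
theorem cumulant_le_of_le (h : IsMeasurableSuperprocess P φ Q)
    (hC : ∀ f, IsBddBorelNonneg f → ∀ x, cumulant Q T f x ≤ C) {t : ℝ≥0} (hT : T ≤ t)
    (hf : IsBddBorelNonneg f) (x : E) : cumulant Q t f x ≤ C := by
  rw [← add_tsub_cancel_of_le hT, h.cumulant_add hf]
  exact hC _ (h.isBddBorelNonneg_cumulant hf _) x

omit [∀ t, IsMarkovKernel (Q t)] in
theorem cumulant_le_exp_of_le [MeasurableEq E] (h : IsMeasurableSuperprocess P φ Q)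
    (hC : ∀ f, IsBddBorelNonneg f → ∀ x, cumulant Q T f x ≤ C) {t : ℝ≥0} (hT : T ≤ t)
    (hf : IsBddBorelNonneg f) (x : E) :
    cumulant Q t f x ≤ C * Real.exp (-(φ.betaStar * (t - T))) := by
  rw [← tsub_add_cancel_of_le hT, h.cumulant_add hf, NNReal.coe_add, add_sub_cancel_right]
  exact h.cumulant_le_exp (h.isBddBorelNonneg_cumulant hf _) (hC f hf) _ x

/-- If `V̄_t → 0` pointwise, then the superprocess started from any finite measure becomes extinct
with probability tending to one. -/
theorem exists_tendsto_one_sub_le (h : IsMeasurableSuperprocess P φ Q)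
    (hC : ∀ f, IsBddBorelNonneg f → ∀ x, cumulant Q T f x ≤ C)
    (hV : ∀ x : E, Tendsto (fun t : ℝ≥0 => cumulantBar Q t x) atTop (𝓝 0)) (μ : FiniteMeasure E) :
    ∃ δ : ℝ≥0 → ℝ, Tendsto δ atTop (𝓝 0) ∧
      ∀ t, T ≤ t → 0 ≤ δ t ∧ 1 - δ t ≤ (Q t μ).real {0} := by
  let g : ℝ≥0 → E → ℝ≥0∞ := fun t x => ⨆ n : ℕ, ENNReal.ofReal (cumulant Q t (fun _ => (n : ℝ)) x)
  have hn : ∀ n : ℕ, IsBddBorelNonneg (fun _ : E => (n : ℝ)) := fun n =>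
    isBddBorelNonneg_const n.cast_nonneg
  have hgC : ∀ t, T ≤ t → ∀ x, g t x ≤ ENNReal.ofReal C := fun t ht x =>
    iSup_le fun n => ENNReal.ofReal_le_ofReal (h.cumulant_le_of_le hC ht (hn n) x)
  have hgm : ∀ t, Measurable (g t) := fun t =>
    Measurable.iSup fun n => (h.isBddBorelNonneg_cumulant (hn n) t).measurable.ennreal_ofReal
  have hg0 : ∀ x, Tendsto (fun t => g t x) atTop (𝓝 0) := fun x =>
    tendsto_of_tendsto_of_tendsto_of_le_of_le tendsto_const_nhds (hV x) (fun _ => zero_le)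
      fun t => iSup_le fun n => le_iSup (fun l : ℝ≥0 =>
        ENNReal.ofReal (cumulant Q t (fun _ => (l : ℝ)) x)) (n : ℝ≥0)
  have hfin : ∫⁻ _, ENNReal.ofReal C ∂(μ : Measure E) ≠ ⊤ := by
    rw [lintegral_const]
    exact ENNReal.mul_ne_top ENNReal.ofReal_ne_top (measure_ne_top _ _)
  have hlim := tendsto_lintegral_filter_of_dominated_convergence (μ := (μ : Measure E))
    (l := (atTop : Filter ℝ≥0)) (F := g) (f := fun _ => 0) (fun _ => ENNReal.ofReal C)
    (Eventually.of_forall hgm)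
    ((eventually_ge_atTop T).mono fun t ht => ae_of_all _ (hgC t ht)) hfin (ae_of_all _ hg0)
  rw [lintegral_zero] at hlim
  refine ⟨fun t => (∫⁻ x, g t x ∂(μ : Measure E)).toReal,
    (ENNReal.tendsto_toReal ENNReal.zero_ne_top).comp hlim, fun t ht =>
      ⟨ENNReal.toReal_nonneg, h.one_sub_le_measureReal_zero fun n => ?_⟩⟩
  rw [integral_eq_lintegral_of_nonneg_ae (ae_of_all _ fun x => h.cumulant_nonneg (hn n) t x)
    (h.isBddBorelNonneg_cumulant (hn n) t).measurable.aestronglyMeasurable]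
  refine ENNReal.toReal_mono ((lintegral_mono (hgC t ht)).trans_lt hfin.lt_top).ne
    (lintegral_mono fun x => ?_)
  exact le_iSup (fun n : ℕ => ENNReal.ofReal (cumulant Q t (fun _ => (n : ℝ)) x)) n

section Immigration

variable [MeasurableEq E] [SFinite F] [IsFiniteMeasure (immigrationMeasure φ Q κ F)]

/-- The mass immigrated before is extinct at time `t` with a probability controlled by the
immigration in the time window `(t - T, t + r - T]`. -/
theorem exp_neg_le_measureReal_zero (h : IsMeasurableSuperprocess P φ Q)
    (hN : IsSkewConvolutionSemigroup Q N)
    (hL : ∀ (t : ℝ≥0) (f : E → ℝ), IsBddBorelNonneg f →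
      laplace (N t : Measure (FiniteMeasure E)) f
        = Real.exp (-∫ s in (0 : ℝ)..t, immigrationExponent φ Q κ F s.toNNReal f))
    (hC0 : 0 < C) (hC : ∀ f, IsBddBorelNonneg f → ∀ x, cumulant Q T f x ≤ C)
    {t : ℝ≥0} (hT : T ≤ t) (r : ℝ≥0) :
    Real.exp (-(C * (immigrationMeasure φ Q κ F).real (Ioc ((t : ℝ) - T) (t + r - T))))
      ≤ ((N r : Measure (FiniteMeasure E)).bind (Q t)).real {0} := by
  refine le_measureReal_zero_of_le_laplace _ fun n => ?_
  have hn : IsBddBorelNonneg (fun _ : E => (n : ℝ)) := isBddBorelNonneg_const n.cast_nonneg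
  rw [hN.laplace_bind_eq (h.integrableOn_immigrationExponent hn) hn (fun t => hL t _ hn) r t,
    Real.exp_le_exp, neg_le_neg_iff]
  have h1 := intervalIntegral.integral_comp_add_right (a := (t : ℝ) - T) (b := t + r - T)
    (fun s : ℝ => immigrationExponent φ Q κ F s.toNNReal (fun _ => (n : ℝ))) (T : ℝ)
  rw [sub_add_cancel, sub_add_cancel] at h1
  have hT' : (0 : ℝ) ≤ (t : ℝ) - T := sub_nonneg.2 (NNReal.coe_le_coe.2 hT)
  rw [← h1]
  exact integral_le_immigrationMeasure hT' (by linarith [r.coe_nonneg]) hC0.le fun s hs =>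
    h.enorm_immigrationExponent_add_le_rate hn hC0 (hC _ hn) (hT'.trans_lt hs)

omit [∀ t, IsMarkovKernel (Q t)] [SFinite F] in
/-- `L_{N_t}(a) ≥ 1 - a M`, where `M` is the total mass of the immigration measure. -/
theorem one_sub_le_laplace (h : IsMeasurableSuperprocess P φ Q)
    (hL : ∀ (t : ℝ≥0) (f : E → ℝ), IsBddBorelNonneg f →
      laplace (N t : Measure (FiniteMeasure E)) f
        = Real.exp (-∫ s in (0 : ℝ)..t, immigrationExponent φ Q κ F s.toNNReal f))
    {a : ℝ} (ha : 0 < a) (t : ℝ≥0) :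
    1 - a * (immigrationMeasure φ Q κ F).real univ
      ≤ laplace (N t : Measure (FiniteMeasure E)) (fun _ => a) := by
  have hf : IsBddBorelNonneg (fun _ : E => a) := isBddBorelNonneg_const ha.le
  rw [hL t _ hf]
  have h1 := (integral_le_immigrationMeasure (φ := φ) (Q := Q) (κ := κ) (F := F) le_rfl
    t.coe_nonneg ha.le fun s hs =>
      h.enorm_immigrationExponent_le_rate hf ha (fun _ => le_rfl) hs).trans
    (mul_le_mul_of_nonneg_left (measureReal_mono (subset_univ _)) ha.le)
  linarith [Real.one_sub_le_exp_neg
    (∫ s in (0 : ℝ)..t, immigrationExponent φ Q κ F s.toNNReal (fun _ => a))]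

/-- The limit law `N_∞` exists: each `N_{t+r}` dominates `exp (-(A_t - A_{t+r})) N_t`, where `A_t`
is a multiple of the tail of the immigration measure. -/
theorem exists_limit (h : IsMeasurableSuperprocess P φ Q)
    (hN : IsSkewConvolutionSemigroup Q N)
    (hL : ∀ (t : ℝ≥0) (f : E → ℝ), IsBddBorelNonneg f →
      laplace (N t : Measure (FiniteMeasure E)) f
        = Real.exp (-∫ s in (0 : ℝ)..t, immigrationExponent φ Q κ F s.toNNReal f))
    (hC0 : 0 < C) (hC : ∀ f, IsBddBorelNonneg f → ∀ x, cumulant Q T f x ≤ C) :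
    ∃ Ninf : ProbabilityMeasure (FiniteMeasure E),
      (∫⁻ ν, (ν : Measure E) univ ∂(Ninf : Measure (FiniteMeasure E)) < ⊤) ∧
      (∀ f : E → ℝ, IsBddBorelNonneg f →
        laplace (Ninf : Measure (FiniteMeasure E)) f
          = Real.exp (-∫ s in Ioi (0 : ℝ), immigrationExponent φ Q κ F s.toNNReal f)) ∧
      ∀ A, MeasurableSet A → Tendsto (fun n : ℕ => (N n : Measure (FiniteMeasure E)).real A)
        atTop (𝓝 ((Ninf : Measure (FiniteMeasure E)).real A)) := by
  set ρ := immigrationMeasure φ Q κ F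
  obtain ⟨Ninf, hlim⟩ := exists_probabilityMeasure_tendsto N
    (fun t : ℝ≥0 => C * ρ.real (Ioi ((t : ℝ) - T)))
    (by
      have h1 : Tendsto (fun t : ℝ≥0 => (t : ℝ) - T) atTop atTop :=
        tendsto_atTop_add_const_right _ _ (NNReal.tendsto_coe_atTop.2 tendsto_id)
      simpa using ((tendsto_measureReal_Ioi_atTop ρ).comp h1).const_mul C)
    T (fun t r hT B hB => by
      have h1 := h.exp_neg_le_measureReal_zero hN hL hC0 hC hT r
      rw [measureReal_Ioi_sub _ (by linarith [r.coe_nonneg]), mul_sub] at h1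
      have h2 := measureReal_zero_mul_le_conv _ (N t : Measure (FiniteMeasure E)) h1 hB
      rwa [← hN, add_comm r, ← NNReal.coe_add] at h2)
  have hlap : ∀ f : E → ℝ, IsBddBorelNonneg f →
      Tendsto (fun n : ℕ => laplace (N n : Measure (FiniteMeasure E)) f) atTop
        (𝓝 (laplace (Ninf : Measure (FiniteMeasure E)) f)) :=
    fun f hf => tendsto_laplace_of_tendsto_lintegral hlim hf
  refine ⟨Ninf, ?_, fun f hf => ?_, tendsto_measureReal_of_tendsto_lintegral hlim⟩
  · refine (lintegral_mass_le (Ninf : Measure (FiniteMeasure E)) (M := ρ.real univ)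
      (θ := fun n : ℕ => 1 / ((n : ℝ) + 1)) tendsto_one_div_add_atTop_nhds_zero_nat
      (fun n => by positivity) fun n => ?_).trans_lt ENNReal.ofReal_lt_top
    have hpos : (0 : ℝ) < 1 / ((n : ℝ) + 1) := by positivity
    rw [sub_le_comm]
    exact ge_of_tendsto (hlap _ (isBddBorelNonneg_const hpos.le))
      (Eventually.of_forall fun k => h.one_sub_le_laplace hL hpos k)
  · refine tendsto_nhds_unique (hlap f hf) ?_
    simp only [hL _ f hf]
    exact (Real.continuous_exp.tendsto _).comp (intervalIntegral_tendsto_integral_Ioi 0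
      (h.integrableOn_immigrationExponent hf)
      (tendsto_natCast_atTop_atTop (R := ℝ))).neg

end Immigration

end IsMeasurableSuperprocess

end

end ImmigrationSuperprocess

end

open ImmigrationSuperprocess in
theorem corollary4p18 {E : Type u} [TopologicalSpace E] [MeasurableSpace E] [BorelSpace E]
    (hE : IsLusinSpace E)
    {Ω : Type v} {mΩ : MeasurableSpace Ω} (P : ℝ≥0 → Kernel E E) (ℱ : Filtration ℝ≥0 mΩ)
    (ξ : ℝ≥0 → Ω → E ⊕ Unit) (Pr : E → Measure Ω) (hξ : IsBorelRightProcess P ℱ ξ Pr)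
    (φ : BranchingMechanism E)
    (Q : ℝ≥0 → Kernel (FiniteMeasure E) (FiniteMeasure E)) [∀ t, IsMarkovKernel (Q t)]
    (hQ : IsSuperprocessSemigroup P φ Q)
    (κ : EntranceLaw P) (F : Measure (EntranceLaw P)) [SigmaFinite F] (hF_zero : F {0} = 0)
    (hF : ∫⁻ s in Set.Ioc (0 : ℝ) 1, ∫⁻ ν : EntranceLaw P, ν.law s.toNNReal Set.univ ∂F < ⊤)
    (N : ℝ≥0 → ProbabilityMeasure (FiniteMeasure E)) (hN : IsSkewConvolutionSemigroup Q N)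
    (hN_laplace : ∀ (t : ℝ≥0) (f : E → ℝ), IsBddBorelNonneg f →
      laplace (N t : Measure (FiniteMeasure E)) f
        = Real.exp (-∫ s in (0 : ℝ)..t, immigrationExponent φ Q κ F s.toNNReal f))
    (h_moment : ∫⁻ s in Set.Ioi (0 : ℝ),
      (ENNReal.ofReal (κ.moment φ Q s.toNNReal (fun _ => 1))
        + ∫⁻ ν : EntranceLaw P, ENNReal.ofReal (ν.moment φ Q s.toNNReal (fun _ => 1)) ∂F) < ⊤)
    (ψ : CBMechanism) (hψ : ∀ (x : E) (z : ℝ), 0 ≤ z → ψ.eval z ≤ φ.localProjection x z)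
    (hψ_Grey : ψ.Grey) :
    ∃ Ninf : ProbabilityMeasure (FiniteMeasure E),
      -- `Ninf` has finite first moment and Laplace functional `exp (-∫₀^∞ I_s(κ,F,f) ds)`
      (∫⁻ ν, (ν : Measure E) Set.univ ∂(Ninf : Measure (FiniteMeasure E)) < ⊤) ∧
      (∀ f : E → ℝ, IsBddBorelNonneg f →
        IntegrableOn (fun s : ℝ => immigrationExponent φ Q κ F s.toNNReal f) (Set.Ioi 0) ∧
        laplace (Ninf : Measure (FiniteMeasure E)) f
          = Real.exp (-∫ s in Set.Ioi (0 : ℝ), immigrationExponent φ Q κ F s.toNNReal f)) ∧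
      -- (i)
      Tendsto (fun t : ℝ≥0 => tvDist (N t : Measure (FiniteMeasure E))
        (Ninf : Measure (FiniteMeasure E))) atTop (𝓝 0) ∧
      -- (ii)
      ((∀ x : E, Tendsto (fun t : ℝ≥0 => cumulantBar Q t x) atTop (𝓝 0)) →
        ∀ μ : FiniteMeasure E,
          Tendsto (fun t : ℝ≥0 => tvDist (immigrationTransition Q N t μ)
            (Ninf : Measure (FiniteMeasure E))) atTop (𝓝 0)) ∧
      -- (iii)
      (0 < φ.betaStar →
        ∃ C : ℝ, 0 ≤ C ∧ ∀ (t : ℝ≥0) (μ : FiniteMeasure E),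
          tvDist (immigrationTransition Q N t μ) (Ninf : Measure (FiniteMeasure E))
            ≤ C * (1 + (μ : Measure E).real Set.univ) * Real.exp (-(φ.betaStar * t))) := by
  obtain ⟨hmet, hsc⟩ := hE.metrizable_secondCountable
  have h : IsMeasurableSuperprocess P φ Q :=
    ⟨hξ.semigroup, hξ.measurable_uncurry, EntranceLaw.measurable_uncurry_law hξ, hQ⟩
  have hρ : IsFiniteMeasure (immigrationMeasure φ Q κ F) := by
    refine ⟨?_⟩
    rw [immigrationMeasure, withDensity_apply _ MeasurableSet.univ, Measure.restrict_univ]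
    exact h_moment
  set ρ := immigrationMeasure φ Q κ F with hρ_def
  obtain ⟨T, C₀, hC₀, hT⟩ := h.exists_cumulant_le hψ hψ_Grey
  obtain ⟨C, hC0, hC⟩ : ∃ C : ℝ, 0 < C ∧
      ∀ f, IsBddBorelNonneg f → ∀ x, cumulant Q T f x ≤ C :=
    ⟨C₀ + 1, by linarith, fun f hf x => (hT f hf x).trans (by linarith)⟩
  obtain ⟨Ninf, hmass, hlap, hlim⟩ := h.exists_limit hN hN_laplace hC0 hC
  have hn : ∀ n : ℕ, IsBddBorelNonneg (fun _ : E => (n : ℝ)) := fun n =>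
    isBddBorelNonneg_const n.cast_nonneg
  -- `A t` bounds the probability that mass immigrated before is still present at time `t`
  let A : ℝ≥0 → ℝ := fun t => C * ρ.real (Ioi ((t : ℝ) - T))
  have hA0 : ∀ t, 0 ≤ A t := fun t => mul_nonneg hC0.le measureReal_nonneg
  have hA : Tendsto A atTop (𝓝 0) := by
    have h1 : Tendsto (fun t : ℝ≥0 => (t : ℝ) - T) atTop atTop :=
      tendsto_atTop_add_const_right _ _ (NNReal.tendsto_coe_atTop.2 tendsto_id)
    simpa using ((tendsto_measureReal_Ioi_atTop ρ).comp h1).const_mul C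
  have hNA : ∀ t, T ≤ t → ∀ B, MeasurableSet B →
      |(N t : Measure (FiniteMeasure E)).real B - (Ninf : Measure (FiniteMeasure E)).real B|
        ≤ A t := fun t ht =>
    hN.abs_measureReal_sub_limit_le hlim (hA0 t) fun r => by
      refine le_trans ?_ (h.exp_neg_le_measureReal_zero hN hN_laplace hC0 hC ht r)
      refine le_trans ?_ (Real.one_sub_le_exp_neg _)
      exact sub_le_sub_left (mul_le_mul_of_nonneg_left (measureReal_mono Ioc_subset_Ioi_self)
        hC0.le) 1
  -- triangle inequality through `N t`
  have htri : ∀ (t : ℝ≥0) (μ : FiniteMeasure E) (δ δ' : ℝ), 0 ≤ δ' →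
      1 - δ' ≤ (Q t μ).real {0} →
      (∀ B, MeasurableSet B → |(N t : Measure (FiniteMeasure E)).real B
        - (Ninf : Measure (FiniteMeasure E)).real B| ≤ δ) →
      tvDist (immigrationTransition Q N t μ) (Ninf : Measure (FiniteMeasure E))
        ≤ 2 * (δ' + δ) := fun t μ δ δ' h0 h1 h2 =>
    tvDist_le_two_mul fun B hB => (abs_sub_le _ _ _).trans
      (add_le_add (abs_measureReal_conv_sub_le (Q t μ) (N t) h0 h1 B hB) (h2 B hB))
  refine ⟨Ninf, hmass, fun f hf => ⟨h.integrableOn_immigrationExponent hf, hlap f hf⟩, ?_, ?_, ?_⟩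
  · refine tendsto_of_tendsto_of_tendsto_of_le_of_le' tendsto_const_nhds
      (by simpa using hA.const_mul 2) (Eventually.of_forall fun t => ENNReal.toReal_nonneg) ?_
    filter_upwards [eventually_ge_atTop T] with t ht
    exact tvDist_le_two_mul (hNA t ht)
  · intro hV μ
    obtain ⟨δ, hδ, hδ'⟩ := h.exists_tendsto_one_sub_le hC hV μ
    refine tendsto_of_tendsto_of_tendsto_of_le_of_le' tendsto_const_nhds
      (by simpa using (hδ.add hA).const_mul 2)
      (Eventually.of_forall fun t => ENNReal.toReal_nonneg) ?_
    filter_upwards [eventually_ge_atTop T] with t ht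
    exact htri t μ _ _ (hδ' t ht).1 (hδ' t ht).2 (hNA t ht)
  · intro hβ
    set M := ρ.real univ
    have hM : 0 ≤ M := measureReal_nonneg
    have hm : ∀ μ : FiniteMeasure E, 0 ≤ (μ : Measure E).real univ := fun _ => measureReal_nonneg
    refine ⟨2 * Real.exp (φ.betaStar * T) * (C * (1 + M) + 1), by positivity, fun t μ => ?_⟩
    have hexp : Real.exp (φ.betaStar * T) * Real.exp (-(φ.betaStar * t))
        = Real.exp (-(φ.betaStar * (t - T))) := by rw [← Real.exp_add]; congr 1; ring
    have hm' := hm μ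
    rw [show 2 * Real.exp (φ.betaStar * T) * (C * (1 + M) + 1) * (1 + (μ : Measure E).real univ)
        * Real.exp (-(φ.betaStar * t)) = 2 * ((C * (1 + M) + 1) * (1 + (μ : Measure E).real univ))
        * Real.exp (-(φ.betaStar * (t - T))) by rw [← hexp]; ring]
    rcases le_or_gt T t with ht | ht
    · set e := Real.exp (-(φ.betaStar * (t - T))) with he
      have he0 : 0 < e := Real.exp_pos _
      have hK : 0 < C * e := mul_pos hC0 he0
      have hVK : ∀ (n : ℕ) x, cumulant Q t (fun _ => (n : ℝ)) x ≤ C * e := fun n x =>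
        h.cumulant_le_exp_of_le hC ht (hn n) x
      -- by time `t`, the descendants of `μ` and of earlier immigrants are extinct up to
      -- probability `C e μ(1)` and `C e M`
      have h1 : 1 - C * e * (μ : Measure E).real univ ≤ (Q t μ).real {0} := by
        refine h.one_sub_le_measureReal_zero fun n => ?_
        rw [← integral_const_finiteMeasure μ (C * e)]
        exact integral_mono ((h.isBddBorelNonneg_cumulant (hn n) t).integrable _)
          (integrable_const _) (hVK n)
      have h2 : ∀ r, 1 - C * e * M
          ≤ ((N r : Measure (FiniteMeasure E)).bind (Q t)).real {0} := fun r => by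
        refine le_measureReal_zero_of_le_laplace _ fun n => ?_
        rw [h.laplace_bind _ (hn n)]
        exact (h.one_sub_le_laplace hN_laplace hK r).trans
          (laplace_anti _ (h.isBddBorelNonneg_cumulant (hn n) t) (isBddBorelNonneg_const hK.le)
            (hVK n))
      refine (htri t μ (C * e * M) (C * e * (μ : Measure E).real univ) (by positivity) h1
        (hN.abs_measureReal_sub_limit_le hlim (by positivity) h2)).trans ?_
      have : (C * ((μ : Measure E).real univ + M)) * e
          ≤ ((C * (1 + M) + 1) * (1 + (μ : Measure E).real univ)) * e := by
        refine mul_le_mul_of_nonneg_right ?_ he0.le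
        have := mul_nonneg hC0.le (mul_nonneg hM hm')
        nlinarith
      linarith
    -- before time `T`, the trivial bound `2` suffices since `e^{β_*(T - t)} ≥ 1`
    · have hprob : IsProbabilityMeasure (immigrationTransition Q N t μ) := by
        unfold immigrationTransition; infer_instance
      have h1 : tvDist (immigrationTransition Q N t μ) (Ninf : Measure (FiniteMeasure E))
          ≤ 2 * 1 := tvDist_le_two_mul fun B _ => by
        have := measureReal_nonneg (μ := immigrationTransition Q N t μ) (s := B)
        have := measureReal_nonneg (μ := (Ninf : Measure (FiniteMeasure E))) (s := B)
        have := measureReal_le_one (μ := immigrationTransition Q N t μ) (s := B)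
        have := measureReal_le_one (μ := (Ninf : Measure (FiniteMeasure E))) (s := B)
        rw [abs_le]; constructor <;> linarith
      have h2 : 1 ≤ Real.exp (-(φ.betaStar * (t - T))) := by
        rw [Real.one_le_exp_iff]
        have : (t : ℝ) < T := NNReal.coe_lt_coe.2 ht
        nlinarith
      have h3 : 1 ≤ (C * (1 + M) + 1) * (1 + (μ : Measure E).real univ) := by
        have : 0 ≤ C * (1 + M) := by positivity
        nlinarith
      have h4 := mul_le_mul h3 h2 zero_le_one (zero_le_one.trans h3)
      linarith
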